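/- **Proposition (Relative Dilation Principle).** Let $R$ be a commutative ring with $1$ in which $2$ is invertible, and let $I\subsetneq R$ be an ideal. For an $R$-algebra $A$ and an $R$-module $M$ write $M_A=A\otimes_R M$; $I_A$ is the ideal of $A$ generated by $I$; $M[X]=M_{R[X]}$, $I[X]=I_{R[X]}$; a subscript $s$ denotes localization at $\{1,s,s^2,\dots\}$, and $I_s[X]=I_{R_s[X]}$. Let $P$ be a finitely generated projective $R$-module of constant rank $n$, and consider one of the following cases. * *Linear:* $n\ge 2$, $Q=P\oplus R$, $G(Q[X])=\mathrm{Aut}(Q[X])$, $N=n+1$. * *Symplectic (resp. orthogonal):* $n=2m\ge 6$; $P$ carries an alternating (resp. symmetric) bilinear form $\langle\,,\rangle$ inducing an isomorphism $P\cong P^*$; $Q=P\perp R^2$, where $R^2$ has the form $\langle (a,b),(a',b')\rangle=ab'-ba'$ (resp. $ab'+ba'$); $G(Q[X])$ is the group of isometries of $Q[X]$; $N=n+2$. In these cases assume (H2): for every non-nilpotent $t\in R$ such that $Q_t$ is a free $R_t$-module, $Q_t$ is isometric to $R_t^{2m+2}$ with the standard form $\sum_{i=1}^{m+1}(e_{2i-1,2i}-e_{2i,2i-1})$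 (resp. $\sum_{i=1}^{m+1}(e_{2i-1,2i}+e_{2i,2i-1})$). Let $G(Q[X],I[X])=\{\sigma\in G(Q[X]):(\sigma-\mathrm{Id})(Q[X])\subseteq I[X]\,Q[X]\}$. For a ring $A$ and an ideal $J\subseteq A$ let $E(N,A,J)$ be the normal closure, in the group generated by all elementary matrices $ge_{ij}(z)$ with $z\in A$, of the set of those with $z\in J$. Here, with $\pi(2i)=2i-1$ and $\pi(2i-1)=2i$, the elementary matrices are: $1+ze_{ij}$ ($i\neq j$) in the linear case; $1+ze_{ij}$ ($i=\pi(j)$) and $1+ze_{ij}-(-1)^{i+j}ze_{\pi(j)\pi(i)}$ ($i\ne j$, $i\neq\pi(j)$) in the symplectic case; $1+ze_{ij}-ze_{\pi(j)\pi(i)}$ ($i\ne j$, $i\ne\pi(j)$) in the orthogonal case. Let $ET(Q[X],I[X])$ be the normal closure, in the group generated by all elementary transvections of $Q[X]$, of those relative to $I[X]$. With $A=R[X]$, the elementary transvections relative to an ideal $J$ of $A$ are the following automorphisms (all elementary transvections: $J=A$). * Linear: $(p,a)\mapsto(p+ax,a)$ and $(p,a)\mapsto(p,a+\varphi(p))$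 with $x\in JP[X]$, $\varphi\in J\,P[X]^*$. * Symplectic: $(p,a,b)\mapsto(p+aq,\,a,\,b+\langle p,q\rangle+\alpha a)$ and $(p,a,b)\mapsto(p+bq,\,a-\langle p,q\rangle+\alpha b,\,b)$ with $q\in JP[X]$, $\alpha\in J$. * Orthogonal: $(p,a,b)\mapsto(p+aq,\,a,\,b-\langle p,q\rangle)$ and $(p,a,b)\mapsto(p+bq,\,a-\langle p,q\rangle,\,b)$ with $q\in JP[X]$, $\langle q,q\rangle=0$. Let $s\in R$ be non-nilpotent with $P_s$ a free $R_s$-module, and let $\sigma(X)\in G(Q[X],I[X])$ satisfy $\sigma(0)=\mathrm{Id}$. Suppose that $\sigma_s(X)\in E(N,R_s[X],I_s[X])$, where $Q_s$ is identified with $R_s^{N}$ by means of some basis of $P_s$ together with $(0,1)$ in the linear case, and by means of some isometry of $Q_s$ with $R_s^{2m+2}$ with its standard form otherwise. Then there is an integer $l>0$ such that for every $b\in (s^l)$ there exists $\widehat\sigma(X)\in ET(Q[X],I[X])$ with $\widehat\sigma(0)=\mathrm{Id}$ and $\widehat\sigma_s(X)=\sigma_s(bX)$. -/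

import Mathlib

open TensorProduct Polynomial

noncomputable section

namespace RelDilation

/-! ### Groups -/

/-- The subgroup generated by all conjugates of elements of `S` by elements of the subgroup `E`.
If `S ⊆ E`, it is the normal closure of `⟨S⟩` in `E`. -/
def normalClosureIn {G : Type*} [Group G] (E : Subgroup G) (S : Set G) : Subgroup G :=
  Subgroup.closure {x | ∃ g ∈ E, ∃ h ∈ S, x = g * h * g⁻¹}

/-! ### Elementary matrix groups -/

section Matrices

variable {A : Type*} [CommRing A]

/-- The elementary matrices `1 + z e_{ij}`, `i ≠ j`, with `z` in the ideal `J`. -/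
def linearGens (ι : Type*) [Fintype ι] [DecidableEq ι] (J : Ideal A) : Set (GL ι A) :=
  {g | ∃ i j : ι, i ≠ j ∧ ∃ z ∈ J, (g : Matrix ι ι A) = 1 + Matrix.single i j z}

/-- The relative elementary linear group `E(ι, A, J)`: the normal closure of `E(ι, J)` in
`E(ι, A)`. -/
def relE (ι : Type*) [Fintype ι] [DecidableEq ι] (J : Ideal A) : Subgroup (GL ι A) :=
  normalClosureIn (Subgroup.closure (linearGens ι (⊤ : Ideal A))) (linearGens ι J)

/-- The `2k` indices of the standard symplectic and hyperbolic forms, in pairs: `(i, false)` is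
the number `2i - 1` and `(i, true)` is the number `2i`. -/
abbrev PairIdx (k : ℕ) : Type := Fin k × Bool

/-- The permutation exchanging `2i - 1` and `2i`. -/
def swapIdx {k : ℕ} (u : PairIdx k) : PairIdx k := (u.1, !u.2)

/-- The matrix `∑ e_{2i-1,2i} + c ∑ e_{2i,2i-1}`: for `c = -1` the standard symplectic form,
for `c = 1` the standard hyperbolic symmetric form. -/
def stdForm (k : ℕ) (c : A) : Matrix (PairIdx k) (PairIdx k) A :=
  fun u v => if v = swapIdx u then (if u.2 then c else 1) else 0

/-- The elementary symplectic matrices `se_{ij}(z)` with `z` in the ideal `J`. The parity of an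
index is its second component. The restriction `i < j` for matrices of the second
type is omitted, since `se_{ij}(z) = se_{σ(j)σ(i)}(-(-1)^{i+j} z)`. -/
def symplecticGens (k : ℕ) (J : Ideal A) : Set (GL (PairIdx k) A) :=
  {g | (∃ i j : PairIdx k, i = swapIdx j ∧ ∃ z ∈ J,
          (g : Matrix (PairIdx k) (PairIdx k) A) = 1 + Matrix.single i j z) ∨
       (∃ i j : PairIdx k, i ≠ j ∧ i ≠ swapIdx j ∧ ∃ z ∈ J,
          (g : Matrix (PairIdx k) (PairIdx k) A) =
            1 + Matrix.single i j z
              - Matrix.single (swapIdx j) (swapIdx i) ((if i.2 = j.2 then 1 else -1) * z))}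

/-- The relative elementary symplectic group `ESp(2k, A, J)`. -/
def relESp (k : ℕ) (J : Ideal A) : Subgroup (GL (PairIdx k) A) :=
  normalClosureIn (Subgroup.closure (symplecticGens k (⊤ : Ideal A))) (symplecticGens k J)

/-- The elementary orthogonal matrices `oe_{ij}(z) = 1 + z e_{ij} - z e_{σ(j)σ(i)}`, `i ≠ j`,
`i ≠ σ(j)`, with `z` in the ideal `J`. Here `oe_{ij}(z) = oe_{σ(j)σ(i)}(-z)`. -/
def orthogonalGens (k : ℕ) (J : Ideal A) : Set (GL (PairIdx k) A) :=
  {g | ∃ i j : PairIdx k, i ≠ j ∧ i ≠ swapIdx j ∧ ∃ z ∈ J,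
          (g : Matrix (PairIdx k) (PairIdx k) A) =
            1 + Matrix.single i j z - Matrix.single (swapIdx j) (swapIdx i) z}

/-- The relative elementary orthogonal group `EO(2k, A, J)`. -/
def relEO (k : ℕ) (J : Ideal A) : Subgroup (GL (PairIdx k) A) :=
  normalClosureIn (Subgroup.closure (orthogonalGens k (⊤ : Ideal A))) (orthogonalGens k J)

end Matrices

/-! ### Bilinear forms -/

section Forms

variable {R : Type*} [CommRing R] {P : Type*} [AddCommGroup P] [Module R P]

/-- The form of `P ⊥ R²`:
`⟨(p, a, b), (p', a', b')⟩ = ⟨p, p'⟩ + a b' + c b a'`, where `R²` carries the standard symplectic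
form for `c = -1` and the standard hyperbolic symmetric form for `c = 1`. -/
def sumForm (B : LinearMap.BilinForm R P) (c : R) : LinearMap.BilinForm R (P × R × R) :=
  LinearMap.mk₂ R (fun v w => B v.1 w.1 + v.2.1 * w.2.2 + c * (v.2.2 * w.2.1))
    (fun v v' w => by simp; ring) (fun t v w => by simp; ring)
    (fun v w w' => by simp; ring) (fun t v w => by simp; ring)

/-- A symplectic form: alternating, and non-degenerate in the sense that it induces an isomorphism
of the module with its dual. -/
def IsSymplectic (B : LinearMap.BilinForm R P) : Prop :=
  B.IsAlt ∧ Function.Bijective (fun p : P => (B p : Module.Dual R P))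

/-- An orthogonal form: symmetric, and non-degenerate in the sense that it induces an isomorphism
of the module with its dual. -/
def IsOrthogonal (B : LinearMap.BilinForm R P) : Prop :=
  B.IsSymm ∧ Function.Bijective (fun p : P => (B p : Module.Dual R P))

/-- `b` identifies the module with `R^{2k}` with its standard form (see `stdForm`). -/
def IsStdBasis {k : ℕ} (B : LinearMap.BilinForm R P) (c : R)
    (b : Module.Basis (PairIdx k) R P) : Prop :=
  ∀ u v, B (b u) (b v) = stdForm k c u v

/-- Hypothesis (H2) for a module `Q` over `R` with form `B`: for every non-nilpotent `t`, if `Q_t`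
is free over `R_t`, then it is isometric to `R_t^{2k}` with its standard form. -/
def H2 (k : ℕ) (B : LinearMap.BilinForm R P) (c : R) : Prop :=
  ∀ t : R, ¬ IsNilpotent t →
    Module.Free (Localization.Away t) (Localization.Away t ⊗[R] P) →
    ∃ b : Module.Basis (PairIdx k) (Localization.Away t) (Localization.Away t ⊗[R] P),
      IsStdBasis (B.baseChange (Localization.Away t)) (algebraMap R _ c) b

end Forms

/-! ### Extension of scalars of endomorphisms -/

section BaseChange

variable {R : Type*} [CommRing R] {Q : Type*} [AddCommGroup Q] [Module R Q]

/-- For `f : A → B`, the `B`-linear endomorphism of `B ⊗ Q` induced by an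
`A`-linear endomorphism `φ` of `A ⊗ Q`, that is `b ⊗ q ↦ b • (f ⊗ 1)(φ (1 ⊗ q))`. -/
def extend {A B : Type*} [CommRing A] [Algebra R A] [CommRing B] [Algebra R B]
    (f : A →ₐ[R] B) (φ : A ⊗[R] Q →ₗ[A] A ⊗[R] Q) : B ⊗[R] Q →ₗ[B] B ⊗[R] Q :=
  LinearMap.liftBaseChange B
    (f.toLinearMap.rTensor Q ∘ₗ φ.restrictScalars R ∘ₗ TensorProduct.mk R A Q 1)

/-- `σ(0)`, an endomorphism of `R ⊗ Q = Q`. -/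
def atZero (σ : R[X] ⊗[R] Q →ₗ[R[X]] R[X] ⊗[R] Q) : R ⊗[R] Q →ₗ[R] R ⊗[R] Q :=
  extend (aeval (0 : R)) σ

/-- `σ(bX)`. -/
def scale (b : R) (σ : R[X] ⊗[R] Q →ₗ[R[X]] R[X] ⊗[R] Q) :
    R[X] ⊗[R] Q →ₗ[R[X]] R[X] ⊗[R] Q :=
  extend (aeval (C b * X : R[X])) σ

/-- `σ_s(X)`, an endomorphism of `Q_s[X] = R_s[X] ⊗ Q`. -/
def localize (s : R) (σ : R[X] ⊗[R] Q →ₗ[R[X]] R[X] ⊗[R] Q) :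
    (Localization.Away s)[X] ⊗[R] Q →ₗ[(Localization.Away s)[X]]
      (Localization.Away s)[X] ⊗[R] Q :=
  extend (mapAlgHom (Algebra.ofId R (Localization.Away s))) σ

/-- The canonical map `Q_s → Q_s[X]`. -/
def constMap (s : R) (Q : Type*) [AddCommGroup Q] [Module R Q] :
    Localization.Away s ⊗[R] Q →ₗ[R] (Localization.Away s)[X] ⊗[R] Q :=
  (IsScalarTower.toAlgHom R (Localization.Away s) (Localization.Away s)[X]).toLinearMap.rTensor Q

/-- The matrix over `R_s[X]` of `σ_s(X)` with respect to the (constant) family `b` in `Q_s`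
belongs to `E`. -/
def MatrixMem {ι : Type*} [Fintype ι] [DecidableEq ι] (s : R)
    (b : ι → Localization.Away s ⊗[R] Q) (E : Subgroup (GL ι (Localization.Away s)[X]))
    (σ : R[X] ⊗[R] Q →ₗ[R[X]] R[X] ⊗[R] Q) : Prop :=
  ∃ g ∈ E, ∀ v, localize s σ (constMap s Q (b v)) =
    ∑ u, (g : Matrix ι ι (Localization.Away s)[X]) u v • constMap s Q (b u)

/-- The automorphism `σ` of `M` is congruent to the identity modulo `J`. -/
def CongrOne {A M : Type*} [CommRing A] [AddCommGroup M] [Module A M] (J : Ideal A)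
    (σ : M ≃ₗ[A] M) : Prop :=
  ∀ v, σ v - v ∈ J • (⊤ : Submodule A M)

/-- The automorphism `σ` of `M` preserves the bilinear form `B`. -/
def IsIsometry {A M : Type*} [CommRing A] [AddCommGroup M] [Module A M]
    (B : LinearMap.BilinForm A M) (σ : M ≃ₗ[A] M) : Prop :=
  ∀ v w, B (σ v) (σ w) = B v w

end BaseChange

/-! ### Elementary transvections -/

section Transvections

variable {R : Type*} [CommRing R] {P : Type*} [AddCommGroup P] [Module R P]
  (A : Type*) [CommRing A] [Algebra R A]

/-- The canonical isomorphism of `A ⊗ (P ⊕ R)` with `(A ⊗ P) ⊕ A`. -/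
def splitLin (P : Type*) [AddCommGroup P] [Module R P] :
    A ⊗[R] (P × R) ≃ₗ[A] (A ⊗[R] P) × A :=
  TensorProduct.prodRight R A A P R ≪≫ₗ
    LinearEquiv.prodCongr (LinearEquiv.refl A _) (AlgebraTensorModule.rid R A A)

/-- The canonical isomorphism of `A ⊗ (P ⊕ R²)` with `(A ⊗ P) ⊕ A²`. -/
def splitForm (P : Type*) [AddCommGroup P] [Module R P] :
    A ⊗[R] (P × R × R) ≃ₗ[A] (A ⊗[R] P) × A × A :=
  TensorProduct.prodRight R A A P (R × R) ≪≫ₗ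
    LinearEquiv.prodCongr (LinearEquiv.refl A _)
      (TensorProduct.prodRight R A A R R ≪≫ₗ
        LinearEquiv.prodCongr (AlgebraTensorModule.rid R A A) (AlgebraTensorModule.rid R A A))

/-- The elementary transvections `(p, a) ↦ (p + a x, a)` and `(p, a) ↦ (p, a + φ(p))` of
`(A ⊗ P) ⊕ A` with `x ∈ J (A ⊗ P)` and `φ ∈ J (A ⊗ P)^*`. -/
def transGens (P : Type*) [AddCommGroup P] [Module R P] (J : Ideal A) :
    Set ((A ⊗[R] (P × R)) ≃ₗ[A] (A ⊗[R] (P × R))) :=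
  {g | (∃ x ∈ J • (⊤ : Submodule A (A ⊗[R] P)), ∀ p a,
          g ((splitLin A P).symm (p, a)) = (splitLin A P).symm (p + a • x, a)) ∨
       (∃ φ ∈ J • (⊤ : Submodule A (Module.Dual A (A ⊗[R] P))), ∀ p a,
          g ((splitLin A P).symm (p, a)) = (splitLin A P).symm (p, a + φ p))}

/-- The relative elementary transvection group `ETrans(A ⊗ (P ⊕ R), J)`: the normal closure,
in the group generated by all elementary transvections, of those relative to `J`. -/
def relETrans (P : Type*) [AddCommGroup P] [Module R P] (J : Ideal A) :
    Subgroup ((A ⊗[R] (P × R)) ≃ₗ[A] (A ⊗[R] (P × R))) :=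
  normalClosureIn (Subgroup.closure (transGens A P ⊤)) (transGens A P J)

/-- The elementary symplectic transvections
`(p, a, b) ↦ (p + a q, a, b + ⟨p, q⟩ + α a)` and `(p, a, b) ↦ (p + b q, a - ⟨p, q⟩ + α b, b)`
of `A ⊗ (P ⊥ R²)` with `q ∈ J (A ⊗ P)` and `α ∈ J`. -/
def transSpGens (B : LinearMap.BilinForm R P) (J : Ideal A) :
    Set ((A ⊗[R] (P × R × R)) ≃ₗ[A] (A ⊗[R] (P × R × R))) :=
  {g | (∃ q ∈ J • (⊤ : Submodule A (A ⊗[R] P)), ∃ α ∈ J, ∀ p a b,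
          g ((splitForm A P).symm (p, a, b)) =
            (splitForm A P).symm (p + a • q, a, b + B.baseChange A p q + α * a)) ∨
       (∃ q ∈ J • (⊤ : Submodule A (A ⊗[R] P)), ∃ α ∈ J, ∀ p a b,
          g ((splitForm A P).symm (p, a, b)) =
            (splitForm A P).symm (p + b • q, a - B.baseChange A p q + α * b, b))}

/-- The relative elementary symplectic transvection group `ETrans_Sp(A ⊗ (P ⊥ R²), J)`. -/
def relETransSp (B : LinearMap.BilinForm R P) (J : Ideal A) :
    Subgroup ((A ⊗[R] (P × R × R)) ≃ₗ[A] (A ⊗[R] (P × R × R))) :=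
  normalClosureIn (Subgroup.closure (transSpGens A B ⊤)) (transSpGens A B J)

/-- The elementary orthogonal transvections
`(p, a, b) ↦ (p + a q, a, b - ⟨p, q⟩)` and `(p, a, b) ↦ (p + b q, a - ⟨p, q⟩, b)`
of `A ⊗ (P ⊥ R²)` with `q ∈ J (A ⊗ P)` isotropic. -/
def transOGens (B : LinearMap.BilinForm R P) (J : Ideal A) :
    Set ((A ⊗[R] (P × R × R)) ≃ₗ[A] (A ⊗[R] (P × R × R))) :=
  {g | (∃ q ∈ J • (⊤ : Submodule A (A ⊗[R] P)), B.baseChange A q q = 0 ∧ ∀ p a b,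
          g ((splitForm A P).symm (p, a, b)) =
            (splitForm A P).symm (p + a • q, a, b - B.baseChange A p q)) ∨
       (∃ q ∈ J • (⊤ : Submodule A (A ⊗[R] P)), B.baseChange A q q = 0 ∧ ∀ p a b,
          g ((splitForm A P).symm (p, a, b)) =
            (splitForm A P).symm (p + b • q, a - B.baseChange A p q, b))}

/-- The relative elementary orthogonal transvection group `ETrans_O(A ⊗ (P ⊥ R²), J)`. -/
def relETransO (B : LinearMap.BilinForm R P) (J : Ideal A) :
    Subgroup ((A ⊗[R] (P × R × R)) ≃ₗ[A] (A ⊗[R] (P × R × R))) :=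
  normalClosureIn (Subgroup.closure (transOGens A B ⊤)) (transOGens A B J)

end Transvections

/-! ### Membership of `σ_s(X)` in the relative elementary groups -/

section LocalCondition

variable {R : Type*} [CommRing R] {P : Type*} [AddCommGroup P] [Module R P]

/-- The family in `Q_s = (P ⊕ R)_s` formed by a family `e` in `P_s` and the vector `(0, 1)`. -/
def addOne {n : ℕ} (s : R) (e : Fin n → Localization.Away s ⊗[R] P) :
    Fin n ⊕ Unit → Localization.Away s ⊗[R] (P × R) :=
  Sum.elim (fun i => (LinearMap.inl R P R).lTensor (Localization.Away s) (e i))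
    (fun _ => (1 : Localization.Away s) ⊗ₜ[R] ((0 : P), (1 : R)))

/-- `σ_s(X) ∈ E(n + 1, R_s[X], I_s[X])`, where `Q_s = P_s ⊕ R_s` is identified with `R_s^{n+1}` by
means of a basis of `P_s`. -/
def LocElemLin (n : ℕ) (I : Ideal R) (s : R)
    (σ : R[X] ⊗[R] (P × R) →ₗ[R[X]] R[X] ⊗[R] (P × R)) : Prop :=
  ∃ e : Module.Basis (Fin n) (Localization.Away s) (Localization.Away s ⊗[R] P),
    MatrixMem s (addOne s e)
      (relE (Fin n ⊕ Unit) (I.map (algebraMap R (Localization.Away s)[X]))) σ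

/-- `σ_s(X) ∈ ESp(2k, R_s[X], I_s[X])`, where `Q_s`, with the form `B`, is identified with
`R_s^{2k}` with its standard symplectic form. -/
def LocElemSp {Q : Type*} [AddCommGroup Q] [Module R Q] (k : ℕ) (B : LinearMap.BilinForm R Q)
    (I : Ideal R) (s : R) (σ : R[X] ⊗[R] Q →ₗ[R[X]] R[X] ⊗[R] Q) : Prop :=
  ∃ b : Module.Basis (PairIdx k) (Localization.Away s) (Localization.Away s ⊗[R] Q),
    IsStdBasis (B.baseChange (Localization.Away s)) (-1) b ∧
    MatrixMem s b (relESp k (I.map (algebraMap R (Localization.Away s)[X]))) σ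

/-- `σ_s(X) ∈ EO(2k, R_s[X], I_s[X])`, where `Q_s`, with the form `B`, is identified with
`R_s^{2k}` with its standard hyperbolic symmetric form. -/
def LocElemO {Q : Type*} [AddCommGroup Q] [Module R Q] (k : ℕ) (B : LinearMap.BilinForm R Q)
    (I : Ideal R) (s : R) (σ : R[X] ⊗[R] Q →ₗ[R[X]] R[X] ⊗[R] Q) : Prop :=
  ∃ b : Module.Basis (PairIdx k) (Localization.Away s) (Localization.Away s ⊗[R] Q),
    IsStdBasis (B.baseChange (Localization.Away s)) 1 b ∧
    MatrixMem s b (relEO k (I.map (algebraMap R (Localization.Away s)[X]))) σ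

end LocalCondition

end RelDilation

end

/-! The relative group is first traded for an absolute one. Over the double of `A` along `J`, the
ring of pairs congruent modulo `J`, a relative elementary matrix is the first component of an
elementary matrix with trivial second component (`exists_lift_double`). Conversely, `τ ↦ fst τ *
(snd τ)⁻¹` maps elementary automorphisms over the double into the relative group
(`fst_mul_inv_snd_mem`). So `σ_s` is replaced by an elementary matrix `g'` over the double of
`R_s[X]` with `g'(0) = 1`.

Such a matrix is a product of conjugates `γ (1 + z Y) γ⁻¹` with `γ` constant and `z(0) = 0`
(`mem_closure_kernelGens`). The substitution `X ↦ s ^ l X` fixes `γ` and, for large `l`, makes `z`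
equal to `s ^ M` times an element coming from the double of `R[X]` (`exists_doubleScale_pow_eq`). It
therefore suffices to lift `γ (1 + s ^ M h Y) γ⁻¹` to a product of elementary transvections, with
one `M` for all `h`; this is `HasDenominators`. The lift is then corrected by factors that are
trivial over `R_s[X]`, so that it becomes relative and equal to the identity at `X = 0`, and `X ↦ c'
X` yields all multiples of `s ^ l` (`exists_dilation`).

`HasDenominators` is a normality statement in which powers of `s` replace units, and it is proved
case by case. Linear: the conjugate is a transvection along a vector `u` on which some functional
takes a power of `s` as its value; functionals killing `u` then split into Koszul pieces, each a
product of commutators of elementary transvections (`linTrans_unimodular_mem`). Symplectic: root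
elements are products of maps `x ↦ x + h ⟨x, w⟩ w`, and these are elementary for every `w` as soon
as `h` is a multiple of a value of the form on `P` (`symTrans_add_mem`). Orthogonal: for isotropic
`w`, a power of `s` times every vector `⟨w, u⟩ v - ⟨w, v⟩ u` is an elementary parameter with axis
`w` (`exists_pow_smul_koszul_mem`). The argument needs a hyperbolic frame of `P`, whereas only `Q_s`
is given as hyperbolic; frames of `P` appear after inverting further coordinates, and the results
are glued through the radical of an ideal. -/

noncomputable section

namespace RelDilation

/-! ### Functoriality of the extension of scalars -/

section ExtendFunctor

variable {R : Type*} [CommRing R] {Q : Type*} [AddCommGroup Q] [Module R Q]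
  {A B C : Type*} [CommRing A] [Algebra R A] [CommRing B] [Algebra R B] [CommRing C] [Algebra R C]

/-- The additive map `A ⊗ Q → B ⊗ Q` induced by `f : A → B`. -/
def scalarMap (Q : Type*) [AddCommGroup Q] [Module R Q] (f : A →ₐ[R] B) :
    A ⊗[R] Q →ₗ[R] B ⊗[R] Q :=
  f.toLinearMap.rTensor Q

@[simp] theorem scalarMap_tmul (f : A →ₐ[R] B) (a : A) (q : Q) :
    scalarMap Q f (a ⊗ₜ q) = f a ⊗ₜ q := rfl

theorem scalarMap_smul (f : A →ₐ[R] B) (a : A) (x : A ⊗[R] Q) :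
    scalarMap Q f (a • x) = f a • scalarMap Q f x := by
  induction x using TensorProduct.induction_on with
  | zero => simp
  | tmul b q => simp [TensorProduct.smul_tmul']
  | add x y hx hy => rw [smul_add, map_add, hx, hy, map_add, smul_add]

theorem scalarMap_comp (g : B →ₐ[R] C) (f : A →ₐ[R] B) (x : A ⊗[R] Q) :
    scalarMap Q (g.comp f) x = scalarMap Q g (scalarMap Q f x) := by
  induction x using TensorProduct.induction_on with
  | zero => simp
  | tmul b q => simp
  | add x y hx hy => rw [map_add, hx, hy, map_add, map_add]

theorem extend_scalarMap (f : A →ₐ[R] B) (φ : A ⊗[R] Q →ₗ[A] A ⊗[R] Q) (x : A ⊗[R] Q) :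
    extend f φ (scalarMap Q f x) = scalarMap Q f (φ x) := by
  induction x using TensorProduct.induction_on with
  | zero => simp
  | tmul a q =>
    have : (a ⊗ₜ[R] q : A ⊗[R] Q) = a • ((1 : A) ⊗ₜ[R] q) := by simp [TensorProduct.smul_tmul']
    rw [scalarMap_tmul, this, map_smul, scalarMap_smul]
    simp [extend, scalarMap]
  | add x y hx hy => rw [map_add, map_add, hx, hy, map_add, map_add]

theorem hom_ext_scalarMap (f : A →ₐ[R] B) {φ ψ : B ⊗[R] Q →ₗ[B] B ⊗[R] Q}
    (h : ∀ x, φ (scalarMap Q f x) = ψ (scalarMap Q f x)) : φ = ψ := by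
  apply TensorProduct.AlgebraTensorModule.curry_injective
  ext q
  simpa using h (1 ⊗ₜ q)

/-- Compatibility with `φ` along `scalarMap` characterises `extend f φ`; most identities between
extensions are checked in this form. -/
theorem eq_extend (f : A →ₐ[R] B) {φ : A ⊗[R] Q →ₗ[A] A ⊗[R] Q} {ψ : B ⊗[R] Q →ₗ[B] B ⊗[R] Q}
    (h : ∀ x, ψ (scalarMap Q f x) = scalarMap Q f (φ x)) : extend f φ = ψ :=
  hom_ext_scalarMap f fun x => by rw [extend_scalarMap, h]

/-- `extend f` as a homomorphism of monoids. -/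
def extendHom (Q : Type*) [AddCommGroup Q] [Module R Q] (f : A →ₐ[R] B) :
    Module.End A (A ⊗[R] Q) →* Module.End B (B ⊗[R] Q) where
  toFun φ := extend f φ
  map_one' := eq_extend f fun x => rfl
  map_mul' φ ψ := eq_extend f fun x => by
    rw [Module.End.mul_apply, extend_scalarMap, extend_scalarMap, Module.End.mul_apply]

theorem extend_extend (g : B →ₐ[R] C) (f : A →ₐ[R] B) (φ : A ⊗[R] Q →ₗ[A] A ⊗[R] Q) :
    extend g (extend f φ) = extend (g.comp f) φ :=
  (eq_extend (g.comp f) fun x => by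
    rw [scalarMap_comp, extend_scalarMap, extend_scalarMap, scalarMap_comp]).symm

/-- `extend f` on automorphisms. -/
def extendEquiv (Q : Type*) [AddCommGroup Q] [Module R Q] (f : A →ₐ[R] B) :
    ((A ⊗[R] Q) ≃ₗ[A] (A ⊗[R] Q)) →* ((B ⊗[R] Q) ≃ₗ[B] (B ⊗[R] Q)) :=
  (LinearMap.GeneralLinearGroup.generalLinearEquiv B (B ⊗[R] Q)).toMonoidHom.comp
    ((Units.map (extendHom Q f)).comp
      (LinearMap.GeneralLinearGroup.generalLinearEquiv A (A ⊗[R] Q)).symm.toMonoidHom)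

@[simp] theorem coe_extendEquiv (f : A →ₐ[R] B) (g : (A ⊗[R] Q) ≃ₗ[A] (A ⊗[R] Q)) :
    (extendEquiv Q f g).toLinearMap = extend f g.toLinearMap := by
  ext x; rfl

theorem coe_mul_equiv {M : Type*} [AddCommGroup M] [Module A M] (g h : M ≃ₗ[A] M) :
    (g * h).toLinearMap = (g.toLinearMap * h.toLinearMap : Module.End A M) := rfl

theorem extend_baseChange (f : A →ₐ[R] B) (N : Module.End R Q) :
    extend f (N.baseChange A) = N.baseChange B :=
  eq_extend f fun x => by
    induction x using TensorProduct.induction_on with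
    | zero => simp
    | tmul a q => simp
    | add x y hx hy => rw [map_add, map_add, hx, hy, map_add, map_add]

theorem extend_one_add_smul (f : A →ₐ[R] B) (a : A) (φ : A ⊗[R] Q →ₗ[A] A ⊗[R] Q) :
    extend f (1 + a • φ : Module.End A (A ⊗[R] Q)) = (1 + f a • extend f φ : Module.End B _) :=
  eq_extend f fun x => by
    simp [extend_scalarMap, scalarMap_smul]

end ExtendFunctor

/-! ### Root elements -/

section RootElements

theorem normalClosureIn_mono {G : Type*} [Group G] {E E' : Subgroup G} {S S' : Set G}
    (hE : E ≤ E') (hS : S ⊆ S') : normalClosureIn E S ≤ normalClosureIn E' S' :=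
  Subgroup.closure_mono fun _ ⟨g, hg, h, hh, hx⟩ => ⟨g, hE hg, h, hS hh, hx⟩

theorem subset_normalClosureIn {G : Type*} [Group G] (E : Subgroup G) (S : Set G) :
    S ⊆ normalClosureIn E S := fun h hh =>
  Subgroup.subset_closure ⟨1, E.one_mem, h, hh, by simp⟩

theorem conj_mem_normalClosureIn {G : Type*} [Group G] {E : Subgroup G} {S : Set G} {g x : G}
    (hg : g ∈ E) (hx : x ∈ normalClosureIn E S) : g * x * g⁻¹ ∈ normalClosureIn E S := by
  induction hx using Subgroup.closure_induction with
  | mem x hx =>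
    obtain ⟨k, hk, h, hh, rfl⟩ := hx
    exact Subgroup.subset_closure ⟨g * k, E.mul_mem hg hk, h, hh, by group⟩
  | one => simp
  | mul x y _ _ hx hy =>
    have := Subgroup.mul_mem _ hx hy
    convert this using 1; group
  | inv x _ hx =>
    have := Subgroup.inv_mem _ hx
    convert this using 1; group

theorem map_mem_normalClosureIn {G H : Type*} [Group G] [Group H] (f : G →* H)
    {E : Subgroup G} {S : Set G} {E' : Subgroup H} {S' : Set H}
    (hE : ∀ g ∈ E, f g ∈ E') (hS : ∀ h ∈ S, f h ∈ S') {x : G} (hx : x ∈ normalClosureIn E S) :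
    f x ∈ normalClosureIn E' S' := by
  induction hx using Subgroup.closure_induction with
  | mem x hx =>
    obtain ⟨k, hk, h, hh, rfl⟩ := hx
    exact Subgroup.subset_closure ⟨f k, hE k hk, f h, hS h hh, by simp⟩
  | one => simp
  | mul x y _ _ hx hy => rw [map_mul]; exact Subgroup.mul_mem _ hx hy
  | inv x _ hx => rw [map_inv]; exact Subgroup.inv_mem _ hx

theorem map_mem_closure {G H : Type*} [Group G] [Group H] (f : G →* H) {S : Set G} {S' : Set H}
    (hS : ∀ h ∈ S, f h ∈ S') {x : G} (hx : x ∈ Subgroup.closure S) :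
    f x ∈ Subgroup.closure S' :=
  (Subgroup.closure_le (K := (Subgroup.closure S').comap f)).2
    (fun h hh => Subgroup.subset_closure (hS h hh)) hx

variable {A B : Type*} [CommRing A] [CommRing B]

theorem exists_unit_one_add_smul {E : Type*} [Ring E] [Algebra A E] {N : E} (hN : N * N = 0)
    (z : A) : ∃ u : Eˣ, (u : E) = 1 + z • N :=
  ⟨⟨1 + z • N, 1 - z • N, by rw [mul_sub, add_mul, add_mul, smul_mul_smul_comm, hN]; simp,
    by rw [mul_add, sub_mul, sub_mul, smul_mul_smul_comm, hN]; simp⟩, rfl⟩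

theorem one_add_smul_mul_one_add_smul {E : Type*} [Ring E] [Algebra A E] {N : E} (hN : N * N = 0)
    (y z : A) : (1 + y • N) * (1 + z • N) = 1 + (y + z) • N := by
  rw [mul_add, add_mul, add_mul, smul_mul_smul_comm, hN, add_smul]
  simp [add_assoc]

/-- The invertible matrices `1 + z Y` with `z ∈ J` and `Y` in a set of integral matrices. -/
def rootMatrices {ι : Type*} [Fintype ι] [DecidableEq ι] (𝒴 : Set (Matrix ι ι ℤ)) (J : Ideal A) :
    Set (GL ι A) :=
  {g | ∃ Y ∈ 𝒴, ∃ z ∈ J, (g : Matrix ι ι A) = 1 + z • Y.map (Int.castRingHom A)}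

section

variable {ι : Type*} [Fintype ι] [DecidableEq ι] {𝒴 : Set (Matrix ι ι ℤ)}

theorem exists_rootMatrix {Y : Matrix ι ι ℤ} (hY : Y * Y = 0) (z : A) :
    ∃ g : GL ι A, (g : Matrix ι ι A) = 1 + z • Y.map (Int.castRingHom A) := by
  have h : Y.map (Int.castRingHom A) * Y.map (Int.castRingHom A) = 0 := by
    rw [← Matrix.map_mul, hY]; simp
  exact exists_unit_one_add_smul h z

theorem map_rootMatrix (f : A →+* B) {g : GL ι A} {Y : Matrix ι ι ℤ} {z : A}
    (hg : (g : Matrix ι ι A) = 1 + z • Y.map (Int.castRingHom A)) :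
    (Matrix.GeneralLinearGroup.map f g : Matrix ι ι B) = 1 + f z • Y.map (Int.castRingHom B) := by
  ext i j
  rw [Matrix.GeneralLinearGroup.map_apply, hg]
  simp [Matrix.one_apply, apply_ite f]

theorem map_mem_rootMatrices (f : A →+* B) {J : Ideal A} {J' : Ideal B} (hf : J ≤ J'.comap f)
    {g : GL ι A} (hg : g ∈ rootMatrices 𝒴 J) :
    Matrix.GeneralLinearGroup.map f g ∈ rootMatrices 𝒴 J' := by
  obtain ⟨Y, hY, z, hz, h⟩ := hg
  exact ⟨Y, hY, f z, hf hz, map_rootMatrix f h⟩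

theorem map_mem_closure_rootMatrices (f : A →+* B) {g : GL ι A}
    (hg : g ∈ Subgroup.closure (rootMatrices 𝒴 (⊤ : Ideal A))) :
    Matrix.GeneralLinearGroup.map f g ∈ Subgroup.closure (rootMatrices 𝒴 (⊤ : Ideal B)) :=
  map_mem_closure _ (fun _ hh => map_mem_rootMatrices f (fun _ _ => Submodule.mem_top) hh) hg

end

variable {R : Type*} [CommRing R] {Q : Type*} [AddCommGroup Q] [Module R Q]
  [Algebra R A] [Algebra R B]

/-- The automorphisms `1 + h N` of `A ⊗ Q` with `h ∈ J` and `N` in a set of endomorphisms of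
`Q`. -/
def rootAuts (𝒩 : Set (Module.End R Q)) (J : Ideal A) : Set ((A ⊗[R] Q) ≃ₗ[A] (A ⊗[R] Q)) :=
  {g | ∃ N ∈ 𝒩, ∃ h ∈ J, g.toLinearMap = (1 + h • N.baseChange A : Module.End A (A ⊗[R] Q))}

theorem baseChange_sq {N : Module.End R Q} (hN : N * N = 0) :
    (N.baseChange A * N.baseChange A : Module.End A (A ⊗[R] Q)) = 0 := by
  rw [← LinearMap.baseChange_mul, hN, LinearMap.baseChange_zero]

theorem exists_rootAut {N : Module.End R Q} (hN : N * N = 0) (h : A) :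
    ∃ g : (A ⊗[R] Q) ≃ₗ[A] (A ⊗[R] Q),
      g.toLinearMap = (1 + h • N.baseChange A : Module.End A (A ⊗[R] Q)) := by
  obtain ⟨u, hu⟩ := exists_unit_one_add_smul (E := Module.End A (A ⊗[R] Q)) (baseChange_sq hN) h
  exact ⟨LinearMap.GeneralLinearGroup.generalLinearEquiv A _ u, hu⟩

theorem extend_mem_rootAuts {𝒩 : Set (Module.End R Q)} (f : A →ₐ[R] B) {J : Ideal A}
    {J' : Ideal B} (hf : ∀ x ∈ J, f x ∈ J') {g : (A ⊗[R] Q) ≃ₗ[A] (A ⊗[R] Q)}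
    (hg : g ∈ rootAuts 𝒩 J) : extendEquiv Q f g ∈ rootAuts 𝒩 J' := by
  obtain ⟨N, hN, h, hh, e⟩ := hg
  refine ⟨N, hN, f h, hf h hh, ?_⟩
  rw [coe_extendEquiv, e, extend_one_add_smul, extend_baseChange]

theorem extend_mem_closure_rootAuts {𝒩 : Set (Module.End R Q)} (f : A →ₐ[R] B)
    {g : (A ⊗[R] Q) ≃ₗ[A] (A ⊗[R] Q)}
    (hg : g ∈ Subgroup.closure (rootAuts 𝒩 (⊤ : Ideal A))) :
    extendEquiv Q f g ∈ Subgroup.closure (rootAuts 𝒩 (⊤ : Ideal B)) :=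
  map_mem_closure _ (fun _ hh => extend_mem_rootAuts f (fun _ _ => Submodule.mem_top) hh) hg

theorem extend_mem_relRootAuts {𝒩 : Set (Module.End R Q)} (f : A →ₐ[R] B) {J : Ideal A}
    {J' : Ideal B} (hf : ∀ x ∈ J, f x ∈ J') {g : (A ⊗[R] Q) ≃ₗ[A] (A ⊗[R] Q)}
    (hg : g ∈ normalClosureIn (Subgroup.closure (rootAuts 𝒩 (⊤ : Ideal A))) (rootAuts 𝒩 J)) :
    extendEquiv Q f g ∈
      normalClosureIn (Subgroup.closure (rootAuts 𝒩 (⊤ : Ideal B))) (rootAuts 𝒩 J') :=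
  map_mem_normalClosureIn _ (fun _ hg => extend_mem_closure_rootAuts f hg)
    (fun _ hh => extend_mem_rootAuts f hf hh) hg

end RootElements

/-! ### The double of a ring along an ideal -/

section Double

variable {A B : Type*} [CommRing A] [CommRing B]

/-- The ring of pairs of elements of `A` that are congruent modulo `J`. -/
def Double (J : Ideal A) : Subalgebra A (A × A) where
  carrier := {x | x.1 - x.2 ∈ J}
  mul_mem' {x y} hx hy := by
    have : (x * y).1 - (x * y).2 = x.1 * (y.1 - y.2) + y.2 * (x.1 - x.2) := by
      simp; ring
    rw [Set.mem_ofPred_eq, this]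
    exact J.add_mem (J.mul_mem_left _ hy) (J.mul_mem_left _ hx)
  add_mem' {x y} hx hy := by
    have : (x + y).1 - (x + y).2 = (x.1 - x.2) + (y.1 - y.2) := by simp; ring
    rw [Set.mem_ofPred_eq, this]
    exact J.add_mem hx hy
  algebraMap_mem' a := by simp

theorem mem_double {J : Ideal A} {x : A × A} : x ∈ Double J ↔ x.1 - x.2 ∈ J := Iff.rfl

variable {R : Type*} [CommRing R] [Algebra R A] [Algebra R B]

/-- The first projection of the double. -/
def Double.fst (R : Type*) [CommRing R] [Algebra R A] (J : Ideal A) : Double J →ₐ[R] A where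
  toFun x := x.1.1
  map_one' := rfl
  map_mul' _ _ := rfl
  map_zero' := rfl
  map_add' _ _ := rfl
  commutes' _ := rfl

/-- The second projection of the double. -/
def Double.snd (R : Type*) [CommRing R] [Algebra R A] (J : Ideal A) : Double J →ₐ[R] A where
  toFun x := x.1.2
  map_one' := rfl
  map_mul' _ _ := rfl
  map_zero' := rfl
  map_add' _ _ := rfl
  commutes' _ := rfl

/-- Functoriality of the double. -/
def Double.map {J : Ideal A} {J' : Ideal B} (f : A →ₐ[R] B) (hf : ∀ x ∈ J, f x ∈ J') :
    Double J →ₐ[R] Double J' where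
  toFun x := ⟨(f x.1.1, f x.1.2), by
    rw [mem_double, ← map_sub]; exact hf _ x.2⟩
  map_one' := by ext <;> simp
  map_mul' _ _ := by ext <;> simp
  map_zero' := by ext <;> simp
  map_add' _ _ := by ext <;> simp
  commutes' r := by
    apply Subtype.ext
    exact Prod.ext (f.commutes r) (f.commutes r)

theorem Double.ext {J : Ideal A} {x y : Double J} (h1 : fst A J x = fst A J y)
    (h2 : snd A J x = snd A J y) : x = y :=
  Subtype.ext (Prod.ext h1 h2)

end Double

end RelDilation

namespace RelDilation

/-! ### Relative groups over the double, and kernels of retractions. -/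

section DoubleGroups

variable {A : Type*} [CommRing A]

/-- A generator `k h k⁻¹` with parameter `z ∈ J` is lifted by embedding `k` diagonally and giving
the middle factor the parameter `(z, 0)`, which belongs to the double because `z ∈ J`. -/
theorem exists_lift_double {ι : Type*} [Fintype ι] [DecidableEq ι] {𝒴 : Set (Matrix ι ι ℤ)}
    (h𝒴 : ∀ Y ∈ 𝒴, Y * Y = 0) {J : Ideal A} {g : GL ι A}
    (hg : g ∈ normalClosureIn (Subgroup.closure (rootMatrices 𝒴 (⊤ : Ideal A)))
      (rootMatrices 𝒴 J)) :
    ∃ g' ∈ Subgroup.closure (rootMatrices 𝒴 (⊤ : Ideal (Double J))),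
      Matrix.GeneralLinearGroup.map (Double.fst A J : Double J →+* A) g' = g ∧
      Matrix.GeneralLinearGroup.map (Double.snd A J : Double J →+* A) g' = 1 := by
  induction hg using Subgroup.closure_induction with
  | mem x hx =>
    obtain ⟨k, hk, h, ⟨Y, hY, z, hz, e⟩, rfl⟩ := hx
    obtain ⟨h', e'⟩ := exists_rootMatrix (h𝒴 Y hY)
      (⟨(z, 0), by simpa [mem_double] using hz⟩ : Double J)
    have hh' : h' ∈ Subgroup.closure (rootMatrices 𝒴 (⊤ : Ideal (Double J))) :=
      Subgroup.subset_closure ⟨Y, hY, _, Submodule.mem_top, e'⟩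
    have hk' := map_mem_closure_rootMatrices (algebraMap A (Double J)) hk
    refine ⟨_, Subgroup.mul_mem _ (Subgroup.mul_mem _ hk' hh') (Subgroup.inv_mem _ hk'), ?_, ?_⟩
    · have h1 : Matrix.GeneralLinearGroup.map (Double.fst A J : Double J →+* A)
          (Matrix.GeneralLinearGroup.map (algebraMap A (Double J)) k) = k := by
        ext i j; rfl
      have h2 : Matrix.GeneralLinearGroup.map (Double.fst A J : Double J →+* A) h' = h := by
        apply Units.ext
        rw [map_rootMatrix _ e', e]; rfl
      rw [map_mul, map_mul, map_inv, h1, h2]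
    · have h2 : Matrix.GeneralLinearGroup.map (Double.snd A J : Double J →+* A) h' = 1 := by
        apply Units.ext
        rw [map_rootMatrix _ e']
        have : (Double.snd A J : Double J →+* A) ⟨(z, 0), by simpa [mem_double] using hz⟩ = 0 := rfl
        rw [this]; simp
      rw [map_mul, map_mul, map_inv, h2]; simp
  | one => exact ⟨1, Subgroup.one_mem _, by simp, by simp⟩
  | mul x y _ _ hx hy =>
    obtain ⟨x', hx', h1, h2⟩ := hx
    obtain ⟨y', hy', h3, h4⟩ := hy
    exact ⟨x' * y', Subgroup.mul_mem _ hx' hy', by rw [map_mul, h1, h3],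
      by rw [map_mul, h2, h4, one_mul]⟩
  | inv x _ hx =>
    obtain ⟨x', hx', h1, h2⟩ := hx
    exact ⟨x'⁻¹, Subgroup.inv_mem _ hx', by rw [map_inv, h1], by rw [map_inv, h2, inv_one]⟩

/-- Conjugates by `θ`-invariant elementary matrices of elementary matrices that `θ` maps to `1`. -/
def kernelGens {ι : Type*} [Fintype ι] [DecidableEq ι] (𝒴 : Set (Matrix ι ι ℤ)) (θ : A →+* A) :
    Set (GL ι A) :=
  {x | ∃ γ ∈ Subgroup.closure (rootMatrices 𝒴 (⊤ : Ideal A)),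
    Matrix.GeneralLinearGroup.map θ γ = γ ∧ ∃ Y ∈ 𝒴, ∃ z, θ z = 0 ∧ ∃ E : GL ι A,
      (E : Matrix ι ι A) = 1 + z • Y.map (Int.castRingHom A) ∧ x = γ * E * γ⁻¹}

/-- The map `x ↦ x (T x)⁻¹` is a crossed homomorphism: its value at `x y` is its value at `x` times
the `T x`-conjugate of its value at `y`. On a generator with parameter `z` it gives the root element
with parameter `z - θ z`, which `θ` kills. Conjugation by the `T`-fixed element `T x` preserves the
subgroup generated by `kernelGens`, so all values lie there, and the value at `g` is `g` itself. -/
theorem mem_closure_kernelGens {ι : Type*} [Fintype ι] [DecidableEq ι] {𝒴 : Set (Matrix ι ι ℤ)}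
    (h𝒴 : ∀ Y ∈ 𝒴, Y * Y = 0) {θ : A →+* A} (hθ : ∀ a, θ (θ a) = θ a) {g : GL ι A}
    (hg : g ∈ Subgroup.closure (rootMatrices 𝒴 (⊤ : Ideal A)))
    (h1 : Matrix.GeneralLinearGroup.map θ g = 1) :
    g ∈ Subgroup.closure (kernelGens 𝒴 θ) := by
  set T : GL ι A →* GL ι A := Matrix.GeneralLinearGroup.map θ with hT
  have hTT : ∀ x, T (T x) = T x := fun x => by
    ext i j; simp [hT, Matrix.GeneralLinearGroup.map_apply, hθ]
  have hconj : ∀ c ∈ Subgroup.closure (rootMatrices 𝒴 (⊤ : Ideal A)), T c = c →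
      ∀ x ∈ Subgroup.closure (kernelGens 𝒴 θ), c * x * c⁻¹ ∈ Subgroup.closure (kernelGens 𝒴 θ) := by
    intro c hc hcT x hx
    induction hx using Subgroup.closure_induction with
    | mem x hx =>
      obtain ⟨γ, hγ, hγT, Y, hY, z, hz, E, hE, rfl⟩ := hx
      exact Subgroup.subset_closure ⟨c * γ, Subgroup.mul_mem _ hc hγ, by
        rw [← hT, map_mul, hcT]; rw [← hT] at hγT; rw [hγT], Y, hY, z, hz, E, hE, by group⟩
    | one => simp
    | mul x y _ _ hx hy =>
      have := Subgroup.mul_mem _ hx hy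
      convert this using 1; group
    | inv x _ hx =>
      have := Subgroup.inv_mem _ hx
      convert this using 1; group
  have main : ∀ x ∈ Subgroup.closure (rootMatrices 𝒴 (⊤ : Ideal A)),
      x * (T x)⁻¹ ∈ Subgroup.closure (kernelGens 𝒴 θ) := by
    intro x hx
    induction hx using Subgroup.closure_induction with
    | mem x hx =>
      obtain ⟨Y, hY, z, -, e⟩ := hx
      obtain ⟨E, hE⟩ := exists_rootMatrix (A := A) (h𝒴 Y hY) (z - θ z)
      have hYY : Y.map (Int.castRingHom A) * Y.map (Int.castRingHom A) = 0 := by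
        rw [← Matrix.map_mul, h𝒴 Y hY]; simp
      have : x = E * T x := by
        apply Units.ext
        rw [Units.val_mul, hE, hT, map_rootMatrix _ e, e, one_add_smul_mul_one_add_smul hYY,
          sub_add_cancel]
      rw [this, map_mul, hTT, mul_inv_rev, mul_assoc, mul_inv_cancel_left]
      have hTE : T E = 1 := by
        apply Units.ext
        rw [hT, map_rootMatrix _ hE, map_sub, hθ]; simp
      rw [hTE, inv_one, mul_one]
      exact Subgroup.subset_closure ⟨1, Subgroup.one_mem _, by simp, Y, hY, z - θ z,
        by rw [map_sub, hθ, sub_self], E, hE, by simp⟩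
    | one => simp
    | mul x y hx _ hx' hy' =>
      have h := Subgroup.mul_mem _ hx' (hconj (T x) (map_mem_closure_rootMatrices θ hx) (hTT x) _ hy')
      convert h using 1
      rw [map_mul]; group
    | inv x hx hx' =>
      have h := Subgroup.inv_mem _ (hconj (T x)⁻¹
        (Subgroup.inv_mem _ (map_mem_closure_rootMatrices θ hx)) (by rw [map_inv, hTT]) _ hx')
      convert h using 1
      rw [map_inv]; group
  have := main g hg
  rwa [h1, inv_one, mul_one] at this

variable {R : Type*} [CommRing R] [Algebra R A] {Q : Type*} [AddCommGroup Q] [Module R Q]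

/-- A generator with parameter `(z₁, z₂)` yields the root automorphism with parameter `z₁ - z₂ ∈ J`;
products and inverses are handled by conjugating with the first component. This serves for lifts
whose second component becomes trivial only after localization. -/
theorem fst_mul_inv_snd_mem {𝒩 : Set (Module.End R Q)} {J : Ideal A}
    {τ : (Double J ⊗[R] Q) ≃ₗ[Double J] (Double J ⊗[R] Q)} (h𝒩 : ∀ N ∈ 𝒩, N * N = 0)
    (hτ : τ ∈ Subgroup.closure (rootAuts 𝒩 (⊤ : Ideal (Double J)))) :
    extendEquiv Q (Double.fst R J) τ * (extendEquiv Q (Double.snd R J) τ)⁻¹ ∈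
      normalClosureIn (Subgroup.closure (rootAuts 𝒩 (⊤ : Ideal A))) (rootAuts 𝒩 J) := by
  induction hτ using Subgroup.closure_induction with
  | mem x hx =>
    obtain ⟨N, hN, z, -, e⟩ := hx
    apply subset_normalClosureIn
    refine ⟨N, hN, z.1.1 - z.1.2, z.2, ?_⟩
    have h1 : (extendEquiv Q (Double.fst R J) x).toLinearMap =
        (1 + z.1.1 • N.baseChange A : Module.End A (A ⊗[R] Q)) := by
      rw [coe_extendEquiv, e, extend_one_add_smul, extend_baseChange]; rfl
    have h2 : (extendEquiv Q (Double.snd R J) x).toLinearMap =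
        (1 + z.1.2 • N.baseChange A : Module.End A (A ⊗[R] Q)) := by
      rw [coe_extendEquiv, e, extend_one_add_smul, extend_baseChange]; rfl
    obtain ⟨g, hg⟩ := exists_rootAut (A := A) (h𝒩 N hN) (z.1.1 - z.1.2)
    have : extendEquiv Q (Double.fst R J) x = g * extendEquiv Q (Double.snd R J) x := by
      apply LinearEquiv.toLinearMap_injective
      rw [coe_mul_equiv, hg, h1, h2, one_add_smul_mul_one_add_smul (E := Module.End A (A ⊗[R] Q))
        (baseChange_sq (h𝒩 N hN)), sub_add_cancel]
    rw [this, mul_inv_cancel_right, hg]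
  | one => simp
  | mul x y hx _ hx' hy' =>
    have := Subgroup.mul_mem _ (conj_mem_normalClosureIn
      (extend_mem_closure_rootAuts (Double.fst R J) hx) hy') hx'
    convert this using 1
    rw [map_mul, map_mul]; group
  | inv x hx hx' =>
    have := Subgroup.inv_mem _ (conj_mem_normalClosureIn
      (Subgroup.inv_mem _ (extend_mem_closure_rootAuts (Double.fst R J) hx)) hx')
    convert this using 1
    rw [map_inv, map_inv]; group

end DoubleGroups

/-! ### Matrices of endomorphisms -/

section Rho

variable {R : Type*} [CommRing R] {S : Type*} [CommRing S] [Algebra R S]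
  {Q : Type*} [AddCommGroup Q] [Module R Q] {ι : Type*}
  (C : Type*) [CommRing C] [Algebra R C] [Algebra S C] [IsScalarTower R S C]

/-- The basis of `C ⊗ Q` induced by a basis of `S ⊗ Q`, for an `S`-algebra `C`. -/
def extBasis (b : Module.Basis ι S (S ⊗[R] Q)) : Module.Basis ι C (C ⊗[R] Q) :=
  (b.baseChange C).map (AlgebraTensorModule.cancelBaseChange R S C C Q)

theorem extBasis_apply (b : Module.Basis ι S (S ⊗[R] Q)) (v : ι) :
    extBasis C b v = scalarMap Q (IsScalarTower.toAlgHom R S C) (b v) := by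
  rw [extBasis, Module.Basis.map_apply, Module.Basis.baseChange_apply]
  induction b v using TensorProduct.induction_on with
  | zero => simp
  | tmul a q => simp [Algebra.smul_def]
  | add x y hx hy => rw [TensorProduct.tmul_add, map_add, hx, hy, map_add]

variable {C} in
theorem scalarMap_extBasis {C' : Type*} [CommRing C'] [Algebra R C'] [Algebra S C']
    [IsScalarTower R S C'] (f : C →ₐ[S] C') (b : Module.Basis ι S (S ⊗[R] Q)) (v : ι) :
    scalarMap Q (f.restrictScalars R) (extBasis C b v) = extBasis C' b v := by
  rw [extBasis_apply, extBasis_apply, ← scalarMap_comp]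
  congr 1
  congr 1
  ext x
  simp

variable [Fintype ι] [DecidableEq ι]

/-- The endomorphism of `C ⊗ Q` with a given matrix. -/
def matEnd (b : Module.Basis ι S (S ⊗[R] Q)) : Matrix ι ι C ≃ₐ[C] Module.End C (C ⊗[R] Q) :=
  Matrix.toLinAlgEquiv (extBasis C b)

theorem matEnd_extBasis (b : Module.Basis ι S (S ⊗[R] Q)) (M : Matrix ι ι C) (v : ι) :
    matEnd C b M (extBasis C b v) = ∑ u, M u v • extBasis C b u :=
  Matrix.toLinAlgEquiv_self _ _ _

variable {C} in
theorem matEnd_one_add_smul (b : Module.Basis ι S (S ⊗[R] Q)) (z : C) (M : Matrix ι ι C) :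
    matEnd C b (1 + z • M) = 1 + z • matEnd C b M := by
  rw [map_add, map_one, map_smul]

variable {C} in
theorem matEnd_one (b : Module.Basis ι S (S ⊗[R] Q)) : matEnd C b 1 = 1 := map_one _

variable {C} in
theorem matEnd_mul (b : Module.Basis ι S (S ⊗[R] Q)) (M M' : Matrix ι ι C) :
    matEnd C b (M * M') = matEnd C b M * matEnd C b M' := map_mul _ _ _

variable {C} in
theorem matEnd_map_one {C' : Type*} [CommRing C'] (b : Module.Basis ι S (S ⊗[R] Q))
    (f : C' →+* C) : matEnd C b ((1 : Matrix ι ι C').map f) = 1 := by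
  rw [Matrix.map_one _ (map_zero f) (map_one f), matEnd_one]

variable {C} in
theorem matEnd_map_mul {C' : Type*} [CommRing C'] (b : Module.Basis ι S (S ⊗[R] Q))
    (f : C' →+* C) (M M' : Matrix ι ι C') :
    matEnd C b ((M * M').map f) = matEnd C b (M.map f) * matEnd C b (M'.map f) := by
  rw [Matrix.map_mul, matEnd_mul]

variable {C} in
theorem extend_matEnd {C' : Type*} [CommRing C'] [Algebra R C'] [Algebra S C']
    [IsScalarTower R S C'] (f : C →ₐ[S] C') (b : Module.Basis ι S (S ⊗[R] Q)) (M : Matrix ι ι C) :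
    extend (f.restrictScalars R) (matEnd C b M) = matEnd C' b (M.map f) := by
  apply (extBasis C' b).ext
  intro v
  rw [matEnd_extBasis, ← scalarMap_extBasis f, extend_scalarMap, matEnd_extBasis, map_sum]
  refine Finset.sum_congr rfl fun u _ => ?_
  rw [scalarMap_smul, scalarMap_extBasis]
  rfl

end Rho

end RelDilation

namespace RelDilation

/-! ### Dilation -/

section Dilation

universe u v

/-- `loc` has the two properties of the localization away from `s`: every element of the target
is a fraction, and the kernel is `s`-power torsion. -/
def IsAwayMap {R C C' : Type*} [CommRing R] [CommRing C] [CommRing C'] [Algebra R C] [Algebra R C']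
    (s : R) (loc : C →ₐ[R] C') : Prop :=
  (∀ y, ∃ k : ℕ, ∃ d, s ^ k • y = loc d) ∧ ∀ d, loc d = 0 → ∃ k : ℕ, s ^ k • d = 0

theorem map_mem_map_algebraMap {R A B : Type*} [CommRing R] [CommRing A] [CommRing B] [Algebra R A]
    [Algebra R B] (f : A →ₐ[R] B) (I : Ideal R) :
    ∀ x ∈ I.map (algebraMap R A), f x ∈ I.map (algebraMap R B) := by
  have : (I.map (algebraMap R A)).map (f : A →+* B) = I.map (algebraMap R B) := by
    rw [Ideal.map_map]; congr 1; ext; simp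
  exact fun x hx => this ▸ Ideal.mem_map_of_mem (f : A →+* B) hx

theorem map_mem_map_algebraMap_of_tower {R S A B : Type*} [CommRing R] [CommRing S] [CommRing A]
    [CommRing B] [Algebra R S] [Algebra R A] [Algebra R B] [Algebra S A] [Algebra S B]
    [IsScalarTower R S A] [IsScalarTower R S B] (f : A →ₐ[S] B) (I : Ideal R) :
    ∀ x ∈ I.map (algebraMap R A), f x ∈ I.map (algebraMap R B) :=
  fun x hx => map_mem_map_algebraMap (f.restrictScalars R) I x hx

variable {R : Type*} [CommRing R] {S : Type*} [CommRing S] [Algebra R S]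

/-- The map `R[X] → S[X]`. -/
def polyMap (R S : Type*) [CommRing R] [CommRing S] [Algebra R S] : R[X] →ₐ[R] S[X] :=
  mapAlgHom (Algebra.ofId R S)

theorem pow_smul_cancel (s : R) [IsLocalization.Away s S] {M : Type*} [AddCommGroup M] [Module R M]
    [Module S M] [IsScalarTower R S M] {k : ℕ} {x y : M} (h : s ^ k • x = s ^ k • y) : x = y := by
  have hu : IsUnit (algebraMap R S (s ^ k)) := by
    rw [map_pow]; exact (IsLocalization.Away.algebraMap_isUnit s).pow k
  rw [← algebraMap_smul S (s ^ k) x, ← algebraMap_smul S (s ^ k) y] at h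
  exact hu.smul_left_cancel.1 h

attribute [local instance] Polynomial.algebra Polynomial.isLocalization in
theorem isAwayMap_polyMap (s : R) [IsLocalization.Away s S] : IsAwayMap s (polyMap R S) := by
  constructor
  · intro y
    obtain ⟨⟨q, ⟨m, hm⟩⟩, h⟩ := IsLocalization.surj ((Submonoid.powers s).map (C : R →+* R[X])) y
    obtain ⟨_, ⟨k, rfl⟩, rfl⟩ := hm
    refine ⟨k, q, ?_⟩
    have h' : y * Polynomial.map (algebraMap R S) (C (s ^ k)) = Polynomial.map (algebraMap R S) q := h
    change _ = Polynomial.map (algebraMap R S) q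
    rw [← h', Algebra.smul_def, mul_comm]
    simp
  · intro d hd
    have hd' : algebraMap R[X] S[X] d = 0 := hd
    obtain ⟨⟨m, hm⟩, h⟩ :=
      (IsLocalization.map_eq_zero_iff ((Submonoid.powers s).map (C : R →+* R[X])) S[X] d).1 hd'
    obtain ⟨_, ⟨k, rfl⟩, rfl⟩ := hm
    refine ⟨k, ?_⟩
    rw [Algebra.smul_def]
    exact h

/-- Denominators are cleared inside the ideal, so that the numerator still measures a congruence;
lifting pairs of the double depends on this. -/
theorem exists_polyMap_eq_of_mem (s : R) [IsLocalization.Away s S] (I : Ideal R) {p : S[X]}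
    (hp : p ∈ I.map (algebraMap R S[X])) :
    ∃ k : ℕ, ∃ q ∈ I.map (algebraMap R R[X]), s ^ k • p = polyMap R S q := by
  induction hp using Submodule.span_induction with
  | mem x hx =>
    obtain ⟨i, hi, rfl⟩ := hx
    exact ⟨0, algebraMap R R[X] i, Ideal.mem_map_of_mem _ hi, by simp [polyMap]⟩
  | zero => exact ⟨0, 0, Ideal.zero_mem _, by simp⟩
  | add x y _ _ hx hy =>
    obtain ⟨k, q, hq, h⟩ := hx
    obtain ⟨k', q', hq', h'⟩ := hy
    refine ⟨k + k', s ^ k' • q + s ^ k • q', Ideal.add_mem _ (Submodule.smul_of_tower_mem _ _ hq)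
      (Submodule.smul_of_tower_mem _ _ hq'), ?_⟩
    rw [map_add, map_smul, map_smul, ← h, ← h', smul_smul, smul_smul, ← pow_add, ← pow_add,
      smul_add, add_comm k']
  | smul a x _ hx =>
    obtain ⟨k, q, hq, h⟩ := hx
    obtain ⟨k', q', h'⟩ := (isAwayMap_polyMap (S := S) s).1 a
    refine ⟨k + k', q' * q, Ideal.mul_mem_left _ _ hq, ?_⟩
    rw [map_mul, ← h, ← h', smul_eq_mul, smul_mul_smul_comm, ← pow_add, add_comm k]

/-- The map of doubles induced by `R[X] → S[X]`. -/
def doublePolyMap (S : Type*) [CommRing S] [Algebra R S] (I : Ideal R) :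
    Double (I.map (algebraMap R R[X])) →ₐ[R] Double (I.map (algebraMap R S[X])) :=
  Double.map (polyMap R S) (map_mem_map_algebraMap _ I)

/-- The endomorphism of the double of `R[X]` induced by `X ↦ c X`. -/
def doubleScale (I : Ideal R) (c : R) :
    Double (I.map (algebraMap R S[X])) →ₐ[S] Double (I.map (algebraMap R S[X])) :=
  Double.map (aeval (C (algebraMap R S c) * X : S[X]))
    (map_mem_map_algebraMap_of_tower _ I)

/-- The endomorphism of the double of `R[X]` induced by `X ↦ 0`. -/
def doubleZero (S : Type*) [CommRing S] [Algebra R S] (I : Ideal R) :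
    Double (I.map (algebraMap R S[X])) →ₐ[S] Double (I.map (algebraMap R S[X])) :=
  Double.map (aeval (0 : S[X])) (map_mem_map_algebraMap_of_tower _ I)

theorem polyMap_aeval (c : S[X]) (d : R[X]) (hc : polyMap R S d = c) (p : R[X]) :
    polyMap R S (aeval d p) = aeval c (polyMap R S p) := by
  subst hc
  have : (polyMap R S).comp ((aeval d).restrictScalars R) =
      ((aeval (polyMap R S d)).restrictScalars R : S[X] →ₐ[R] S[X]).comp (polyMap R S) := by
    ext; simp [polyMap]
  exact DFunLike.congr_fun this p

theorem polyMap_C_mul_X (c : R) :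
    polyMap R S (C (algebraMap R R c) * X) = C (algebraMap R S c) * X := by
  simp [polyMap]

/-- Lifting the two components of `(a, b)` separately could destroy the congruence. Instead `b` is
lifted in `R[X]` and `a - b` inside the ideal, and the first component is taken as the sum. -/
theorem isAwayMap_doublePolyMap (s : R) [IsLocalization.Away s S] (I : Ideal R) :
    IsAwayMap s (doublePolyMap S I) := by
  constructor
  · rintro ⟨⟨a, b⟩, h⟩
    obtain ⟨k, p, hp⟩ := (isAwayMap_polyMap (S := S) s).1 b
    obtain ⟨k', q, hq, h'⟩ := exists_polyMap_eq_of_mem s I (mem_double.1 h)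
    refine ⟨k + k', ⟨(s ^ k • q + s ^ k' • p, s ^ k' • p), ?_⟩, ?_⟩
    · rw [mem_double, add_sub_cancel_right]
      exact Submodule.smul_of_tower_mem _ _ hq
    · have h1 : s ^ (k + k') • b = polyMap R S (s ^ k' • p) := by
        rw [map_smul, ← hp, smul_smul, ← pow_add, add_comm]
      have h2 : s ^ (k + k') • a = polyMap R S (s ^ k • q + s ^ k' • p) := by
        rw [map_add, ← h1, map_smul, ← h', smul_smul, ← pow_add, ← smul_add, sub_add_cancel]
      exact Subtype.ext (Prod.ext h2 h1)
  · rintro ⟨⟨a, b⟩, h⟩ h0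
    obtain ⟨k, hk⟩ := (isAwayMap_polyMap (S := S) s).2 a (congrArg (fun x => x.1.1) h0)
    obtain ⟨k', hk'⟩ := (isAwayMap_polyMap (S := S) s).2 b (congrArg (fun x => x.1.2) h0)
    refine ⟨k + k', Subtype.ext (Prod.ext ?_ ?_)⟩
    · change s ^ (k + k') • a = 0
      rw [add_comm, pow_add, mul_smul, hk, smul_zero]
    · change s ^ (k + k') • b = 0
      rw [pow_add, mul_smul, hk', smul_zero]

theorem doublePolyMap_doubleScale (I : Ideal R) (c : R)
    (d : Double (I.map (algebraMap R R[X]))) :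
    doublePolyMap S I (doubleScale I c d) = doubleScale I c (doublePolyMap S I d) :=
  Double.ext (polyMap_aeval _ _ (polyMap_C_mul_X c) _) (polyMap_aeval _ _ (polyMap_C_mul_X c) _)

theorem doublePolyMap_doubleZero (I : Ideal R) (d : Double (I.map (algebraMap R R[X]))) :
    doublePolyMap S I (doubleZero R I d) = doubleZero S I (doublePolyMap S I d) :=
  Double.ext (polyMap_aeval _ _ (map_zero _) _) (polyMap_aeval _ _ (map_zero _) _)

theorem aeval_zero_eq_C (p : R[X]) : aeval (0 : R[X]) p = C (p.coeff 0) :=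
  (coeff_zero_eq_aeval_zero' p).symm

theorem divX_mem {I : Ideal R} {p : R[X]} (hp : p ∈ I.map (algebraMap R R[X])) :
    p.divX ∈ I.map (algebraMap R R[X]) := by
  change p ∈ I.map C at hp
  change p.divX ∈ I.map C
  rw [Ideal.mem_map_C_iff] at hp ⊢
  exact fun n => by rw [coeff_divX]; exact hp _

theorem aeval_C_mul_X_of_coeff_zero {p : R[X]} (hp : p.coeff 0 = 0) (c : R) :
    aeval (C c * X : R[X]) p = c • (X * aeval (C c * X : R[X]) p.divX) := by
  conv_lhs => rw [← divX_mul_X_add p, hp]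
  simp [Algebra.smul_def]
  ring

/-- Without constant terms, both components are divisible by `X`, and substituting `c X` extracts a
factor `c`. The quotient pair stays in the double because membership in the extended ideal is tested
on coefficients (`divX_mem`). -/
theorem exists_doubleScale_eq (I : Ideal R) (c : R) {d : Double (I.map (algebraMap R R[X]))}
    (hd : doubleZero R I d = 0) : ∃ d', doubleScale I c d = c • d' := by
  obtain ⟨⟨p, q⟩, h⟩ := d
  have hp : p.coeff 0 = 0 := by
    have : aeval (0 : R[X]) p = 0 := congrArg (fun x => x.1.1) hd
    rwa [aeval_zero_eq_C, C_eq_zero] at this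
  have hq : q.coeff 0 = 0 := by
    have : aeval (0 : R[X]) q = 0 := congrArg (fun x => x.1.2) hd
    rwa [aeval_zero_eq_C, C_eq_zero] at this
  refine ⟨⟨(X * aeval (C c * X : R[X]) p.divX, X * aeval (C c * X : R[X]) q.divX), ?_⟩, ?_⟩
  · rw [mem_double, ← mul_sub, ← map_sub]
    have : p.divX - q.divX = (p - q).divX := by ext; simp [coeff_divX]
    rw [this]
    exact Ideal.mul_mem_left _ _ (map_mem_map_algebraMap _ I _ (divX_mem h))
  · exact Double.ext (aeval_C_mul_X_of_coeff_zero hp c) (aeval_C_mul_X_of_coeff_zero hq c)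

/-- Vanishing at `X = 0` provides a factor `s ^ l`. Of it, `s ^ k` pays for the denominator of `z`,
and `s ^ k'` for the constant term of the numerator, which vanishes only up to `s`-torsion; at least
`s ^ M` remains. -/
theorem exists_doubleScale_pow_eq (s : R) [IsLocalization.Away s S] (I : Ideal R)
    {z : Double (I.map (algebraMap R S[X]))} (hz : doubleZero S I z = 0) (M : ℕ) :
    ∃ l₀ : ℕ, ∀ l, l₀ ≤ l → ∃ d, doubleScale I (s ^ l) z = s ^ M • doublePolyMap S I d := by
  obtain ⟨k, d, h⟩ := (isAwayMap_doublePolyMap (S := S) s I).1 z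
  have hz' : doublePolyMap S I (doubleZero R I d) = 0 := by
    rw [doublePolyMap_doubleZero, ← h,
      show doubleZero S I (s ^ k • z) = s ^ k • doubleZero S I z from
        AlgHom.map_smul_of_tower _ _ _, hz, smul_zero]
  obtain ⟨k', h'⟩ := (isAwayMap_doublePolyMap (S := S) s I).2 _ hz'
  refine ⟨k' + k + M, fun l hl => ?_⟩
  obtain ⟨j, rfl⟩ := Nat.exists_eq_add_of_le hl
  obtain ⟨d', hd'⟩ := exists_doubleScale_eq I (s ^ (k' + k + M + j)) (d := s ^ k' • d)
    (by rw [map_smul, h'])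
  refine ⟨s ^ j • d', pow_smul_cancel (S := S) s (k := k' + k) ?_⟩
  have e := congrArg (doublePolyMap S I) hd'
  rw [doublePolyMap_doubleScale, map_smul (doublePolyMap S I), map_smul (doublePolyMap S I), ← h,
    AlgHom.map_smul_of_tower,
    AlgHom.map_smul_of_tower] at e
  rw [pow_add, mul_smul, e, map_smul]
  simp only [smul_smul]
  congr 1
  ring

end Dilation

end RelDilation

namespace RelDilation

/-! ### The dilation argument, given control of denominators. -/

section DilationTheorem

universe u v

variable {R : Type u} [CommRing R] {S : Type u} [CommRing S] [Algebra R S]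
  {Q : Type v} [AddCommGroup Q] [Module R Q] {ι : Type*} [Fintype ι] [DecidableEq ι]

/-- Conjugated root elements with sufficiently divisible parameters come from root automorphisms
over rings without denominators. -/
def HasDenominators (s : R) (b : Module.Basis ι S (S ⊗[R] Q)) (𝒴 : Set (Matrix ι ι ℤ))
    (𝒩 : Set (Module.End R Q)) : Prop :=
  ∀ (C C' : Type u) [CommRing C] [CommRing C'] [Algebra R C] [Algebra R C'] [Algebra S C']
    [IsScalarTower R S C'] (loc : C →ₐ[R] C'), IsAwayMap s loc →
    ∀ γ ∈ Subgroup.closure (rootMatrices 𝒴 (⊤ : Ideal C')), ∀ Y ∈ 𝒴, ∃ M : ℕ, ∀ h : C,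
      ∃ τ ∈ Subgroup.closure (rootAuts 𝒩 (⊤ : Ideal C)), extend loc τ.toLinearMap =
        (1 + (s ^ M • loc h) • matEnd C' b ((γ : Matrix ι ι C') * Y.map (Int.castRingHom C') *
          ((γ⁻¹ : GL ι C') : Matrix ι ι C')) : Module.End C' (C' ⊗[R] Q))

theorem extend_one {A B : Type*} [CommRing A] [Algebra R A] [CommRing B] [Algebra R B]
    (f : A →ₐ[R] B) :
    extend f (1 : Module.End A (A ⊗[R] Q)) = (1 : Module.End B (B ⊗[R] Q)) :=
  map_one (extendHom Q f)

theorem extend_equiv_mul {A B : Type*} [CommRing A] [Algebra R A] [CommRing B] [Algebra R B]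
    (f : A →ₐ[R] B) (g h : (A ⊗[R] Q) ≃ₗ[A] (A ⊗[R] Q)) :
    extend f (g * h).toLinearMap =
      (extend f g.toLinearMap * extend f h.toLinearMap : Module.End B (B ⊗[R] Q)) :=
  map_mul (extendHom Q f) g.toLinearMap h.toLinearMap

theorem extend_equiv_one {A B : Type*} [CommRing A] [Algebra R A] [CommRing B] [Algebra R B]
    (f : A →ₐ[R] B) :
    extend f (1 : (A ⊗[R] Q) ≃ₗ[A] (A ⊗[R] Q)).toLinearMap = (1 : Module.End B (B ⊗[R] Q)) :=
  map_one (extendHom Q f)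

theorem extend_equiv_inv {A B : Type*} [CommRing A] [Algebra R A] [CommRing B] [Algebra R B]
    {f : A →ₐ[R] B} {g : (A ⊗[R] Q) ≃ₗ[A] (A ⊗[R] Q)} {φ ψ : Module.End B (B ⊗[R] Q)}
    (h : extend f g.toLinearMap = φ) (hφ : φ * ψ = 1) : extend f (g⁻¹).toLinearMap = ψ := by
  refine left_inv_eq_right_inv (M := Module.End B (B ⊗[R] Q)) (a := φ) ?_ hφ
  rw [← h, ← extend_equiv_mul, inv_mul_cancel, extend_equiv_one]

/-- The double of `S[X]` along the ideal generated by `I`. -/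
abbrev PolyDouble (S : Type*) [CommRing S] [Algebra R S] (I : Ideal R) : Type _ :=
  Double (I.map (algebraMap R S[X]))

/-- The exponent `M` in `HasDenominators` does not depend on the parameter `h`: it is fixed by `γ`
and `Y`, and `l` is chosen afterwards. Having the conclusion for all large `l` lets the factors of a
product share one `l`. -/
theorem exists_dilation_of_mem_closure (s : R) [IsLocalization.Away s S] (I : Ideal R)
    (b : Module.Basis ι S (S ⊗[R] Q)) {𝒴 : Set (Matrix ι ι ℤ)}
    {𝒩 : Set (Module.End R Q)} (hd : HasDenominators s b 𝒴 𝒩)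
    {x : GL ι (PolyDouble S I)}
    (hx : x ∈ Subgroup.closure (kernelGens 𝒴 (doubleZero S I : PolyDouble S I →+* PolyDouble S I))) :
    ∃ l₀ : ℕ, ∀ l, l₀ ≤ l →
      ∃ τ ∈ Subgroup.closure (rootAuts 𝒩 (⊤ : Ideal (PolyDouble R I))),
        extend (doublePolyMap S I) τ.toLinearMap =
          matEnd (PolyDouble S I) b
            ((x : Matrix ι ι (PolyDouble S I)).map (doubleScale I (s ^ l))) := by
  induction hx using Subgroup.closure_induction with
  | mem x hx =>
    obtain ⟨γ, hγ, hγ0, Y, hY, z, hz, E, hE, rfl⟩ := hx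
    obtain ⟨M, hM⟩ := hd _ _ (doublePolyMap S I) (isAwayMap_doublePolyMap s I) γ hγ Y hY
    obtain ⟨l₀, h⟩ := exists_doubleScale_pow_eq s I hz M
    refine ⟨l₀, fun l hl => ?_⟩
    obtain ⟨d, hd⟩ := h l hl
    obtain ⟨τ, hτ, e⟩ := hM d
    refine ⟨τ, hτ, ?_⟩
    rw [e, ← hd]
    let L : PolyDouble S I →+* PolyDouble S I :=
      ((doubleScale I (s ^ l) : PolyDouble S I →ₐ[S] PolyDouble S I) :
        PolyDouble S I →+* PolyDouble S I)
    -- Values of `doubleZero` are constants, which `X ↦ s ^ l X` does not move; hence it fixes `γ`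
    -- and acts only on the parameter `z`.
    have hcomp : ∀ a : PolyDouble S I, L (doubleZero S I a) = doubleZero S I a := by
      intro a
      have : ∀ p : S[X], aeval (C (algebraMap R S (s ^ l)) * X : S[X]) (aeval (0 : S[X]) p) =
          aeval (0 : S[X]) p := fun p => by rw [aeval_zero_eq_C, aeval_C]; rfl
      exact Double.ext (this _) (this _)
    have hγL : Matrix.GeneralLinearGroup.map L γ = γ := by
      rw [← hγ0]
      ext i j : 2
      simp only [Matrix.GeneralLinearGroup.map_apply]
      exact hcomp _
    have hx : ((γ * E * γ⁻¹ : GL ι (PolyDouble S I)) : Matrix ι ι (PolyDouble S I)).map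
        (doubleScale I (s ^ l)) = ((Matrix.GeneralLinearGroup.map L (γ * E * γ⁻¹) :
          GL ι (PolyDouble S I)) : Matrix ι ι (PolyDouble S I)) := rfl
    have hmat : ((Matrix.GeneralLinearGroup.map L (γ * E * γ⁻¹) : GL ι (PolyDouble S I)) :
        Matrix ι ι (PolyDouble S I)) = 1 + L z • ((γ : Matrix ι ι (PolyDouble S I)) *
          Y.map (Int.castRingHom (PolyDouble S I)) *
          ((γ⁻¹ : GL ι (PolyDouble S I)) : Matrix ι ι (PolyDouble S I))) := by
      rw [map_mul, map_mul, map_inv, hγL, Units.val_mul, Units.val_mul, map_rootMatrix L hE,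
        mul_add, add_mul, mul_one, Units.mul_inv, mul_smul_comm, smul_mul_assoc]
    rw [hx, hmat]
    exact (matEnd_one_add_smul b _ _).symm
  | one =>
    refine ⟨0, fun l _ => ⟨1, Subgroup.one_mem _, ?_⟩⟩
    exact (extend_equiv_one _).trans (matEnd_map_one b _).symm
  | mul x y _ _ hx hy =>
    obtain ⟨l₁, h₁⟩ := hx
    obtain ⟨l₂, h₂⟩ := hy
    refine ⟨l₁ + l₂, fun l hl => ?_⟩
    obtain ⟨τ₁, m₁, e₁⟩ := h₁ l (by omega)
    obtain ⟨τ₂, m₂, e₂⟩ := h₂ l (by omega)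
    refine ⟨τ₁ * τ₂, Subgroup.mul_mem _ m₁ m₂, ?_⟩
    refine (extend_equiv_mul _ _ _).trans ?_
    rw [e₁, e₂]
    exact (matEnd_map_mul b _ _ _).symm
  | inv x _ hx =>
    obtain ⟨l₁, h₁⟩ := hx
    refine ⟨l₁, fun l hl => ?_⟩
    obtain ⟨τ₁, m₁, e₁⟩ := h₁ l hl
    refine ⟨τ₁⁻¹, Subgroup.inv_mem _ m₁, ?_⟩
    refine extend_equiv_inv e₁ ((matEnd_map_mul b _ _ _).symm.trans ?_)
    rw [Units.mul_inv]
    exact matEnd_map_one b _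

theorem scale_eq_extend (c : R) (σ : R[X] ⊗[R] Q →ₗ[R[X]] R[X] ⊗[R] Q) :
    scale c σ = extend ((aeval (C (algebraMap R R c) * X : R[X])).restrictScalars R) σ := rfl

theorem polyMap_comp_aeval (c : S[X]) (d : R[X]) (hc : polyMap R S d = c) :
    (polyMap R S).comp ((aeval d).restrictScalars R) =
      ((aeval c : S[X] →ₐ[S] S[X]).restrictScalars R).comp (polyMap R S) := by
  exact AlgHom.ext fun p => polyMap_aeval c d hc p

theorem extend_polyMap_scale (c : R) (σ : R[X] ⊗[R] Q →ₗ[R[X]] R[X] ⊗[R] Q) :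
    extend (polyMap R S) (scale c σ) =
      extend ((aeval (C (algebraMap R S c) * X : S[X])).restrictScalars R)
        (extend (polyMap R S) σ) := by
  rw [scale_eq_extend, extend_extend, extend_extend,
    polyMap_comp_aeval _ _ (polyMap_C_mul_X c)]

theorem scale_mul (c c' : R) (σ : R[X] ⊗[R] Q →ₗ[R[X]] R[X] ⊗[R] Q) :
    scale c (scale c' σ) = scale (c' * c) σ := by
  unfold scale
  rw [extend_extend]
  congr 1
  apply Polynomial.algHom_ext
  simp
  ring

/-- Evaluation in `R` is replaced by the endomorphism `X ↦ 0` of `R[X]`, which composes with the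
other substitutions. -/
theorem atZero_eq_iff (σ : R[X] ⊗[R] Q →ₗ[R[X]] R[X] ⊗[R] Q) :
    atZero σ = LinearMap.id ↔
      extend ((aeval (0 : R[X])).restrictScalars R : R[X] →ₐ[R] R[X]) σ = LinearMap.id := by
  constructor
  · intro h
    have := congrArg (extend (Algebra.ofId R R[X])) h
    rw [show (LinearMap.id : R ⊗[R] Q →ₗ[R] R ⊗[R] Q) = (1 : Module.End R _) from rfl, extend_one,
      atZero, extend_extend] at this
    rw [show ((aeval (0 : R[X])).restrictScalars R : R[X] →ₐ[R] R[X]) =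
      (Algebra.ofId R R[X]).comp (aeval (0 : R)) by ext; simp]
    exact this
  · intro h
    have := congrArg (extend (aeval (0 : R) : R[X] →ₐ[R] R)) h
    rw [show (LinearMap.id : R[X] ⊗[R] Q →ₗ[R[X]] R[X] ⊗[R] Q) = (1 : Module.End R[X] _) from rfl,
      extend_one, extend_extend] at this
    rw [atZero, show (aeval (0 : R) : R[X] →ₐ[R] R) =
      (aeval (0 : R)).comp ((aeval (0 : R[X])).restrictScalars R : R[X] →ₐ[R] R[X]) by ext; simp]
    exact this

theorem exists_dilation (s : R) [IsLocalization.Away s S] (I : Ideal R)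
    (b : Module.Basis ι S (S ⊗[R] Q)) {𝒴 : Set (Matrix ι ι ℤ)} (h𝒴 : ∀ Y ∈ 𝒴, Y * Y = 0)
    {𝒩 : Set (Module.End R Q)} (h𝒩 : ∀ N ∈ 𝒩, N * N = 0) (hd : HasDenominators s b 𝒴 𝒩)
    (σ : R[X] ⊗[R] Q →ₗ[R[X]] R[X] ⊗[R] Q) (h0 : atZero σ = LinearMap.id) {g : GL ι S[X]}
    (hg : g ∈ normalClosureIn (Subgroup.closure (rootMatrices 𝒴 (⊤ : Ideal S[X])))
      (rootMatrices 𝒴 (I.map (algebraMap R S[X]))))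
    (hσ : extend (polyMap R S) σ = matEnd S[X] b (g : Matrix ι ι S[X])) :
    ∃ l : ℕ, 0 < l ∧ ∀ c ∈ Ideal.span {s ^ l},
      ∃ τ ∈ normalClosureIn (Subgroup.closure (rootAuts 𝒩 (⊤ : Ideal R[X])))
        (rootAuts 𝒩 (I.map (algebraMap R R[X]))),
        atZero τ.toLinearMap = LinearMap.id ∧
        extend (polyMap R S) τ.toLinearMap = extend (polyMap R S) (scale c σ) := by
  obtain ⟨g', hg', hfst, hsnd⟩ := exists_lift_double h𝒴 hg
  have h0S : extend ((aeval (0 : S[X])).restrictScalars R : S[X] →ₐ[R] S[X])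
      (extend (polyMap R S) σ) = LinearMap.id := by
    rw [extend_extend, ← polyMap_comp_aeval _ 0 (map_zero _), ← extend_extend,
      (atZero_eq_iff σ).1 h0]
    exact extend_one _
  have hg0 : (g : Matrix ι ι S[X]).map (aeval (0 : S[X])) = 1 := by
    apply (matEnd S[X] b).injective
    rw [← extend_matEnd, ← hσ, h0S, map_one]
    rfl
  -- The first component is trivial at `X = 0` because `σ(0) = Id`, the second because it is
  -- identically trivial.
  have hg'0 : Matrix.GeneralLinearGroup.map (doubleZero S I : PolyDouble S I →+* PolyDouble S I) g' = 1 := by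
    apply Units.ext
    ext i j : 1
    apply Double.ext
    · have h1 : Double.fst S[X] (I.map (algebraMap R S[X])) ((g' : Matrix ι ι (PolyDouble S I)) i j) =
          (g : Matrix ι ι S[X]) i j := by rw [← hfst]; rfl
      have h2 := congrFun (congrFun hg0 i) j
      rw [Matrix.map_apply, ← h1] at h2
      refine Eq.trans h2 (Eq.trans ?_ (congrFun (congrFun (Matrix.map_one (Double.fst S[X]
        (I.map (algebraMap R S[X]))) (map_zero _) (map_one _)).symm i) j))
      rfl
    · have h1 : Double.snd S[X] (I.map (algebraMap R S[X])) ((g' : Matrix ι ι (PolyDouble S I)) i j) =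
          (1 : Matrix ι ι S[X]) i j := by
        have h : (Matrix.GeneralLinearGroup.map ((Double.snd S[X] (I.map (algebraMap R S[X])) :
          PolyDouble S I →ₐ[S[X]] S[X]) : PolyDouble S I →+* S[X]) g' : Matrix ι ι S[X]) = 1 := by
            rw [hsnd]; rfl
        exact congrFun (congrFun h i) j
      have h2 := congrFun (congrFun (Matrix.map_one (n := ι) (aeval (0 : S[X]) : S[X] →ₐ[S] S[X])
        (map_zero _) (map_one _)) i) j
      rw [Matrix.map_apply, ← h1] at h2
      refine Eq.trans h2 (Eq.trans h1 (congrFun (congrFun (Matrix.map_one (Double.snd S[X]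
        (I.map (algebraMap R S[X]))) (map_zero _) (map_one _)).symm i) j))
  have hθ : ∀ a, (doubleZero S I : PolyDouble S I →+* PolyDouble S I) ((doubleZero S I : PolyDouble S I →+* PolyDouble S I) a) =
      (doubleZero S I : PolyDouble S I →+* PolyDouble S I) a := by
    intro a
    have : ∀ p : S[X], aeval (0 : S[X]) (aeval (0 : S[X]) p) = aeval (0 : S[X]) p := fun p => by
      rw [aeval_zero_eq_C p, aeval_C]; rfl
    exact Double.ext (this _) (this _)
  obtain ⟨l₀, hl₀⟩ := exists_dilation_of_mem_closure s I b hd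
    (mem_closure_kernelGens h𝒴 hθ hg' hg'0)
  -- The shift by one only serves to make the exponent positive.
  refine ⟨l₀ + 1, Nat.succ_pos _, fun c hc => ?_⟩
  obtain ⟨c', rfl⟩ := Ideal.mem_span_singleton'.1 hc
  set l := l₀ + 1
  obtain ⟨τ, hτ, e⟩ := hl₀ l (Nat.le_succ _)
  set J := I.map (algebraMap R R[X])
  set τ₁ := extendEquiv Q (Double.fst R J) τ
  set τ₂ := extendEquiv Q (Double.snd R J) τ
  have e₁ : extend (polyMap R S) τ₁.toLinearMap = extend (polyMap R S) (scale (s ^ l) σ) := by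
    rw [extend_polyMap_scale, hσ, extend_matEnd, coe_extendEquiv, extend_extend,
      show (polyMap R S).comp (Double.fst R J) =
        ((Double.fst S _).restrictScalars R).comp (doublePolyMap S I) from rfl,
      ← extend_extend, e, extend_matEnd, ← hfst]
    rfl
  have e₂ : extend (polyMap R S) τ₂.toLinearMap = (1 : Module.End S[X] _) := by
    rw [coe_extendEquiv, extend_extend,
      show (polyMap R S).comp (Double.snd R J) =
        ((Double.snd S _).restrictScalars R).comp (doublePolyMap S I) from rfl,
      ← extend_extend, e, extend_matEnd]
    rw [← map_one (matEnd S[X] b)]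
    congr 1
    have h1 : ((Matrix.GeneralLinearGroup.map ((Double.snd S[X] (I.map (algebraMap R S[X])) :
      PolyDouble S I →ₐ[S[X]] S[X]) : PolyDouble S I →+* S[X]) g' : GL ι S[X]) :
      Matrix ι ι S[X]) = 1 := by rw [hsnd]; rfl
    have h2 := congrArg (fun M : Matrix ι ι S[X] =>
      M.map (aeval (C (algebraMap R S (s ^ l)) * X : S[X]))) h1
    refine Eq.trans h2 ?_
    ext i j : 2
    simp only [Matrix.map_apply, Matrix.one_apply]
    split_ifs <;> simp
  -- `τ₂` is trivial over `S[X]` but possibly not over `R[X]`. Dividing by it keeps the localization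
  -- of `τ₁` and lands in the relative group.
  set τ₃ := τ₁ * τ₂⁻¹
  have m₃ := fst_mul_inv_snd_mem h𝒩 hτ
  have e₃ : extend (polyMap R S) τ₃.toLinearMap = extend (polyMap R S) (scale (s ^ l) σ) := by
    have : (extend (polyMap R S) τ₃.toLinearMap * extend (polyMap R S) τ₂.toLinearMap :
        Module.End S[X] _) = extend (polyMap R S) τ₁.toLinearMap := by
      rw [← extend_equiv_mul, inv_mul_cancel_right]
    rw [← e₁, ← this, e₂]; rfl
  let θ : R[X] →ₐ[R] R[X] := (aeval (0 : R[X])).restrictScalars R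
  have hθθ : θ.comp θ = θ := by ext; simp [θ]
  -- Likewise the value of `τ₃` at `X = 0` is trivial only after localization. It is itself
  -- relative, so dividing by it normalises the value at `0` and changes nothing over `S[X]`.
  set τ₀ := extendEquiv Q θ τ₃
  have e₀ : extend (polyMap R S) τ₀.toLinearMap = (1 : Module.End S[X] _) := by
    rw [coe_extendEquiv, extend_extend, polyMap_comp_aeval (S := S) _ 0 (map_zero _),
      ← extend_extend, e₃, extend_polyMap_scale, extend_extend]
    rw [show ((aeval (0 : S[X])).restrictScalars R).comp
        ((aeval (C (algebraMap R S (s ^ l)) * X : S[X])).restrictScalars R) =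
        ((aeval (0 : S[X])).restrictScalars R : S[X] →ₐ[R] S[X]) from
        congrArg (AlgHom.restrictScalars R) (show (aeval (0 : S[X])).comp
          (aeval (C (algebraMap R S (s ^ l)) * X : S[X])) = aeval (0 : S[X]) by ext; simp)]
    exact h0S
  have m₀ : τ₀ ∈ normalClosureIn (Subgroup.closure (rootAuts 𝒩 (⊤ : Ideal R[X])))
      (rootAuts 𝒩 J) := extend_mem_relRootAuts θ (map_mem_map_algebraMap θ I) m₃
  have m₄ := Subgroup.mul_mem _ m₃ (Subgroup.inv_mem _ m₀)
  have a₄ : extend θ (τ₃ * τ₀⁻¹).toLinearMap = LinearMap.id := by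
    rw [← coe_extendEquiv, map_mul, map_inv]
    have : extendEquiv Q θ τ₀ = extendEquiv Q θ τ₃ := by
      apply LinearEquiv.toLinearMap_injective
      rw [coe_extendEquiv, coe_extendEquiv, extend_extend, hθθ]
    rw [this, mul_inv_cancel]
    rfl
  have e₄ : extend (polyMap R S) (τ₃ * τ₀⁻¹).toLinearMap =
      extend (polyMap R S) (scale (s ^ l) σ) := by
    have : (extend (polyMap R S) (τ₃ * τ₀⁻¹).toLinearMap * extend (polyMap R S) τ₀.toLinearMap :
        Module.End S[X] _) = extend (polyMap R S) τ₃.toLinearMap := by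
      rw [← extend_equiv_mul, inv_mul_cancel_right]
    rw [← e₃, ← this, e₀]; rfl
  -- The substitution `X ↦ c' X` passes from the solution for `s ^ l` to the one for `c = c' * s ^
  -- l`.
  let δ : R[X] →ₐ[R] R[X] := aeval (C c' * X : R[X])
  refine ⟨extendEquiv Q δ (τ₃ * τ₀⁻¹), extend_mem_relRootAuts δ (map_mem_map_algebraMap δ I) m₄,
    ?_, ?_⟩
  · rw [atZero_eq_iff, coe_extendEquiv, extend_extend,
      show ((aeval (0 : R[X])).restrictScalars R : R[X] →ₐ[R] R[X]).comp δ = θ by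
        ext; simp [θ, δ]]
    exact a₄
  · rw [coe_extendEquiv, mul_comm c', ← scale_mul, extend_polyMap_scale c', ← e₄,
      ← extend_polyMap_scale]
    rfl

end DilationTheorem

end RelDilation

namespace RelDilation

/-! ### Linear transvections -/

section LinearTransvections

variable {C : Type*} [CommRing C] {V : Type*} [AddCommGroup V] [Module C V]

/-- The endomorphism `x ↦ x + φ(x) u`. -/
def linTrans (u : V) (φ : Module.Dual C V) : Module.End C V := 1 + φ.smulRight u

@[simp] theorem linTrans_apply (u : V) (φ : Module.Dual C V) (x : V) :
    linTrans u φ x = x + φ x • u := rfl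

theorem linTrans_add_right {u : V} {φ ψ : Module.Dual C V} (h : φ u = 0) :
    linTrans u (φ + ψ) = linTrans u φ * linTrans u ψ := by
  ext x
  simp only [linTrans_apply, Module.End.mul_apply, LinearMap.add_apply, map_add, map_smul, h]
  module

theorem linTrans_add_left {u v : V} {φ : Module.Dual C V} (h : φ v = 0) :
    linTrans (u + v) φ = linTrans u φ * linTrans v φ := by
  ext x
  simp only [linTrans_apply, Module.End.mul_apply, map_add, map_smul, h]
  module

theorem linTrans_smul_left (a : C) (u : V) (φ : Module.Dual C V) :
    linTrans (a • u) φ = linTrans u (a • φ) := by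
  ext x
  simp only [linTrans_apply, LinearMap.smul_apply, smul_eq_mul]
  module

theorem linTrans_zero_right (u : V) : linTrans u (0 : Module.Dual C V) = 1 := by
  ext x; simp

/-- The coordinate-free form of the relation `[E_ij(x), E_jk(y)] = E_ik(xy)`. -/
theorem linTrans_commutator {u v : V} {φ ψ : Module.Dual C V} (h1 : φ u = 0) (h2 : ψ v = 0)
    (h3 : ψ u = 0) :
    linTrans u φ * linTrans v ψ * linTrans u (-φ) * linTrans v (-ψ) =
      linTrans u (φ v • ψ) := by
  ext x
  simp only [linTrans_apply, Module.End.mul_apply, LinearMap.neg_apply, LinearMap.smul_apply,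
    map_add, map_smul, h1, h2, h3, smul_eq_mul]
  module

variable {𝓜 : Submonoid (Module.End C V)} {e : V} {π : Module.Dual C V}

/-- Split `u = p + π(u) e` with `π p = 0`. The part along `e` is a given transvection, and the part
along `p` is the commutator of `linTrans p π` with `linTrans e φ`, since `π e = 1`. -/
theorem linTrans_mem_of_apply_eq_zero (he : π e = 1)
    (H1 : ∀ x, π x = 0 → linTrans x π ∈ 𝓜) (H2 : ∀ φ : Module.Dual C V, φ e = 0 → linTrans e φ ∈ 𝓜)
    {u : V} {φ : Module.Dual C V} (hφe : φ e = 0) (hφu : φ u = 0) : linTrans u φ ∈ 𝓜 := by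
  set p := u - π u • e
  have hp : π p = 0 := by simp [p, he]
  have hφp : φ p = 0 := by simp [p, hφe, hφu]
  have h1 : linTrans p φ ∈ 𝓜 := by
    have := linTrans_commutator hp hφe hφp
    rw [he, one_smul] at this
    rw [← this]
    refine 𝓜.mul_mem (𝓜.mul_mem (𝓜.mul_mem (H1 p hp) (H2 φ hφe)) ?_) (H2 _ (by simp [hφe]))
    rw [show linTrans p (-π) = linTrans (-p) π by ext x; simp]
    exact H1 (-p) (by simp [hp])
  have h2 : linTrans (π u • e) φ ∈ 𝓜 := by
    rw [linTrans_smul_left]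
    exact H2 _ (by simp [hφe])
  rw [show u = p + π u • e by simp [p], linTrans_add_left (by simp [hφe])]
  exact 𝓜.mul_mem h1 h2

/-- Split `φ = (φ - φ(e) π) + φ(e) π`: the first summand kills `e`, so the preceding lemma applies,
and the second gives a given transvection. -/
theorem linTrans_mem_of_proj_eq_zero (he : π e = 1)
    (H1 : ∀ x, π x = 0 → linTrans x π ∈ 𝓜) (H2 : ∀ φ : Module.Dual C V, φ e = 0 → linTrans e φ ∈ 𝓜)
    {u : V} {φ : Module.Dual C V} (hπu : π u = 0) (hφu : φ u = 0) : linTrans u φ ∈ 𝓜 := by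
  have h1 : linTrans u (φ - φ e • π) ∈ 𝓜 :=
    linTrans_mem_of_apply_eq_zero he H1 H2 (by simp [he]) (by simp [hφu, hπu])
  have h2 : linTrans u (φ e • π) ∈ 𝓜 := by
    rw [← linTrans_smul_left]
    exact H1 _ (by simp [hπu])
  rw [← sub_add_cancel φ (φ e • π), linTrans_add_right (by simp [hφu, hπu])]
  exact 𝓜.mul_mem h1 h2

/-- The functional `φ = α(u) π - π(u) α` kills both `u` and `q`. Write `β(q) u = u' + β(u) q` with
`β(u') = 0`: the `q`-part is covered by `linTrans_mem_of_proj_eq_zero`, and the `u'`-part is the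
commutator of `linTrans u' β` with `linTrans q (h • φ)`. One factor `β(q)` comes from the splitting
of `u`, the other from the commutator. -/
theorem linTrans_koszul_mem (he : π e = 1)
    (H1 : ∀ x, π x = 0 → linTrans x π ∈ 𝓜) (H2 : ∀ φ : Module.Dual C V, φ e = 0 → linTrans e φ ∈ 𝓜)
    {u q : V} {α β : Module.Dual C V} (hβ : β e = 0) (hq : π q = 0) (hαq : α q = 0)
    (h : C) : linTrans u ((h * β q ^ 2) • (α u • π - π u • α)) ∈ 𝓜 := by
  set φ := α u • π - π u • α
  have hφu : φ u = 0 := by simp [φ, mul_comm]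
  have hφq : φ q = 0 := by simp [φ, hq, hαq]
  set u' := β q • u - β u • q
  have hφu' : φ u' = 0 := by simp [u', hφu, hφq]
  have hβu' : β u' = 0 := by simp [u', mul_comm]
  have h1 : linTrans u' ((h * β q) • φ) ∈ 𝓜 := by
    have := linTrans_commutator (φ := β) (ψ := h • φ) hβu' (v := q) (by simp [hφq]) (by simp [hφu'])
    rw [smul_smul, mul_comm] at this
    rw [← this]
    exact 𝓜.mul_mem (𝓜.mul_mem (𝓜.mul_mem (linTrans_mem_of_apply_eq_zero he H1 H2 hβ hβu')
      (linTrans_mem_of_proj_eq_zero he H1 H2 hq (by simp [hφq])))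
      (linTrans_mem_of_apply_eq_zero he H1 H2 (by simp [hβ]) (by simp [hβu'])))
      (linTrans_mem_of_proj_eq_zero he H1 H2 hq (by simp [hφq]))
  have h2 : linTrans (β u • q) ((h * β q) • φ) ∈ 𝓜 :=
    linTrans_mem_of_proj_eq_zero he H1 H2 (by simp [hq]) (by simp [hφq])
  have h3 : linTrans u ((h * β q ^ 2) • φ) = linTrans (u' + β u • q) ((h * β q) • φ) := by
    rw [show u' + β u • q = β q • u by simp [u'], linTrans_smul_left, smul_smul]
    congr 2; ring
  rw [h3, linTrans_add_left (by simp [hφq])]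
  exact 𝓜.mul_mem h1 h2

theorem linTrans_sum_mem {u : V} {σ : Type*} (t : Finset σ) {f : σ → Module.Dual C V}
    (h0 : ∀ i ∈ t, f i u = 0) (hf : ∀ i ∈ t, linTrans u (f i) ∈ 𝓜) :
    linTrans u (∑ i ∈ t, f i) ∈ 𝓜 := by
  classical
  induction t using Finset.induction_on with
  | empty => rw [Finset.sum_empty, linTrans_zero_right]; exact 𝓜.one_mem
  | insert a t ha ih =>
    rw [Finset.sum_insert ha, linTrans_add_right (h0 a (Finset.mem_insert_self _ _))]
    exact 𝓜.mul_mem (hf a (Finset.mem_insert_self _ _))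
      (ih (fun i hi => h0 i (Finset.mem_insert_of_mem hi))
        fun i hi => hf i (Finset.mem_insert_of_mem hi))

/-- As `φ u = 0`, the functional `χ(u) φ` equals the Koszul functional `χ(u) φ - φ(u) χ`. Separating
the `π`-components of `φ` and `χ` leaves a Koszul functional killing `e` plus `κ(u) π - π(u) κ`.
Expanding `K κ` in the `α i` reduces the latter to `linTrans_koszul_mem`. Of the factor `K ^ 3`, one
`K` is spent on this expansion and two on the squares `β(q) ^ 2`. -/
theorem linTrans_unimodular_mem (he : π e = 1)
    (H1 : ∀ x, π x = 0 → linTrans x π ∈ 𝓜) (H2 : ∀ φ : Module.Dual C V, φ e = 0 → linTrans e φ ∈ 𝓜)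
    {σ : Type*} [Fintype σ] {p : σ → V} {α : σ → Module.Dual C V} {K : C}
    (hspan : ∀ κ : Module.Dual C V, κ e = 0 → K • κ = ∑ i, κ (p i) • α i)
    (hoff : ∀ i, ∃ q β, π q = 0 ∧ α i q = 0 ∧ (β : Module.Dual C V) e = 0 ∧ β q = K)
    {u : V} {φ χ : Module.Dual C V} (hφ : φ u = 0) (h : C) :
    linTrans u ((h * K ^ 3 * χ u) • φ) ∈ 𝓜 := by
  set φ₁ := φ - φ e • π
  set χ₁ := χ - χ e • π
  set κ := φ e • χ₁ - χ e • φ₁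
  have hφ₁ : φ₁ e = 0 := by simp [φ₁, he]
  have hχ₁ : χ₁ e = 0 := by simp [χ₁, he]
  have hκ : κ e = 0 := by simp [κ, hφ₁, hχ₁]
  have key : (h * K ^ 3 * χ u) • φ = (h * K ^ 3) • (χ₁ u • φ₁ - φ₁ u • χ₁) +
      ∑ i, (h * κ (p i) * K ^ 2) • (α i u • π - π u • α i) := by
    have e1 : ∑ i, (h * κ (p i) * K ^ 2) • (α i u • π - π u • α i) =
        (h * K ^ 2) • ((∑ i, κ (p i) • α i) u • π - π u • ∑ i, κ (p i) • α i) := by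
      simp only [LinearMap.sum_apply, LinearMap.smul_apply, Finset.sum_smul, Finset.smul_sum,
        smul_sub, Finset.sum_sub_distrib, smul_smul, smul_eq_mul]
      congr 1 <;> refine Finset.sum_congr rfl fun i _ => ?_ <;> congr 1 <;> ring
    rw [e1, ← hspan κ hκ]
    ext x
    simp only [κ, φ₁, χ₁, LinearMap.smul_apply, LinearMap.add_apply, LinearMap.sub_apply,
      smul_eq_mul, hφ]
    ring
  rw [key, linTrans_add_right (by simp [mul_comm])]
  refine 𝓜.mul_mem (linTrans_mem_of_apply_eq_zero he H1 H2 (by simp [hφ₁, hχ₁])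
    (by simp [mul_comm])) (linTrans_sum_mem _ (fun i _ => by simp [mul_comm]) fun i _ => ?_)
  obtain ⟨q, β, hq, hαq, hβ, hβq⟩ := hoff i
  rw [← hβq]
  exact linTrans_koszul_mem he H1 H2 hβ hq hαq _

end LinearTransvections

/-! ### Lifting along localizations -/

section Lifting

variable {R : Type*} [CommRing R] {C C' : Type*} [CommRing C] [CommRing C'] [Algebra R C]
  [Algebra R C'] {s : R} {loc : C →ₐ[R] C'} {Q : Type*} [AddCommGroup Q] [Module R Q]

theorem exists_scalarMap_eq (hl : IsAwayMap s loc) (u : C' ⊗[R] Q) :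
    ∃ k : ℕ, ∃ v, s ^ k • u = scalarMap Q loc v := by
  induction u using TensorProduct.induction_on with
  | zero => exact ⟨0, 0, by simp⟩
  | tmul a q =>
    obtain ⟨k, d, h⟩ := hl.1 a
    exact ⟨k, d ⊗ₜ q, by rw [scalarMap_tmul, ← h, TensorProduct.smul_tmul']⟩
  | add x y hx hy =>
    obtain ⟨k, v, h⟩ := hx
    obtain ⟨k', v', h'⟩ := hy
    refine ⟨k + k', s ^ k' • v + s ^ k • v', ?_⟩
    rw [map_add, map_smul, map_smul, ← h, ← h', smul_smul, smul_smul, ← pow_add, ← pow_add,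
      smul_add, add_comm k']

theorem exists_common_lift (hl : IsAwayMap s loc) {σ : Type*} [Finite σ] (f : σ → C') :
    ∃ k : ℕ, ∃ d : σ → C, ∀ i, s ^ k • f i = loc (d i) := by
  cases nonempty_fintype σ
  choose k d h using fun i => hl.1 (f i)
  refine ⟨∑ i, k i, fun i => s ^ (∑ j, k j - k i) • d i, fun i => ?_⟩
  rw [map_smul, ← h, smul_smul, ← pow_add,
    Nat.sub_add_cancel (Finset.single_le_sum (fun _ _ => Nat.zero_le _) (Finset.mem_univ i))]

/-- A finite dual basis of a finitely generated projective module. -/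
theorem exists_dual_basis (R Q : Type*) [CommRing R] [AddCommGroup Q] [Module R Q]
    [Module.Finite R Q] [Module.Projective R Q] :
    ∃ (n : ℕ) (x : Fin n → Q) (ξ : Fin n → Module.Dual R Q), ∀ q, ∑ i, ξ i q • x i = q := by
  obtain ⟨n, f, g, -, -, hfg⟩ := Module.Finite.exists_comp_eq_id_of_projective R Q
  refine ⟨n, fun i => f fun j => if i = j then 1 else 0, fun i => LinearMap.proj i ∘ₗ g,
    fun q => ?_⟩
  have := DFunLike.congr_fun hfg q
  rw [LinearMap.comp_apply, LinearMap.pi_apply_eq_sum_univ f (g q)] at this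
  exact this

/-- A functional on `C' ⊗ Q` is determined by its values on a finite dual basis of `Q`, so a single
power of `s` clears all denominators. -/
theorem exists_dual_lift [Module.Finite R Q] [Module.Projective R Q] (hl : IsAwayMap s loc)
    (φ : Module.Dual C' (C' ⊗[R] Q)) :
    ∃ k : ℕ, ∃ ψ : Module.Dual C (C ⊗[R] Q), ∀ x, loc (ψ x) = s ^ k • φ (scalarMap Q loc x) := by
  obtain ⟨n, x, ξ, hx⟩ := exists_dual_basis R Q
  obtain ⟨k, d, hd⟩ := exists_common_lift hl fun i => φ (1 ⊗ₜ x i)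
  refine ⟨k, ∑ i, d i • (ξ i).baseChange C, fun y => ?_⟩
  induction y using TensorProduct.induction_on with
  | zero => simp
  | tmul a q =>
    have : φ (loc a ⊗ₜ[R] q) = ∑ i, loc a * algebraMap R C' (ξ i q) * φ (1 ⊗ₜ x i) := by
      conv_lhs => rw [← hx q]
      rw [TensorProduct.tmul_sum, map_sum]
      refine Finset.sum_congr rfl fun i _ => ?_
      rw [← smul_eq_mul, ← map_smul]
      congr 1
      rw [TensorProduct.smul_tmul', TensorProduct.tmul_smul, TensorProduct.smul_tmul']
      simp [Algebra.smul_def, mul_comm]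
    rw [scalarMap_tmul, this, LinearMap.sum_apply, map_sum, Finset.smul_sum]
    refine Finset.sum_congr rfl fun i _ => ?_
    rw [LinearMap.smul_apply, smul_eq_mul, map_mul, ← hd]
    simp [Algebra.smul_def]
    ring
  | add x y hx hy => rw [map_add, map_add, hx, hy, map_add, map_add, smul_add]

theorem isAwayMap_ofId {S : Type*} [CommRing S] [Algebra R S] (s : R) [IsLocalization.Away s S] :
    IsAwayMap s (Algebra.ofId R S) := by
  constructor
  · intro y
    obtain ⟨k, d, h⟩ := IsLocalization.Away.surj s y
    refine ⟨k, d, ?_⟩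
    rw [Algebra.smul_def, mul_comm, map_pow, h]; rfl
  · intro d hd
    obtain ⟨⟨m, ⟨k, hk⟩⟩, h⟩ := (IsLocalization.map_eq_zero_iff (Submonoid.powers s) S d).1 hd
    refine ⟨k, ?_⟩
    rw [smul_eq_mul]
    change s ^ k = m at hk
    rw [hk]; exact h

section Frame

variable {S : Type*} [CommRing S] [Algebra R S] (s : R) [IsLocalization.Away s S]

theorem exists_pow_smul_eq_one_tmul {σ : Type*} [Finite σ] (f : σ → S ⊗[R] Q) :
    ∃ k : ℕ, ∃ p : σ → Q, ∀ i, 1 ⊗ₜ p i = s ^ k • f i := by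
  cases nonempty_fintype σ
  choose k v h using fun i => exists_scalarMap_eq (isAwayMap_ofId (S := S) s) (f i)
  have key : ∀ v : R ⊗[R] Q, scalarMap Q (Algebra.ofId R S) v = 1 ⊗ₜ TensorProduct.lid R Q v := by
    intro v
    induction v using TensorProduct.induction_on with
    | zero => simp
    | tmul a q =>
      simp [TensorProduct.tmul_smul, TensorProduct.smul_tmul', Algebra.ofId_apply,
        Algebra.algebraMap_eq_smul_one]
    | add x y hx hy => rw [map_add, hx, hy, map_add, TensorProduct.tmul_add]
  refine ⟨∑ i, k i, fun i => s ^ (∑ j, k j - k i) • TensorProduct.lid R Q (v i), fun i => ?_⟩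
  rw [TensorProduct.tmul_smul, ← key, ← h, smul_smul, ← pow_add,
    Nat.sub_add_cancel (Finset.single_le_sum (fun _ _ => Nat.zero_le _) (Finset.mem_univ i))]

theorem exists_pow_smul_eq_zero_of_algebraMap {σ : Type*} [Finite σ] (f : σ → R)
    (hf : ∀ i, algebraMap R S (f i) = 0) : ∃ k : ℕ, ∀ i, s ^ k * f i = 0 := by
  cases nonempty_fintype σ
  choose k h using fun i => (isAwayMap_ofId (S := S) s).2 (f i) (hf i)
  refine ⟨∑ i, k i, fun i => ?_⟩
  rw [← Nat.sub_add_cancel (Finset.single_le_sum (f := k) (fun _ _ => Nat.zero_le _)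
    (Finset.mem_univ i)), pow_add, mul_assoc, ← smul_eq_mul (s ^ k i), h, mul_zero]

/-- A finite dual basis reduces the vanishing of `D` to that of finitely many scalars, which gives
an exponent independent of `x`. -/
theorem exists_pow_smul_eq_zero [Module.Finite R Q] [Module.Projective R Q]
    (D : Module.End R Q) (hD : ∀ x, (1 : S) ⊗ₜ[R] D x = 0) : ∃ k : ℕ, ∀ x, s ^ k • D x = 0 := by
  obtain ⟨n, x, ξ, hx⟩ := exists_dual_basis R Q
  obtain ⟨k, hk⟩ := exists_pow_smul_eq_zero_of_algebraMap (S := S) s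
    (fun i : Fin n × Fin n => ξ i.1 (D (x i.2))) fun i => by
      have := congrArg ((ξ i.1).baseChange S) (hD (x i.2))
      simpa [Algebra.algebraMap_eq_smul_one] using this
  refine ⟨k, fun y => ?_⟩
  rw [← hx y, map_sum, Finset.smul_sum]
  refine Finset.sum_eq_zero fun j _ => ?_
  rw [map_smul, ← hx (D (x j)), smul_comm, Finset.smul_sum, Finset.sum_eq_zero, smul_zero]
  intro i _
  rw [smul_smul, hk (i, j), zero_smul]

/-- A basis of a localization, together with its dual basis, up to denominators. -/
theorem exists_frame [Module.Finite R Q] [Module.Projective R Q] {σ : Type*} [Fintype σ]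
    [DecidableEq σ] (e : Module.Basis σ S (S ⊗[R] Q)) :
    ∃ (k : ℕ) (p : σ → Q) (φ : σ → Module.Dual R Q), (∀ x, ∑ i, φ i x • p i = s ^ k • x) ∧
      ∀ i j, φ i (p j) = if i = j then s ^ k else 0 := by
  obtain ⟨k, p, hp⟩ := exists_pow_smul_eq_one_tmul s e
  choose k' ψ hψ using fun i => exists_dual_lift (isAwayMap_ofId (S := S) s) (e.coord i)
  set K := ∑ i, k' i
  set φ : σ → Module.Dual R Q := fun i => s ^ (K - k' i) • ψ i ∘ₗ TensorProduct.mk R R Q 1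
  have hφ : ∀ i x, algebraMap R S (φ i x) = s ^ K • e.repr (1 ⊗ₜ x) i := by
    intro i x
    have h1 : algebraMap R S (ψ i (1 ⊗ₜ x)) = s ^ k' i • e.repr (1 ⊗ₜ x) i := by
      simpa using hψ i (1 ⊗ₜ x)
    simp only [φ, LinearMap.smul_apply, LinearMap.comp_apply, TensorProduct.mk_apply]
    rw [smul_eq_mul, map_mul, h1, ← Algebra.smul_def, smul_smul, ← pow_add,
      Nat.sub_add_cancel (Finset.single_le_sum (fun _ _ => Nat.zero_le _) (Finset.mem_univ i))]
  obtain ⟨t, ht⟩ := exists_pow_smul_eq_zero_of_algebraMap (S := S) s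
    (fun i : σ × σ => φ i.1 (p i.2) - if i.1 = i.2 then s ^ (K + k) else 0) fun i => by
      rw [map_sub, hφ, hp, ← algebraMap_smul S (s ^ k) (e i.2), map_smul]
      simp [Finsupp.single_apply, Algebra.smul_def, pow_add, eq_comm]
      split_ifs <;> simp
  obtain ⟨t', ht'⟩ := exists_pow_smul_eq_zero (S := S) s
    (∑ i, (φ i).smulRight (p i) - s ^ (K + k) • LinearMap.id) fun x => by
      simp only [LinearMap.sub_apply, LinearMap.sum_apply, LinearMap.smulRight_apply,
        LinearMap.smul_apply, LinearMap.id_apply, TensorProduct.tmul_sub, TensorProduct.tmul_sum,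
        TensorProduct.tmul_smul, hp]
      rw [sub_eq_zero]
      conv_rhs => rw [← e.sum_repr (1 ⊗ₜ x), Finset.smul_sum]
      refine Finset.sum_congr rfl fun i _ => ?_
      rw [← algebraMap_smul S (φ i x), hφ, smul_assoc, smul_comm _ (s ^ k), smul_smul, pow_add]
  -- Over `R` the two relations hold only up to `s`-torsion, killed by `s ^ t` and `s ^ t'`; scaling
  -- the functionals, and not the vectors, repairs both.
  refine ⟨t + t' + (K + k), p, fun i => s ^ (t + t') • φ i, fun x => ?_, fun i j => ?_⟩
  · have := ht' x
    rw [LinearMap.sub_apply, smul_sub, sub_eq_zero] at this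
    simp only [LinearMap.sum_apply, LinearMap.smulRight_apply, LinearMap.smul_apply,
      LinearMap.id_apply] at this
    simp only [LinearMap.smul_apply, smul_assoc, ← Finset.smul_sum]
    rw [pow_add, mul_smul, this]
    simp only [smul_smul]
    congr 1
    ring
  · have := ht (i, j)
    rw [mul_sub, sub_eq_zero] at this
    rw [LinearMap.smul_apply, smul_eq_mul, pow_add, mul_right_comm, this]
    simp only [mul_ite, mul_zero, ite_mul, zero_mul]
    congr 1
    ring

end Frame

end Lifting

end RelDilation

namespace RelDilation

/-! ### Endomorphisms underlying root automorphisms -/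

section RootEnds

variable {R : Type*} [CommRing R] {C : Type*} [CommRing C] [Algebra R C] {Q : Type*}
  [AddCommGroup Q] [Module R Q]

/-- The endomorphisms underlying the group generated by the root automorphisms. -/
def rootEnds (C : Type*) [CommRing C] [Algebra R C] (𝒩 : Set (Module.End R Q)) :
    Submonoid (Module.End C (C ⊗[R] Q)) where
  carrier := {φ | ∃ τ ∈ Subgroup.closure (rootAuts 𝒩 (⊤ : Ideal C)), τ.toLinearMap = φ}
  mul_mem' := by
    rintro _ _ ⟨τ, hτ, rfl⟩ ⟨τ', hτ', rfl⟩
    exact ⟨τ * τ', Subgroup.mul_mem _ hτ hτ', rfl⟩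
  one_mem' := ⟨1, Subgroup.one_mem _, rfl⟩

theorem one_add_smul_mem_rootEnds {𝒩 : Set (Module.End R Q)} (h𝒩 : ∀ N ∈ 𝒩, N * N = 0)
    {N : Module.End R Q} (hN : N ∈ 𝒩) (h : C) :
    (1 + h • N.baseChange C : Module.End C (C ⊗[R] Q)) ∈ rootEnds C 𝒩 := by
  obtain ⟨g, hg⟩ := exists_rootAut (A := C) (h𝒩 N hN) h
  exact ⟨g, Subgroup.subset_closure ⟨N, hN, h, Submodule.mem_top, hg⟩, hg⟩

theorem relRootAuts_le {𝒩 : Set (Module.End R Q)} {J : Ideal C}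
    (G : Ideal C → Set ((C ⊗[R] Q) ≃ₗ[C] (C ⊗[R] Q))) (h : ∀ J, rootAuts 𝒩 J ⊆ G J) :
    normalClosureIn (Subgroup.closure (rootAuts 𝒩 (⊤ : Ideal C))) (rootAuts 𝒩 J) ≤
      normalClosureIn (Subgroup.closure (G ⊤)) (G J) :=
  normalClosureIn_mono (Subgroup.closure_mono (h ⊤)) (h J)

theorem relRootMatrices_le {A ι : Type*} [CommRing A] [Fintype ι] [DecidableEq ι]
    {𝒴 : Set (Matrix ι ι ℤ)} {J : Ideal A} (G : Ideal A → Set (GL ι A))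
    (h : ∀ J, G J ⊆ rootMatrices 𝒴 J) :
    normalClosureIn (Subgroup.closure (G ⊤)) (G J) ≤
      normalClosureIn (Subgroup.closure (rootMatrices 𝒴 (⊤ : Ideal A))) (rootMatrices 𝒴 J) :=
  normalClosureIn_mono (Subgroup.closure_mono (h ⊤)) (h J)

end RootEnds

/-! ### Linear transvections of `P ⊕ R` as root automorphisms. -/

section LinearCase

variable {R : Type*} [CommRing R] {P : Type*} [AddCommGroup P] [Module R P]

theorem splitLin_symm_apply (A : Type*) [CommRing A] [Algebra R A] (p : A ⊗[R] P) (a : A) :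
    (splitLin A P).symm (p, a) =
      (LinearMap.inl R P R).baseChange A p + a ⊗ₜ ((0 : P), (1 : R)) := by
  rw [LinearEquiv.symm_apply_eq, map_add]
  have h1 : splitLin A P ((LinearMap.inl R P R).baseChange A p) = (p, 0) := by
    induction p using TensorProduct.induction_on with
    | zero => rw [map_zero, map_zero]; rfl
    | tmul b q => simp [splitLin]
    | add x y hx hy => rw [map_add, map_add, hx, hy]; simp
  rw [h1]
  simp [splitLin]

/-- The nilpotent endomorphisms of `P ⊕ R` giving the elementary transvections. -/
def linNilp (R P : Type*) [CommRing R] [AddCommGroup P] [Module R P] :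
    Set (Module.End R (P × R)) :=
  {N | (∃ x : P, N = LinearMap.inl R P R ∘ₗ (LinearMap.snd R P R).smulRight x) ∨
    ∃ φ : Module.Dual R P, N = LinearMap.inr R P R ∘ₗ φ ∘ₗ LinearMap.fst R P R}

theorem linNilp_sq : ∀ N ∈ linNilp R P, N * N = 0 := by
  rintro _ (⟨x, rfl⟩ | ⟨φ, rfl⟩) <;> ext <;> simp

theorem rootAuts_linNilp_subset (A : Type*) [CommRing A] [Algebra R A] (J : Ideal A) :
    rootAuts (linNilp R P) J ⊆ transGens A P J := by
  rintro g ⟨N, (⟨x, rfl⟩ | ⟨φ, rfl⟩), h, hh, e⟩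
  · refine Or.inl ⟨h • (1 ⊗ₜ x), Submodule.smul_mem_smul hh Submodule.mem_top, fun p a => ?_⟩
    have e' : g ((splitLin A P).symm (p, a)) = _ := DFunLike.congr_fun e _
    rw [e', splitLin_symm_apply, splitLin_symm_apply]
    have h1 : ((LinearMap.inl R P R ∘ₗ (LinearMap.snd R P R).smulRight x).baseChange A)
        ((LinearMap.inl R P R).baseChange A p) = 0 := by
      rw [← LinearMap.comp_apply, ← LinearMap.baseChange_comp]
      have : (LinearMap.inl R P R ∘ₗ (LinearMap.snd R P R).smulRight x) ∘ₗ LinearMap.inl R P R = 0 := by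
        refine LinearMap.ext fun y => ?_
        simp
      rw [this, LinearMap.baseChange_zero, LinearMap.zero_apply]
    simp only [LinearMap.add_apply, Module.End.one_apply, LinearMap.smul_apply, map_add, h1,
      LinearMap.baseChange_tmul, LinearMap.comp_apply, LinearMap.smulRight_apply,
      LinearMap.snd_apply, LinearMap.inl_apply, one_smul, TensorProduct.smul_tmul',
      smul_eq_mul, mul_one, mul_comm h a]
    abel
  · refine Or.inr ⟨h • φ.baseChange A, Submodule.smul_mem_smul hh Submodule.mem_top, fun p a => ?_⟩
    have e' : g ((splitLin A P).symm (p, a)) = _ := DFunLike.congr_fun e _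
    rw [e', splitLin_symm_apply, splitLin_symm_apply]
    have h1 : ((LinearMap.inr R P R ∘ₗ φ ∘ₗ LinearMap.fst R P R).baseChange A)
        ((LinearMap.inl R P R).baseChange A p) = (φ.baseChange A p) ⊗ₜ ((0 : P), (1 : R)) := by
      clear e'
      induction p using TensorProduct.induction_on with
      | zero => simp
      | tmul b q =>
        have : ((0 : P), φ q) = φ q • ((0 : P), (1 : R)) := by simp
        simp only [LinearMap.baseChange_tmul, LinearMap.comp_apply, LinearMap.inl_apply,
          LinearMap.fst_apply, LinearMap.inr_apply]
        rw [this, TensorProduct.tmul_smul, TensorProduct.smul_tmul']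
        simp
      | add x y hx hy => simp only [map_add, hx, hy, TensorProduct.add_tmul]
    simp only [LinearMap.add_apply, Module.End.one_apply, LinearMap.smul_apply, map_add, h1,
      LinearMap.baseChange_tmul, LinearMap.comp_apply,
      LinearMap.fst_apply, map_zero, TensorProduct.tmul_zero, smul_zero, add_zero,
      TensorProduct.smul_tmul', TensorProduct.add_tmul]
    abel

theorem linearGens_subset {A ι : Type*} [CommRing A] [Fintype ι] [DecidableEq ι] (J : Ideal A) :
    linearGens ι J ⊆ rootMatrices {Y | ∃ i j, i ≠ j ∧ Y = Matrix.single i j 1} J := by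
  rintro g ⟨i, j, hij, z, hz, e⟩
  refine ⟨_, ⟨i, j, hij, rfl⟩, z, hz, ?_⟩
  rw [e, Matrix.map_single]
  simp [Matrix.smul_single]

variable {C : Type*} [CommRing C] [Algebra R C]

theorem inl_add_smul_eq (x : C ⊗[R] (P × R)) :
    (LinearMap.inl R P R).baseChange C ((LinearMap.fst R P R).baseChange C x) +
      Module.Dual.baseChange C (LinearMap.snd R P R) x • ((1 : C) ⊗ₜ ((0 : P), (1 : R))) = x := by
  induction x using TensorProduct.induction_on with
  | zero => simp
  | tmul a q =>
    obtain ⟨p, r⟩ := q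
    have : ((p, r) : P × R) = (p, 0) + r • (0, 1) := by simp
    conv_rhs => rw [this, TensorProduct.tmul_add, TensorProduct.tmul_smul]
    simp [TensorProduct.smul_tmul']
  | add x y hx hy =>
    conv_rhs => rw [← hx, ← hy]
    simp only [map_add, add_smul]
    abel

/-- Root automorphisms provide only the parameters `a ⊗ q`; additivity of `linTrans` in the vector
gives the sums. -/
theorem linTrans_inl_mem (x : C ⊗[R] (P × R))
    (hx : Module.Dual.baseChange C (LinearMap.snd R P R) x = 0) :
    linTrans x (Module.Dual.baseChange C (LinearMap.snd R P R)) ∈ rootEnds C (linNilp R P) := by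
  rw [← inl_add_smul_eq x, hx, zero_smul, add_zero]
  have h0 : ∀ y : C ⊗[R] P, Module.Dual.baseChange C (LinearMap.snd R P R)
      ((LinearMap.inl R P R).baseChange C y) = 0 := by
    intro y
    induction y using TensorProduct.induction_on with
    | zero => simp
    | tmul a q => simp
    | add x y hx hy => rw [map_add, map_add, hx, hy, add_zero]
  generalize (LinearMap.fst R P R).baseChange C x = y
  induction y using TensorProduct.induction_on with
  | zero =>
    rw [map_zero]
    convert (rootEnds C (linNilp R P)).one_mem
    exact LinearMap.ext fun x => by simp
  | tmul a q =>
    have := one_add_smul_mem_rootEnds (C := C) linNilp_sq (N := LinearMap.inl R P R ∘ₗ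
      (LinearMap.snd R P R).smulRight q) (Or.inl ⟨q, rfl⟩) a
    convert this using 1
    refine TensorProduct.AlgebraTensorModule.curry_injective ?_
    refine LinearMap.ext fun c => LinearMap.ext fun ⟨p, r⟩ => ?_
    change linTrans _ _ (c ⊗ₜ (p, r)) = c ⊗ₜ (p, r) + a • LinearMap.baseChange C
      (LinearMap.inl R P R ∘ₗ (LinearMap.snd R P R).smulRight q) (c ⊗ₜ (p, r))
    have h : (LinearMap.inl R P R ∘ₗ (LinearMap.snd R P R).smulRight q) (p, r) = r • (q, 0) := by
      simp
    rw [linTrans_apply, LinearMap.baseChange_tmul, LinearMap.baseChange_tmul, h,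
      Module.Dual.baseChange_apply_tmul, LinearMap.snd_apply, TensorProduct.tmul_smul,
      LinearMap.inl_apply, TensorProduct.smul_tmul', TensorProduct.smul_tmul',
      TensorProduct.smul_tmul']
    congr 2
    simp [Algebra.smul_def]
    ring
  | add x y hx hy =>
    rw [map_add, linTrans_add_left (h0 y)]
    exact mul_mem hx hy

/-- A functional vanishing on `(0, 1)` comes from `P` and expands in a dual frame. It is used with
`k = 1` for a dual basis of `P`, and with a power of `s` for the frame obtained from a basis of
`P_s`. -/
theorem dual_eq_sum {n : ℕ} {x : Fin n → P} {ξ : Fin n → Module.Dual R P} {k : R}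
    (hx : ∀ q, ∑ i, ξ i q • x i = k • q) {φ : Module.Dual C (C ⊗[R] (P × R))}
    (hφ : φ (1 ⊗ₜ (0, 1)) = 0) :
    algebraMap R C k • φ = ∑ i, φ (1 ⊗ₜ (x i, 0)) •
      Module.Dual.baseChange C (ξ i ∘ₗ LinearMap.fst R P R) := by
  refine TensorProduct.AlgebraTensorModule.curry_injective ?_
  refine LinearMap.ext fun c => LinearMap.ext fun ⟨p, r⟩ => ?_
  have h1 : φ (c ⊗ₜ (p, r)) = c * φ (1 ⊗ₜ (p, 0)) := by
    have : ((p, r) : P × R) = (p, 0) + r • (0, 1) := by simp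
    have h2 : ∀ q : P × R, (c ⊗ₜ q : C ⊗[R] (P × R)) = c • (1 ⊗ₜ q) := fun q => by
      simp [TensorProduct.smul_tmul']
    rw [this, TensorProduct.tmul_add, TensorProduct.tmul_smul, map_add, h2, h2 (0, 1),
      ← algebraMap_smul C r, map_smul, map_smul, map_smul, hφ]
    simp
  have h3 : algebraMap R C k * φ (1 ⊗ₜ (p, 0)) = ∑ i, algebraMap R C (ξ i p) * φ (1 ⊗ₜ (x i, 0)) := by
    have h4 : ((1 : C) ⊗ₜ[R] ((k • p, 0) : P × R)) =
        ∑ i, algebraMap R C (ξ i p) • ((1 : C) ⊗ₜ[R] ((x i, 0) : P × R)) := by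
      simp only [algebraMap_smul, ← TensorProduct.tmul_smul, ← TensorProduct.tmul_sum]
      congr 1
      rw [← hx p]
      ext <;> simp [Prod.fst_sum, Prod.snd_sum]
    have h5 : ((k • p, 0) : P × R) = k • (p, 0) := by simp
    rw [h5, TensorProduct.tmul_smul, ← algebraMap_smul C k] at h4
    have := congrArg φ h4
    rw [map_smul, map_sum] at this
    simpa only [map_smul, smul_eq_mul] using this
  simp only [AlgebraTensorModule.curry_apply, LinearMap.restrictScalars_apply, TensorProduct.curry_apply,
    LinearMap.smul_apply, LinearMap.sum_apply, smul_eq_mul]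
  rw [h1, mul_left_comm, h3, Finset.mul_sum]
  refine Finset.sum_congr rfl fun i _ => ?_
  simp [Algebra.smul_def]
  ring

/-- As `P` is finitely generated projective, a functional on `C ⊗ P` is a finite combination of base
changes of functionals on `P`, and each term is a root automorphism. -/
theorem linTrans_inr_mem [Module.Finite R P] [Module.Projective R P]
    {φ : Module.Dual C (C ⊗[R] (P × R))} (hφ : φ (1 ⊗ₜ (0, 1)) = 0) :
    linTrans (1 ⊗ₜ (0, 1)) φ ∈ rootEnds C (linNilp R P) := by
  obtain ⟨n, x, ξ, hx⟩ := exists_dual_basis R P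
  have := dual_eq_sum (k := 1) (by simpa using hx) hφ
  rw [map_one, one_smul] at this
  rw [this]
  refine linTrans_sum_mem _ (fun i _ => by simp) fun i _ => ?_
  have := one_add_smul_mem_rootEnds (C := C) linNilp_sq (N := LinearMap.inr R P R ∘ₗ
      ξ i ∘ₗ LinearMap.fst R P R) (Or.inr ⟨ξ i, rfl⟩) (φ (1 ⊗ₜ (x i, 0)))
  convert this using 1
  refine TensorProduct.AlgebraTensorModule.curry_injective ?_
  refine LinearMap.ext fun c => LinearMap.ext fun ⟨p, r⟩ => ?_
  change linTrans _ _ (c ⊗ₜ[R] (p, r)) = c ⊗ₜ[R] (p, r) + φ (1 ⊗ₜ (x i, 0)) • LinearMap.baseChange C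
    (LinearMap.inr R P R ∘ₗ ξ i ∘ₗ LinearMap.fst R P R) (c ⊗ₜ (p, r))
  have h : (LinearMap.inr R P R ∘ₗ ξ i ∘ₗ LinearMap.fst R P R) (p, r) = ξ i p • (0, 1) := by simp
  rw [linTrans_apply, LinearMap.baseChange_tmul, h, LinearMap.smul_apply,
    Module.Dual.baseChange_apply_tmul, TensorProduct.tmul_smul, TensorProduct.smul_tmul',
    TensorProduct.smul_tmul', TensorProduct.smul_tmul']
  congr 2
  simp [Algebra.smul_def]

theorem extend_linTrans {C' : Type*} [CommRing C'] [Algebra R C'] {Q : Type*} [AddCommGroup Q]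
    [Module R Q] (loc : C →ₐ[R] C') {u : C ⊗[R] Q} {φ : Module.Dual C (C ⊗[R] Q)}
    {φ' : Module.Dual C' (C' ⊗[R] Q)} (h : ∀ x, φ' (scalarMap Q loc x) = loc (φ x)) :
    extend loc (linTrans u φ) = linTrans (scalarMap Q loc u) φ' :=
  eq_extend loc fun x => by
    rw [linTrans_apply, linTrans_apply, map_add, scalarMap_smul, h]

end LinearCase

/-! ### Denominators in the linear case. -/

section LinearDenominators

universe u v

variable {R : Type u} [CommRing R] {P : Type v} [AddCommGroup P] [Module R P] {S : Type u}
  [CommRing S] [Algebra R S]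

/-- The conjugate of the matrix unit is the rank-one map with vector `γ b_i` and functional `b_j^*
γ⁻¹`, lifted to `u` and `ψ`. The functional `b_i^* γ⁻¹` takes the value `1` on `γ b_i`, so its lift
`χ` takes on `u` a value that localizes to a power of `s`. Thus `linTrans_unimodular_mem` applies.
-/
theorem hasDenominators_linear [Module.Finite R P] [Module.Projective R P] (s : R)
    [IsLocalization.Away s S] {n : ℕ} (hn : 2 ≤ n) (e : Module.Basis (Fin n) S (S ⊗[R] P))
    {ι : Type*} [Fintype ι] [DecidableEq ι] (b : Module.Basis ι S (S ⊗[R] (P × R))) :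
    HasDenominators s b {Y | ∃ i j, i ≠ j ∧ Y = Matrix.single i j 1} (linNilp R P) := by
  rintro C C' _ _ _ _ _ _ loc hloc γ - Y ⟨i, j, hij, rfl⟩
  obtain ⟨k, p, φ, hp, hφp⟩ := exists_frame s e
  set b' := extBasis C' b
  set G := matEnd C' b (γ : Matrix ι ι C')
  set G' := matEnd C' b ((γ⁻¹ : GL ι C') : Matrix ι ι C')
  have hG : ∀ x, G' (G x) = x := fun x => by
    rw [← Module.End.mul_apply, ← matEnd_mul, Units.inv_mul, matEnd_one, Module.End.one_apply]
  have hY : matEnd C' b ((Matrix.single i j (1 : ℤ)).map (Int.castRingHom C')) =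
      (b'.coord j).smulRight (b' i) := by
    refine b'.ext fun v => ?_
    rw [matEnd_extBasis]
    simp [Matrix.single_apply, Finsupp.single_apply, b', ite_and, eq_comm]
  obtain ⟨k₁, u, hu⟩ := exists_scalarMap_eq hloc (G (b' i))
  obtain ⟨k₂, ψ, hψ⟩ := exists_dual_lift hloc (b'.coord j ∘ₗ G')
  obtain ⟨k₃, χ, hχ⟩ := exists_dual_lift hloc (b'.coord i ∘ₗ G')
  have hψu : loc (ψ u) = 0 := by
    rw [hψ, ← hu]
    simp [hG, hij, ← algebraMap_smul C' (s ^ k₁)]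
  have hχu : loc (χ u) = algebraMap R C' (s ^ (k₃ + k₁)) := by
    rw [hχ, ← hu]
    simp [hG, ← algebraMap_smul C' (s ^ k₁), Algebra.smul_def, pow_add]
  obtain ⟨k₄, hk₄⟩ := hloc.2 _ hψu
  -- Here `3 * k` comes from `K ^ 3`, `k₃ + k₁` from `χ u`, `k₄` from forcing `ψ u = 0` in `C`, and
  -- the final `k₂`, `k₁` from lifting the functional and the vector.
  refine ⟨3 * k + (k₃ + k₁) + k₄ + k₂ + k₁, fun h => ?_⟩
  have hmem : linTrans u ((h * (algebraMap R C (s ^ k)) ^ 3 * χ u) • (s ^ k₄ • ψ)) ∈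
      rootEnds C (linNilp R P) := by
    refine linTrans_unimodular_mem (e := 1 ⊗ₜ (0, 1))
      (π := Module.Dual.baseChange C (LinearMap.snd R P R)) (by simp) linTrans_inl_mem
      (fun φ => linTrans_inr_mem) (p := fun i => 1 ⊗ₜ (p i, 0))
      (α := fun i => Module.Dual.baseChange C (φ i ∘ₗ LinearMap.fst R P R))
      (fun κ hκ => dual_eq_sum hp hκ) (fun i => ?_) ?_ h
    -- Rank at least two supplies a second frame vector, which `φ i` kills.
    · have : Nontrivial (Fin n) := Fin.nontrivial_iff_two_le.2 hn
      obtain ⟨j, hj⟩ := exists_ne i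
      refine ⟨1 ⊗ₜ (p j, 0), Module.Dual.baseChange C (φ j ∘ₗ LinearMap.fst R P R), by simp,
        by simp [hφp, hj.symm], by simp, by simp [hφp, Algebra.algebraMap_eq_smul_one]⟩
    · rw [LinearMap.smul_apply, hk₄]
  obtain ⟨τ, hτ, hτe⟩ := hmem
  refine ⟨τ, hτ, ?_⟩
  rw [hτe, extend_linTrans loc (φ' := (loc h * algebraMap R C' (s ^ (3 * k + (k₃ + k₁) + k₄ + k₂))) •
    (b'.coord j ∘ₗ G'))]
  · rw [← hu, matEnd_mul, matEnd_mul, hY]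
    refine LinearMap.ext fun x => ?_
    simp only [linTrans_apply, LinearMap.add_apply, Module.End.one_apply, LinearMap.smul_apply,
      Module.End.mul_apply, LinearMap.smulRight_apply, map_smul, LinearMap.comp_apply]
    rw [← algebraMap_smul C' (s ^ k₁), Algebra.smul_def (s ^ _) (loc h), smul_smul, smul_smul,
      smul_eq_mul, pow_add s _ k₁, map_mul]
    congr 2
    ring
  · intro x
    simp only [LinearMap.smul_apply, map_mul, smul_eq_mul, hχu, hψ, map_pow,
      AlgHom.commutes, LinearMap.comp_apply, Algebra.smul_def]
    ring

end LinearDenominators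

end RelDilation

namespace RelDilation

universe u v

/-! ### From matrices over `R_s[X]` to the dilation statement. -/

section Conclusion

variable {R : Type u} [CommRing R] {Q : Type v} [AddCommGroup Q] [Module R Q]

theorem extBasis_eq_constMap (s : R) {ι : Type*} [Fintype ι] [DecidableEq ι]
    (b : Module.Basis ι (Localization.Away s) (Localization.Away s ⊗[R] Q)) (v : ι) :
    extBasis (Localization.Away s)[X] b v = constMap s Q (b v) :=
  extBasis_apply _ b v

theorem localize_eq_matEnd (s : R) {ι : Type*} [Fintype ι] [DecidableEq ι]
    (b : Module.Basis ι (Localization.Away s) (Localization.Away s ⊗[R] Q))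
    (σ : R[X] ⊗[R] Q →ₗ[R[X]] R[X] ⊗[R] Q) (M : Matrix ι ι (Localization.Away s)[X])
    (h : ∀ v, localize s σ (constMap s Q (b v)) = ∑ u, M u v • constMap s Q (b u)) :
    localize s σ = matEnd (Localization.Away s)[X] b M := by
  refine (extBasis (Localization.Away s)[X] b).ext fun v => ?_
  rw [matEnd_extBasis, extBasis_eq_constMap, h]
  simp only [extBasis_eq_constMap]

/-- The dilation principle for groups generated by root elements. -/
theorem exists_dilation_of_matrixMem (s : R) (I : Ideal R) {ι : Type*} [Fintype ι] [DecidableEq ι]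
    (b : Module.Basis ι (Localization.Away s) (Localization.Away s ⊗[R] Q))
    {𝒴 : Set (Matrix ι ι ℤ)} {𝒩 : Set (Module.End R Q)}
    (h𝒴 : ∀ Y ∈ 𝒴, Y * Y = 0) (h𝒩 : ∀ N ∈ 𝒩, N * N = 0) (hd : HasDenominators s b 𝒴 𝒩)
    (G : Ideal (Localization.Away s)[X] → Set (GL ι (Localization.Away s)[X]))
    (hG : ∀ J, G J ⊆ rootMatrices 𝒴 J)
    (T : Ideal R[X] → Set ((R[X] ⊗[R] Q) ≃ₗ[R[X]] (R[X] ⊗[R] Q)))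
    (hT : ∀ J, rootAuts 𝒩 J ⊆ T J)
    (σ : (R[X] ⊗[R] Q) ≃ₗ[R[X]] (R[X] ⊗[R] Q)) (h0 : atZero σ.toLinearMap = LinearMap.id)
    (hσ : MatrixMem s b (normalClosureIn (Subgroup.closure (G ⊤))
      (G (I.map (algebraMap R (Localization.Away s)[X])))) σ.toLinearMap) :
    ∃ l : ℕ, 0 < l ∧ ∀ c ∈ Ideal.span {s ^ l},
      ∃ τ ∈ normalClosureIn (Subgroup.closure (T ⊤)) (T (I.map (algebraMap R R[X]))),
        atZero τ.toLinearMap = LinearMap.id ∧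
        localize s τ.toLinearMap = localize s (scale c σ.toLinearMap) := by
  obtain ⟨g, hg, e⟩ := hσ
  -- `localize s` unfolds to `extend (polyMap R _)`, so the identity for `localize s σ` is accepted
  -- as it stands.
  obtain ⟨l, hl, H⟩ := exists_dilation s I b h𝒴 h𝒩 hd σ.toLinearMap h0
    (relRootMatrices_le G hG hg) (localize_eq_matEnd s b _ _ e)
  refine ⟨l, hl, fun c hc => ?_⟩
  obtain ⟨τ, hτ, h1, h2⟩ := H c hc
  exact ⟨τ, relRootAuts_le T hT hτ, h1, h2⟩

end Conclusion

/-! ### The dilation principle in the linear case. -/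

section LinearConclusion

variable {R : Type u} [CommRing R] {P : Type v} [AddCommGroup P] [Module R P]

theorem lTensor_inl_eq {A : Type*} [CommRing A] [Algebra R A] (p : A ⊗[R] P) :
    (LinearMap.inl R P R).lTensor A p = (LinearMap.inl R P R).baseChange A p := rfl

theorem exists_basis_addOne {n : ℕ} (s : R)
    (e : Module.Basis (Fin n) (Localization.Away s) (Localization.Away s ⊗[R] P)) :
    ∃ b : Module.Basis (Fin n ⊕ Unit) (Localization.Away s) (Localization.Away s ⊗[R] (P × R)),
      ⇑b = addOne s e := by
  refine ⟨(e.prod (Module.Basis.singleton Unit _)).map (splitLin _ P).symm, funext fun v => ?_⟩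
  rcases v with i | i
  · rw [Module.Basis.map_apply, Module.Basis.prod_apply]
    simp [splitLin_symm_apply, addOne, lTensor_inl_eq]
  · rw [Module.Basis.map_apply, Module.Basis.prod_apply]
    simp [splitLin_symm_apply, addOne]

theorem dilation_linear [Module.Finite R P] [Module.Projective R P] (I : Ideal R) {n : ℕ} (s : R)
    (hn : 2 ≤ n) (σ : (R[X] ⊗[R] (P × R)) ≃ₗ[R[X]] (R[X] ⊗[R] (P × R)))
    (h0 : atZero σ.toLinearMap = LinearMap.id) (hσ : LocElemLin n I s σ.toLinearMap) :
    ∃ l : ℕ, 0 < l ∧ ∀ b ∈ Ideal.span {s ^ l},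
      ∃ τ ∈ relETrans R[X] P (I.map (algebraMap R R[X])),
        atZero τ.toLinearMap = LinearMap.id ∧
        localize s τ.toLinearMap = localize s (scale b σ.toLinearMap) := by
  obtain ⟨e, he⟩ := hσ
  obtain ⟨b, hb⟩ := exists_basis_addOne s e
  rw [← hb] at he
  refine exists_dilation_of_matrixMem s I b (𝒴 := {Y | ∃ i j, i ≠ j ∧ Y = Matrix.single i j 1})
    ?_ linNilp_sq (hasDenominators_linear s hn e b) (linearGens (Fin n ⊕ Unit)) linearGens_subset
    (transGens R[X] P) (rootAuts_linNilp_subset R[X]) σ h0 he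
  rintro _ ⟨i, j, hij, rfl⟩
  exact Matrix.single_mul_single_of_ne _ _ _ _ hij.symm _

end LinearConclusion

end RelDilation

namespace RelDilation

/-! ### Forms and standard bases -/

section BaseChangeForm

variable {R : Type*} [CommRing R] {Q : Type*} [AddCommGroup Q] [Module R Q]
  {C C' : Type*} [CommRing C] [Algebra R C] [CommRing C'] [Algebra R C']

theorem baseChange_scalarMap (B : LinearMap.BilinForm R Q) (f : C →ₐ[R] C') (x y : C ⊗[R] Q) :
    B.baseChange C' (scalarMap Q f x) (scalarMap Q f y) = f (B.baseChange C x y) := by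
  induction x using TensorProduct.induction_on with
  | zero => simp
  | add x x' hx hx' => simp only [map_add, LinearMap.add_apply, hx, hx']
  | tmul a q =>
    induction y using TensorProduct.induction_on with
    | zero => simp
    | add x x' hx hx' => simp only [map_add, hx, hx']
    | tmul a' q' => simp [LinearMap.BilinForm.baseChange_tmul]

theorem baseChange_comm {B : LinearMap.BilinForm R Q} {c : R} (h : ∀ x y, B x y = c * B y x)
    (x y : C ⊗[R] Q) : B.baseChange C x y = algebraMap R C c * B.baseChange C y x := by
  induction x using TensorProduct.induction_on with
  | zero => simp
  | add x x' hx hx' => simp only [map_add, LinearMap.add_apply, hx, hx', mul_add]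
  | tmul a q =>
    induction y using TensorProduct.induction_on with
    | zero => simp
    | add x x' hx hx' => simp only [map_add, LinearMap.add_apply, hx, hx', mul_add]
    | tmul a' q' =>
      rw [LinearMap.BilinForm.baseChange_tmul, LinearMap.BilinForm.baseChange_tmul, h,
        mul_smul, Algebra.smul_def, mul_comm a]

theorem isStdBasis_extBasis {S : Type*} [CommRing S] [Algebra R S] [Algebra S C]
    [IsScalarTower R S C] {B : LinearMap.BilinForm R Q} {k : ℕ} {c : S}
    {b : Module.Basis (PairIdx k) S (S ⊗[R] Q)} (hb : IsStdBasis (B.baseChange S) c b) :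
    IsStdBasis (B.baseChange C) (algebraMap S C c) (extBasis C b) := by
  intro u v
  rw [extBasis_apply, extBasis_apply, baseChange_scalarMap, hb]
  simp only [stdForm, IsScalarTower.coe_toAlgHom']
  split_ifs <;> simp

end BaseChangeForm

section StdBasis

theorem swapIdx_swapIdx {k : ℕ} (u : PairIdx k) : swapIdx (swapIdx u) = u := by
  simp [swapIdx]

theorem swapIdx_inj {k : ℕ} {u v : PairIdx k} : swapIdx u = swapIdx v ↔ u = v :=
  ⟨fun h => by rw [← swapIdx_swapIdx u, h, swapIdx_swapIdx], fun h => h ▸ rfl⟩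

theorem swapIdx_ne {k : ℕ} (u : PairIdx k) : swapIdx u ≠ u := fun h => by
  simpa [swapIdx] using congrArg Prod.snd h

variable {C V : Type*} [CommRing C] [AddCommGroup V] [Module C V]

/-- The endomorphism `x ↦ ⟨x, v⟩ u`. -/
def rankOne (ω : LinearMap.BilinForm C V) (u v : V) : Module.End C V :=
  (ω.flip v).smulRight u

@[simp] theorem rankOne_apply (ω : LinearMap.BilinForm C V) (u v x : V) :
    rankOne ω u v x = ω x v • u := rfl

/-- The sign `⟨b_j, b_{swapIdx j}⟩` for a standard basis. -/
def stdSign {k : ℕ} (c : C) (j : PairIdx k) : C := if j.2 then c else 1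

theorem stdSign_mul_self {k : ℕ} {c : C} (hc : c * c = 1) (j : PairIdx k) :
    stdSign c j * stdSign c j = 1 := by
  unfold stdSign
  split_ifs <;> simp [hc]

variable {ω : LinearMap.BilinForm C V} {k : ℕ} {c : C} {b : Module.Basis (PairIdx k) C V}

theorem IsStdBasis.apply_self (hb : IsStdBasis ω c b) (u : PairIdx k) : ω (b u) (b u) = 0 := by
  rw [hb, stdForm, if_neg (swapIdx_ne u).symm]

theorem IsStdBasis.apply_swapIdx (hb : IsStdBasis ω c b) (y : V) (j : PairIdx k) :
    ω y (b (swapIdx j)) = stdSign c j * b.repr y j := by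
  conv_lhs => rw [← b.sum_repr y]
  rw [map_sum, LinearMap.sum_apply, Finset.sum_eq_single j]
  · rw [map_smul, LinearMap.smul_apply, hb, stdForm, if_pos rfl, smul_eq_mul, mul_comm, stdSign]
  · intro u _ hu
    rw [map_smul, LinearMap.smul_apply, hb, stdForm, if_neg (fun h => hu (swapIdx_inj.1 h).symm),
      smul_zero]
  · simp

theorem IsStdBasis.coord_eq (hb : IsStdBasis ω c b) (hc : c * c = 1) (y : V) (j : PairIdx k) :
    b.repr y j = stdSign c j * ω y (b (swapIdx j)) := by
  rw [hb.apply_swapIdx, ← mul_assoc, stdSign_mul_self hc, one_mul]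

theorem IsStdBasis.toLin_single (hb : IsStdBasis ω c b) (hc : c * c = 1) (i j : PairIdx k) :
    Matrix.toLinAlgEquiv b (Matrix.single i j (1 : C)) =
      stdSign c j • rankOne ω (b i) (b (swapIdx j)) := by
  refine LinearMap.ext fun x => ?_
  rw [LinearMap.smul_apply, rankOne_apply, smul_smul, ← hb.coord_eq hc]
  rw [Matrix.toLinAlgEquiv_apply]
  simp only [Matrix.single_mulVec]
  simp [Function.update_apply, ite_smul]

/-- The linear terms cancel by skewness, and the quadratic term is `ω (N x) (N y) = -ω x (N (N y)) =
0`. -/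
theorem isometry_one_add_smul {N : Module.End C V} (hs : ∀ x y, ω (N x) y = -ω x (N y))
    (hN : N * N = 0) (z : C) (x y : V) :
    ω ((1 + z • N : Module.End C V) x) ((1 + z • N : Module.End C V) y) = ω x y := by
  have h1 : N (N y) = 0 := by rw [← Module.End.mul_apply, hN, LinearMap.zero_apply]
  simp only [LinearMap.add_apply, Module.End.one_apply, LinearMap.smul_apply, map_add, map_smul, hs,
    h1, map_zero, smul_eq_mul]
  ring

theorem isometry_of_mem_closure {ι : Type*} [Fintype ι] [DecidableEq ι]
    (β : Module.Basis ι C V) {𝒴 : Set (Matrix ι ι ℤ)} (h𝒴 : ∀ Y ∈ 𝒴, Y * Y = 0)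
    (hs : ∀ Y ∈ 𝒴, ∀ x y, ω (Matrix.toLinAlgEquiv β (Y.map (Int.castRingHom C)) x) y =
      -ω x (Matrix.toLinAlgEquiv β (Y.map (Int.castRingHom C)) y)) {γ : GL ι C}
    (hγ : γ ∈ Subgroup.closure (rootMatrices 𝒴 (⊤ : Ideal C))) (x y : V) :
    ω (Matrix.toLinAlgEquiv β (γ : Matrix ι ι C) x) (Matrix.toLinAlgEquiv β (γ : Matrix ι ι C) y) =
      ω x y := by
  have key : ∀ g : GL ι C, ∀ x, Matrix.toLinAlgEquiv β (g : Matrix ι ι C)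
      (Matrix.toLinAlgEquiv β ((g⁻¹ : GL ι C) : Matrix ι ι C) x) = x := fun g x => by
    rw [← Module.End.mul_apply, ← map_mul, Units.mul_inv, map_one, Module.End.one_apply]
  induction hγ using Subgroup.closure_induction generalizing x y with
  | mem g hg =>
    obtain ⟨Y, hY, z, -, e⟩ := hg
    rw [e, map_add, map_one, map_smul]
    refine isometry_one_add_smul (hs Y hY) ?_ z x y
    rw [← map_mul, ← Matrix.map_mul, h𝒴 Y hY]
    simp
  | one => simp
  | mul g g' _ _ h h' =>
    rw [Units.val_mul, map_mul, Module.End.mul_apply, Module.End.mul_apply, h, h']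
  | inv g _ h => rw [← h, key, key]

/-- In terms of the form a matrix unit is a rank-one map, and an isometry moves `γ⁻¹` across the
form; conjugation therefore just applies `γ` to both vectors. -/
theorem IsStdBasis.conj_single (hb : IsStdBasis ω c b) (hc : c * c = 1)
    {γ : GL (PairIdx k) C}
    (hγ : ∀ x y, ω (Matrix.toLinAlgEquiv b (γ : Matrix _ _ C) x)
      (Matrix.toLinAlgEquiv b (γ : Matrix _ _ C) y) = ω x y) (i j : PairIdx k) :
    Matrix.toLinAlgEquiv b ((γ : Matrix _ _ C) * Matrix.single i j (1 : C) *
      ((γ⁻¹ : GL (PairIdx k) C) : Matrix _ _ C)) =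
      stdSign c j • rankOne ω (Matrix.toLinAlgEquiv b (γ : Matrix _ _ C) (b i))
        (Matrix.toLinAlgEquiv b (γ : Matrix _ _ C) (b (swapIdx j))) := by
  refine LinearMap.ext fun x => ?_
  rw [map_mul, map_mul, hb.toLin_single hc]
  simp only [Module.End.mul_apply, LinearMap.smul_apply, rankOne_apply, map_smul]
  rw [← hγ, ← Module.End.mul_apply _ _ x, ← map_mul, Units.mul_inv, map_one, Module.End.one_apply]

end StdBasis

section SumForm

variable {R : Type*} [CommRing R] {P : Type*} [AddCommGroup P] [Module R P]
  {B : LinearMap.BilinForm R P} {c : R}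

theorem sumForm_apply (v w : P × R × R) :
    sumForm B c v w = B v.1 w.1 + v.2.1 * w.2.2 + c * (v.2.2 * w.2.1) := rfl

theorem sumForm_comm (hc : c * c = 1) (h : ∀ x y, B x y = c * B y x) (x y : P × R × R) :
    sumForm B c x y = c * sumForm B c y x := by
  rw [sumForm_apply, sumForm_apply, h]
  linear_combination (-(x.2.1 * y.2.2)) * hc

variable (C : Type*) [CommRing C] [Algebra R C]

theorem splitForm_symm_apply (p : C ⊗[R] P) (a b : C) :
    (splitForm C P).symm (p, a, b) =
      (LinearMap.inl R P (R × R)).baseChange C p + a ⊗ₜ ((0 : P), (1 : R), (0 : R)) +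
        b ⊗ₜ ((0 : P), (0 : R), (1 : R)) := by
  rw [LinearEquiv.symm_apply_eq, map_add, map_add]
  have h1 : splitForm C P ((LinearMap.inl R P (R × R)).baseChange C p) = (p, 0, 0) := by
    induction p using TensorProduct.induction_on with
    | zero => rw [map_zero, map_zero]; rfl
    | tmul b q => simp [splitForm]
    | add x y hx hy => rw [map_add, map_add, hx, hy]; simp
  rw [h1]
  simp [splitForm]

theorem baseChange_sumForm_inl (p q : C ⊗[R] P) :
    (sumForm B c).baseChange C ((LinearMap.inl R P (R × R)).baseChange C p)
      ((LinearMap.inl R P (R × R)).baseChange C q) = B.baseChange C p q := by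
  induction p using TensorProduct.induction_on with
  | zero => simp
  | add x x' hx hx' => simp only [map_add, LinearMap.add_apply, hx, hx']
  | tmul a p' =>
    induction q using TensorProduct.induction_on with
    | zero => simp
    | add x x' hx hx' => simp only [map_add, hx, hx']
    | tmul a' q' => simp [LinearMap.BilinForm.baseChange_tmul, sumForm_apply]

end SumForm

end RelDilation

namespace RelDilation

/-! ### Symplectic transvections -/

section SymplecticTransvections

variable {C V : Type*} [CommRing C] [AddCommGroup V] [Module C V]

/-- The endomorphism `x ↦ x + ⟨x, v⟩ u + ⟨x, u⟩ v`. -/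
def spTrans (ω : LinearMap.BilinForm C V) (u v : V) : Module.End C V :=
  1 + (rankOne ω u v + rankOne ω v u)

/-- The symplectic transvection `x ↦ x + h ⟨x, w⟩ w`. -/
def symTrans (ω : LinearMap.BilinForm C V) (w : V) (h : C) : Module.End C V :=
  1 + h • rankOne ω w w

variable {ω : LinearMap.BilinForm C V}

theorem isAlt_swap (hω : ω.IsAlt) (x y : V) : ω x y = -ω y x := (hω.neg_eq y x).symm

theorem spTrans_apply (u v x : V) : spTrans ω u v x = x + (ω x v • u + ω x u • v) := rfl

theorem symTrans_apply (w : V) (h : C) (x : V) : symTrans ω w h x = x + h • ω x w • w := rfl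

/-- Transvections along `u` with parameters orthogonal to `u` form a Heisenberg-type group:
parameters add up to the central factor `symTrans ω u`. -/
theorem spTrans_mul (hω : ω.IsAlt) {u v v' : V} (h : ω v u = 0) (h' : ω v' u = 0) :
    spTrans ω u v * spTrans ω u v' = spTrans ω u (v + v') * symTrans ω u (ω v' v) := by
  have hu := hω u
  have h2 : ω u v = 0 := by rw [isAlt_swap hω, h, neg_zero]
  have h2' : ω u v' = 0 := by rw [isAlt_swap hω, h', neg_zero]
  refine LinearMap.ext fun x => ?_
  simp only [Module.End.mul_apply, spTrans_apply, symTrans_apply, map_add, map_smul,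
    hu, h', h2, h2']
  module

theorem symTrans_mul (hω : ω.IsAlt) (w : V) (h h' : C) :
    symTrans ω w h * symTrans ω w h' = symTrans ω w (h + h') := by
  have hu := hω w
  refine LinearMap.ext fun x => ?_
  simp only [Module.End.mul_apply, symTrans_apply, map_add, map_smul,
    hu]
  module

theorem symTrans_zero (w : V) : symTrans ω w 0 = 1 := by
  rw [symTrans, zero_smul, add_zero]

theorem symTrans_smul (w : V) (a h : C) : symTrans ω (a • w) h = symTrans ω w (a * a * h) := by
  refine LinearMap.ext fun x => ?_
  simp only [symTrans_apply, map_smul, smul_eq_mul]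
  module

theorem spTrans_zero (u : V) : spTrans ω u 0 = 1 := by
  refine LinearMap.ext fun x => by simp [spTrans_apply]

theorem spTrans_smul (u v : V) (h : C) :
    spTrans ω u (h • v) = 1 + h • (rankOne ω u v + rankOne ω v u) := by
  refine LinearMap.ext fun x => ?_
  simp only [spTrans_apply, map_smul, smul_eq_mul, LinearMap.add_apply, LinearMap.smul_apply,
    Module.End.one_apply, rankOne_apply]
  module

/-- Polarization of the quadratic map `w ↦ ⟨x, w⟩ w`. It reduces short root elements to the
transvections `symTrans`. -/
theorem spTrans_smul_eq_mul (hω : ω.IsAlt) {u v : V} (h : ω u v = 0) (z : C) :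
    spTrans ω u (z • v) = symTrans ω (u + v) z * symTrans ω u (-z) * symTrans ω v (-z) := by
  have hu := hω u
  have hv := hω v
  have h' : ω v u = 0 := by rw [isAlt_swap hω, h, neg_zero]
  refine LinearMap.ext fun x => ?_
  simp only [Module.End.mul_apply, spTrans_apply, symTrans_apply, map_add, map_smul,
    hu, hv, h, h', smul_eq_mul]
  module

/-- The relations between a hyperbolic pair `e, f`, a submodule `W` orthogonal to it, and a monoid
containing the elementary symplectic transvections. -/
structure SpElementary (ω : LinearMap.BilinForm C V) (e f : V) (W : Submodule C V)
    (M : Submonoid (Module.End C V)) : Prop where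
  alt : ω.IsAlt
  pair : ω e f = 1
  orth_left : ∀ v ∈ W, ω v e = 0
  orth_right : ∀ v ∈ W, ω v f = 0
  trans_left : ∀ v ∈ W, spTrans ω e v ∈ M
  trans_right : ∀ v ∈ W, spTrans ω f v ∈ M

namespace SpElementary

variable {e f : V} {W : Submodule C V} {M : Submonoid (Module.End C V)}

/-- A commutator of transvections along `e` and `f` with proportional parameters `v` and `t h v`; it
produces a factor `2`, which `t = 1 / 2` offsets. -/
theorem symTrans_mem (H : SpElementary ω e f W M) (h2 : IsUnit (2 : C)) {v : V} (hv : v ∈ W)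
    (h : C) : symTrans ω v h ∈ M := by
  obtain ⟨t, ht⟩ := h2.exists_left_inv
  have ee := H.alt e
  have ff := H.alt f
  have vv := H.alt v
  have ef := H.pair
  have fe : ω f e = -1 := by rw [isAlt_swap H.alt, ef]
  have ve := H.orth_left v hv
  have vf := H.orth_right v hv
  have ev : ω e v = 0 := by rw [isAlt_swap H.alt, ve, neg_zero]
  have fv : ω f v = 0 := by rw [isAlt_swap H.alt, vf, neg_zero]
  have key : symTrans ω v h = spTrans ω e v * spTrans ω f ((-t * h) • v) * spTrans ω e (-v) *
      spTrans ω f ((t * h) • v) := by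
    refine LinearMap.ext fun x => ?_
    simp only [Module.End.mul_apply, spTrans_apply, symTrans_apply, map_add, map_smul, map_neg,
      smul_eq_mul, smul_add, smul_neg, 
      ee, ff, vv, ef, fe, ve, vf, ev, fv]
    have : h = 2 * t * h := by rw [mul_comm 2, ht, one_mul]
    conv_lhs => rw [this]
    module
  rw [key]
  exact mul_mem (mul_mem (mul_mem (H.trans_left _ hv) (H.trans_right _ (W.smul_mem _ hv)))
    (H.trans_left _ (W.neg_mem hv))) (H.trans_right _ (W.smul_mem _ hv))

/-- The transvections along `e` and `f` with parameters proportional to `v` do not commute;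
`symTrans ω v (a * b)` compensates. -/
theorem spTrans_mem (H : SpElementary ω e f W M) (h2 : IsUnit (2 : C)) {v : V} (hv : v ∈ W)
    (a b : C) : spTrans ω (a • e + b • f) v ∈ M := by
  have ff := H.alt f
  have vv := H.alt v
  have fe : ω f e = -1 := by rw [isAlt_swap H.alt, H.pair]
  have ve := H.orth_left v hv
  have vf := H.orth_right v hv
  have fv : ω f v = 0 := by rw [isAlt_swap H.alt, vf, neg_zero]
  have key : spTrans ω (a • e + b • f) v =
      spTrans ω e (a • v) * spTrans ω f (b • v) * symTrans ω v (a * b) := by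
    refine LinearMap.ext fun x => ?_
    simp only [Module.End.mul_apply, spTrans_apply, symTrans_apply, map_add, map_smul, 
      smul_eq_mul, smul_add, 
      vv, fe, ve, vf, fv]
    module
  rw [key]
  exact mul_mem (mul_mem (H.trans_left _ (W.smul_mem _ hv)) (H.trans_right _ (W.smul_mem _ hv)))
    (H.symTrans_mem h2 hv _)

/-- Commutators in the Heisenberg-type group along `u` are central: those with parameters `q` and
`q'` give `symTrans ω u`, and this is where the factor `ω q' q` enters. -/
theorem symTrans_pair_mem (H : SpElementary ω e f W M) (h2 : IsUnit (2 : C)) {q q' : V}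
    (hq : q ∈ W) (hq' : q' ∈ W) (a b h : C) :
    symTrans ω (a • e + b • f) (h * ω q' q) ∈ M := by
  obtain ⟨t, ht⟩ := h2.exists_left_inv
  set u := a • e + b • f with hu
  have qu : ∀ v ∈ W, ω v u = 0 := fun v hv => by
    simp [hu, H.orth_left v hv, H.orth_right v hv]
  have uq : ∀ v ∈ W, ω u v = 0 := fun v hv => by
    rw [isAlt_swap H.alt, qu v hv, neg_zero]
  have uu := H.alt u
  have key : symTrans ω u (h * ω q' q) = spTrans ω u (-q) * spTrans ω u (-((t * h) • q')) *
      spTrans ω u q * spTrans ω u ((t * h) • q') := by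
    refine LinearMap.ext fun x => ?_
    have h3 : ω q q' = - ω q' q := isAlt_swap H.alt q q'
    have h4 := H.alt q
    have h5 := H.alt q'
    simp only [Module.End.mul_apply, spTrans_apply, symTrans_apply, map_add, map_smul, map_neg,
      smul_eq_mul, smul_add, smul_neg,
      uu, qu q hq, qu q' hq', uq q hq, uq q' hq', h3, h4, h5]
    have : h = 2 * t * h := by rw [mul_comm 2, ht, one_mul]
    conv_lhs => rw [this]
    module
  rw [key]
  have hq'' := W.smul_mem (t * h) hq'
  exact mul_mem (mul_mem (mul_mem (H.spTrans_mem h2 (W.neg_mem hq) _ _)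
    (H.spTrans_mem h2 (W.neg_mem hq'') _ _)) (H.spTrans_mem h2 hq _ _))
    (H.spTrans_mem h2 hq'' _ _)

/-- Polarization at `p + u` reduces an arbitrary vector to its component in `W` and its component in
the hyperbolic plane. -/
theorem symTrans_add_mem (H : SpElementary ω e f W M) (h2 : IsUnit (2 : C)) {p q q' : V}
    (hp : p ∈ W) (hq : q ∈ W) (hq' : q' ∈ W) (a b h : C) :
    symTrans ω (p + (a • e + b • f)) (h * ω q' q) ∈ M := by
  have h3 := H.symTrans_pair_mem h2 hq hq' a b h
  have h4 := H.symTrans_mem h2 hp (h * ω q' q)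
  have h5 := H.spTrans_mem h2 (W.smul_mem (h * ω q' q) hp) a b
  set u := a • e + b • f with hu
  have pu : ω p u = 0 := by simp [hu, H.orth_left p hp, H.orth_right p hp]
  have up : ω u p = 0 := by rw [isAlt_swap H.alt, pu, neg_zero]
  have key : symTrans ω (p + u) (h * ω q' q) = symTrans ω p (h * ω q' q) *
      symTrans ω u (h * ω q' q) * spTrans ω u ((h * ω q' q) • p) := by
    refine LinearMap.ext fun x => ?_
    simp only [Module.End.mul_apply, spTrans_apply, symTrans_apply, map_add, map_smul,
      smul_eq_mul, H.alt p, H.alt u, pu, up]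
    module
  rw [key]
  exact mul_mem (mul_mem h4 h3) h5

end SpElementary
end SymplecticTransvections

end RelDilation

namespace RelDilation

/-! ### The symplectic case -/

section RankOne

variable {R : Type*} [CommRing R] {Q : Type*} [AddCommGroup Q] [Module R Q]
  {C C' : Type*} [CommRing C] [Algebra R C] [CommRing C'] [Algebra R C']

theorem rankOne_baseChange (B : LinearMap.BilinForm R Q) (u v : Q) :
    (rankOne B u v).baseChange C = rankOne (B.baseChange C) (1 ⊗ₜ u) (1 ⊗ₜ v) := by
  refine TensorProduct.AlgebraTensorModule.curry_injective ?_
  refine LinearMap.ext fun c => LinearMap.ext fun x => ?_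
  change LinearMap.baseChange C (rankOne B u v) (c ⊗ₜ[R] x) =
    rankOne (B.baseChange C) (1 ⊗ₜ u) (1 ⊗ₜ v) (c ⊗ₜ[R] x)
  rw [LinearMap.baseChange_tmul, rankOne_apply, rankOne_apply, LinearMap.BilinForm.baseChange_tmul,
    TensorProduct.tmul_smul, TensorProduct.smul_tmul', TensorProduct.smul_tmul']
  simp

theorem extend_rankOne (B : LinearMap.BilinForm R Q) (f : C →ₐ[R] C') (u v : C ⊗[R] Q) :
    extend f (rankOne (B.baseChange C) u v) =
      rankOne (B.baseChange C') (scalarMap Q f u) (scalarMap Q f v) :=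
  eq_extend f fun x => by
    rw [rankOne_apply, rankOne_apply, baseChange_scalarMap, scalarMap_smul]

variable {P : Type*} [AddCommGroup P] [Module R P] {B : LinearMap.BilinForm R P} {c : R}

theorem baseChange_sumForm_splitForm (p : C ⊗[R] P) (a b : C) (x : P) (r t : R) :
    (sumForm B c).baseChange C ((splitForm C P).symm (p, a, b)) (1 ⊗ₜ (x, r, t)) =
      B.baseChange C p (1 ⊗ₜ x) + t • a + (c * r) • b := by
  rw [splitForm_symm_apply]
  simp only [map_add, LinearMap.add_apply, LinearMap.BilinForm.baseChange_tmul, sumForm_apply]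
  congr 1
  · congr 1
    · induction p using TensorProduct.induction_on with
      | zero => simp
      | tmul b q => simp [LinearMap.BilinForm.baseChange_tmul, sumForm_apply]
      | add x y hx hy => simp only [map_add, LinearMap.add_apply, hx, hy]
    · simp
  · simp

theorem one_tmul_eq_splitForm (x : P) (r t : R) :
    (1 : C) ⊗ₜ[R] ((x, r, t) : P × R × R) =
      (splitForm C P).symm (1 ⊗ₜ x, algebraMap R C r, algebraMap R C t) := by
  rw [LinearEquiv.eq_symm_apply]
  simp [splitForm, Algebra.algebraMap_eq_smul_one]

end RankOne

section SymplecticRoots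

variable {R : Type*} [CommRing R] {P : Type*} [AddCommGroup P] [Module R P]
  (B : LinearMap.BilinForm R P)

/-- The nilpotent endomorphisms of `P ⊥ R²` giving the elementary symplectic transvections. -/
def spNilp : Set (Module.End R (P × R × R)) :=
  {N | ∃ u ∈ ({(0, 1, 0), (0, 0, 1)} : Set (P × R × R)),
    N = rankOne (sumForm B (-1)) u u ∨ ∃ x : P, N =
      rankOne (sumForm B (-1)) u (x, 0, 0) + rankOne (sumForm B (-1)) (x, 0, 0) u}

variable {B}

theorem spNilp_sq (hB : B.IsAlt) : ∀ N ∈ spNilp B, N * N = 0 := by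
  have h : ∀ x, B x x = 0 := hB
  rintro _ ⟨_, rfl | rfl, rfl | ⟨x, rfl⟩⟩ <;>
    refine LinearMap.ext fun y => ?_ <;>
    simp [sumForm_apply, h]

theorem rootAuts_spNilp_subset (A : Type*) [CommRing A] [Algebra R A] (J : Ideal A) :
    rootAuts (spNilp B) J ⊆ transSpGens A B J := by
  have key : ∀ (g : (A ⊗[R] (P × R × R)) ≃ₗ[A] (A ⊗[R] (P × R × R)))
      (N : Module.End A (A ⊗[R] (P × R × R))), g.toLinearMap = 1 + N → ∀ x, g x = x + N x :=
    fun g N e x => DFunLike.congr_fun e x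
  rintro g ⟨_, ⟨_, rfl | rfl, rfl | ⟨x, rfl⟩⟩, h, hh, e⟩
  · refine Or.inr ⟨0, zero_mem _, -h, neg_mem hh, fun p a b => ?_⟩
    rw [key _ _ e, rankOne_baseChange, LinearMap.smul_apply, rankOne_apply,
      baseChange_sumForm_splitForm, one_tmul_eq_splitForm, ← map_smul, ← map_smul, ← map_add]
    simp
  · refine Or.inr ⟨-h • (1 ⊗ₜ x), Submodule.smul_mem_smul (neg_mem hh) Submodule.mem_top, 0,
      zero_mem _, fun p a b => ?_⟩
    rw [key _ _ e, LinearMap.baseChange_add, rankOne_baseChange, rankOne_baseChange,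
      LinearMap.smul_apply, LinearMap.add_apply, rankOne_apply, rankOne_apply,
      baseChange_sumForm_splitForm, baseChange_sumForm_splitForm, one_tmul_eq_splitForm,
      one_tmul_eq_splitForm, ← map_smul, ← map_smul, ← map_add, ← map_smul, ← map_add]
    simp [smul_smul, mul_comm]
  · refine Or.inl ⟨0, zero_mem _, h, hh, fun p a b => ?_⟩
    rw [key _ _ e, rankOne_baseChange, LinearMap.smul_apply, rankOne_apply,
      baseChange_sumForm_splitForm, one_tmul_eq_splitForm, ← map_smul, ← map_smul, ← map_add]
    simp
  · refine Or.inl ⟨h • (1 ⊗ₜ x), Submodule.smul_mem_smul hh Submodule.mem_top, 0,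
      zero_mem _, fun p a b => ?_⟩
    rw [key _ _ e, LinearMap.baseChange_add, rankOne_baseChange, rankOne_baseChange,
      LinearMap.smul_apply, LinearMap.add_apply, rankOne_apply, rankOne_apply,
      baseChange_sumForm_splitForm, baseChange_sumForm_splitForm, one_tmul_eq_splitForm,
      one_tmul_eq_splitForm, ← map_smul, ← map_smul, ← map_add, ← map_smul, ← map_add]
    simp [smul_smul, mul_comm]

/-- The integer matrices of the root elements of the symplectic group. -/
def spRoots (k : ℕ) : Set (Matrix (PairIdx k) (PairIdx k) ℤ) :=
  {Y | (∃ j, Y = Matrix.single (swapIdx j) j 1) ∨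
    ∃ i j : PairIdx k, i ≠ j ∧ i ≠ swapIdx j ∧ Y = Matrix.single i j 1 -
      (if i.2 = j.2 then 1 else -1 : ℤ) • Matrix.single (swapIdx j) (swapIdx i) 1}

theorem spRoots_sq {k : ℕ} : ∀ Y ∈ spRoots k, Y * Y = 0 := by
  rintro _ (⟨j, rfl⟩ | ⟨i, j, h1, h2, rfl⟩)
  · exact Matrix.single_mul_single_of_ne _ _ _ _ (swapIdx_ne j).symm _
  · rw [sub_mul, mul_sub, mul_sub, Matrix.smul_mul, Matrix.smul_mul, Matrix.mul_smul,
      Matrix.mul_smul, Matrix.single_mul_single_of_ne _ _ _ _ h1.symm,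
      Matrix.single_mul_single_of_ne _ _ _ _ (swapIdx_ne j).symm,
      Matrix.single_mul_single_of_ne _ _ _ _ (swapIdx_ne i),
      Matrix.single_mul_single_of_ne _ _ _ _ (fun h => h1 (swapIdx_inj.1 h))]
    simp

theorem symplecticGens_subset {A : Type*} [CommRing A] {k : ℕ} (J : Ideal A) :
    symplecticGens k J ⊆ rootMatrices (spRoots k) J := by
  rintro g (⟨i, j, rfl, z, hz, e⟩ | ⟨i, j, h1, h2, z, hz, e⟩)
  · refine ⟨_, Or.inl ⟨j, rfl⟩, z, hz, ?_⟩
    rw [e, Matrix.map_single]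
    simp [Matrix.smul_single]
  · refine ⟨_, Or.inr ⟨i, j, h1, h2, rfl⟩, z, hz, ?_⟩
    rw [e]
    have : ∀ ε : ℤ, (Matrix.single i j (1 : ℤ) - ε • Matrix.single (swapIdx j) (swapIdx i) 1).map
        (Int.castRingHom A) = Matrix.single i j (1 : A) -
          (ε : A) • Matrix.single (swapIdx j) (swapIdx i) 1 := fun ε => by
      ext u v
      simp [Matrix.single_apply]
    rw [this, smul_sub, smul_smul, Matrix.smul_single, Matrix.smul_single, add_sub_assoc]
    simp [mul_comm]

variable {C V : Type*} [CommRing C] [AddCommGroup V] [Module C V] {ω : LinearMap.BilinForm C V}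
  {k : ℕ} {b : Module.Basis (PairIdx k) C V}

/-- Long roots give the first alternative, short roots the second; there `u` and `v` are orthogonal
because `i ≠ j`. -/
theorem IsStdBasis.conj_spRoot (hb : IsStdBasis ω (-1) b) {γ : GL (PairIdx k) C}
    (hγ : ∀ x y, ω (Matrix.toLinAlgEquiv b (γ : Matrix _ _ C) x)
      (Matrix.toLinAlgEquiv b (γ : Matrix _ _ C) y) = ω x y) {Y : Matrix (PairIdx k) (PairIdx k) ℤ}
    (hY : Y ∈ spRoots k) :
    ∃ (ε : C) (u v : V), (Matrix.toLinAlgEquiv b ((γ : Matrix _ _ C) *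
        Y.map (Int.castRingHom C) * ((γ⁻¹ : GL (PairIdx k) C) : Matrix _ _ C)) =
          ε • rankOne ω u u) ∨
      (ω u v = 0 ∧ Matrix.toLinAlgEquiv b ((γ : Matrix _ _ C) *
        Y.map (Int.castRingHom C) * ((γ⁻¹ : GL (PairIdx k) C) : Matrix _ _ C)) =
          ε • (rankOne ω u v + rankOne ω v u)) := by
  have hc : (-1 : C) * -1 = 1 := by ring
  obtain (⟨j, rfl⟩ | ⟨i, j, h1, h2, rfl⟩) := hY
  · refine ⟨stdSign (-1) j, Matrix.toLinAlgEquiv b (γ : Matrix _ _ C) (b (swapIdx j)), 0,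
      Or.inl ?_⟩
    rw [Matrix.map_single, map_one, hb.conj_single hc hγ]
  · have : ∀ ε : ℤ, (Matrix.single i j (1 : ℤ) - ε • Matrix.single (swapIdx j) (swapIdx i) 1).map
        (Int.castRingHom C) = Matrix.single i j (1 : C) -
          (ε : C) • Matrix.single (swapIdx j) (swapIdx i) 1 := fun ε => by
      ext u v
      simp [Matrix.single_apply]
    refine ⟨stdSign (-1) j, Matrix.toLinAlgEquiv b (γ : Matrix _ _ C) (b i),
      Matrix.toLinAlgEquiv b (γ : Matrix _ _ C) (b (swapIdx j)), Or.inr ⟨?_, ?_⟩⟩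
    rotate_left
    · rw [this, mul_sub, sub_mul, map_sub, Matrix.mul_smul, Matrix.smul_mul, map_smul,
        hb.conj_single hc hγ, hb.conj_single hc hγ, swapIdx_swapIdx, smul_smul, smul_add,
        sub_eq_add_neg, ← neg_smul]
      congr 2
      obtain ⟨i, b⟩ := i
      obtain ⟨j, b'⟩ := j
      cases b <;> cases b' <;> simp [stdSign, swapIdx]
    · rw [hγ, hb, stdForm, if_neg]
      rw [swapIdx_inj]
      exact h1.symm

theorem IsStdBasis.isometry_sp (hω : ω.IsAlt) (hb : IsStdBasis ω (-1) b) {γ : GL (PairIdx k) C}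
    (hγ : γ ∈ Subgroup.closure (rootMatrices (spRoots k) (⊤ : Ideal C))) (x y : V) :
    ω (Matrix.toLinAlgEquiv b (γ : Matrix _ _ C) x)
      (Matrix.toLinAlgEquiv b (γ : Matrix _ _ C) y) = ω x y := by
  refine isometry_of_mem_closure b spRoots_sq (fun Y hY x y => ?_) hγ x y
  obtain ⟨ε, u, v, h⟩ := hb.conj_spRoot (γ := 1) (by simp) hY
  simp only [Units.val_one, one_mul, inv_one, mul_one] at h
  obtain h | ⟨-, h⟩ := h <;> rw [h] <;>
    simp only [LinearMap.smul_apply, LinearMap.add_apply, rankOne_apply, map_smul, map_add,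
      smul_eq_mul, isAlt_swap hω u y, isAlt_swap hω v y] <;> ring

end SymplecticRoots

end RelDilation

namespace RelDilation

/-! ### `P ⊥ R²` as an instance of `SpElementary`. -/

section SymplecticElementary

variable {R : Type*} [CommRing R] {P : Type*} [AddCommGroup P] [Module R P]
  {B : LinearMap.BilinForm R P} {C : Type*} [CommRing C] [Algebra R C]

theorem isAlt_sumForm (hB : B.IsAlt) : (sumForm B (-1)).IsAlt := fun x => by
  rw [sumForm_apply, hB]
  ring

theorem isAlt_baseChange {Q : Type*} [AddCommGroup Q] [Module R Q] {B : LinearMap.BilinForm R Q}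
    (hB : B.IsAlt) : (B.baseChange C).IsAlt := by
  intro x
  have h := baseChange_comm (C := C) (B := B) (c := -1)
    (fun x y => by rw [isAlt_swap hB, neg_one_mul])
  induction x using TensorProduct.induction_on with
  | zero => simp
  | tmul a q => rw [LinearMap.BilinForm.baseChange_tmul, hB, zero_smul]
  | add x y hx hy =>
    simp only [map_add, LinearMap.add_apply, hx, hy, h y x]
    simp

/-- Root automorphisms give the parameters `h ⊗ x`. For sums, the central factor of `spTrans_mul` is
removed by a transvection `symTrans` along `(0, 1, 0)` or `(0, 0, 1)`, itself a root automorphism.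
-/
theorem spElementary (hB : B.IsAlt) :
    SpElementary ((sumForm B (-1)).baseChange C) (1 ⊗ₜ (0, 1, 0)) (1 ⊗ₜ (0, 0, 1))
      (LinearMap.range ((LinearMap.inl R P (R × R)).baseChange C)) (rootEnds C (spNilp B)) := by
  have halt : ((sumForm B (-1)).baseChange C).IsAlt := isAlt_baseChange (isAlt_sumForm hB)
  have orth : ∀ r t, ∀ v ∈ LinearMap.range ((LinearMap.inl R P (R × R)).baseChange C),
      (sumForm B (-1)).baseChange C v (1 ⊗ₜ (0, r, t)) = 0 := by
    rintro r t _ ⟨p, rfl⟩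
    have := baseChange_sumForm_splitForm (B := B) (c := -1) p 0 0 0 r t
    rw [splitForm_symm_apply] at this
    simpa using this
  have sym : ∀ u ∈ ({(0, 1, 0), (0, 0, 1)} : Set (P × R × R)), ∀ h : C,
      symTrans ((sumForm B (-1)).baseChange C) (1 ⊗ₜ u) h ∈ rootEnds C (spNilp B) := by
    intro u hu h
    rw [symTrans, ← rankOne_baseChange]
    exact one_add_smul_mem_rootEnds (spNilp_sq hB) ⟨u, hu, Or.inl rfl⟩ h
  have trans : ∀ u ∈ ({(0, 1, 0), (0, 0, 1)} : Set (P × R × R)),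
      ∀ v ∈ LinearMap.range ((LinearMap.inl R P (R × R)).baseChange C),
      spTrans ((sumForm B (-1)).baseChange C) (1 ⊗ₜ u) v ∈ rootEnds C (spNilp B) := by
    rintro u hu _ ⟨p, rfl⟩
    have orth' : ∀ p, (sumForm B (-1)).baseChange C ((LinearMap.inl R P (R × R)).baseChange C p)
        (1 ⊗ₜ u) = 0 := fun p => by
      obtain rfl | rfl := hu <;> exact orth _ _ _ ⟨p, rfl⟩
    induction p using TensorProduct.induction_on with
    | zero =>
      rw [map_zero, spTrans_zero]
      exact Submonoid.one_mem _
    | tmul h x =>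
      have : (LinearMap.inl R P (R × R)).baseChange C (h ⊗ₜ x) = h • (1 ⊗ₜ (x, 0, 0)) := by
        rw [TensorProduct.smul_tmul', smul_eq_mul, mul_one]
        rfl
      rw [this, spTrans_smul, ← rankOne_baseChange, ← rankOne_baseChange, ← LinearMap.baseChange_add]
      exact one_add_smul_mem_rootEnds (spNilp_sq hB) ⟨u, hu, Or.inr ⟨x, rfl⟩⟩ h
    | add x y hx hy =>
      have h1 := spTrans_mul halt (orth' x) (orth' y)
      have h2 := mul_mem (mul_mem hx hy) (sym u hu (-((sumForm B (-1)).baseChange C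
        ((LinearMap.inl R P (R × R)).baseChange C y) ((LinearMap.inl R P (R × R)).baseChange C x))))
      rw [h1, mul_assoc, symTrans_mul halt, add_neg_cancel, symTrans_zero, mul_one] at h2
      rwa [map_add]
  refine ⟨halt, ?_, orth _ _, orth _ _, trans _ (by simp), trans _ (by simp)⟩
  simp [LinearMap.BilinForm.baseChange_tmul, sumForm_apply]

theorem symTrans_mem_rootEnds (hB : B.IsAlt) (h2 : IsUnit (2 : R)) (x y : P)
    (w : C ⊗[R] (P × R × R)) (h : C) :
    symTrans ((sumForm B (-1)).baseChange C) w (h * algebraMap R C (B x y)) ∈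
      rootEnds C (spNilp B) := by
  have := (spElementary (C := C) hB).symTrans_add_mem (by simpa only [map_ofNat] using h2.map (algebraMap R C))
    ⟨(splitForm C P w).1, rfl⟩ ⟨1 ⊗ₜ y, rfl⟩ ⟨1 ⊗ₜ x, rfl⟩ (splitForm C P w).2.1
    (splitForm C P w).2.2 h
  rw [baseChange_sumForm_inl, LinearMap.BilinForm.baseChange_tmul] at this
  convert this using 2
  · have := splitForm_symm_apply C (splitForm C P w).1 (splitForm C P w).2.1 (splitForm C P w).2.2
    simp only [Prod.mk.eta, LinearEquiv.symm_apply_apply] at this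
    conv_lhs => rw [this]
    rw [← add_assoc]
    simp [TensorProduct.smul_tmul']
  · simp [Algebra.algebraMap_eq_smul_one]

theorem extend_symTrans {C' Q : Type*} [AddCommGroup Q] [Module R Q] [CommRing C'] [Algebra R C']
    (B : LinearMap.BilinForm R Q) (f : C →ₐ[R] C') (w : C ⊗[R] Q) (h : C) :
    extend f (symTrans (B.baseChange C) w h) =
      symTrans (B.baseChange C') (scalarMap Q f w) (f h) := by
  rw [symTrans, extend_one_add_smul, extend_rankOne, symTrans]

end SymplecticElementary

/-! ### Denominators and conclusion in the symplectic case. -/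

section SymplecticDenominators

universe u v

variable {R : Type u} [CommRing R] {P : Type v} [AddCommGroup P] [Module R P] {S : Type u}
  [CommRing S] [Algebra R S]

/-- After polarization only the maps `symTrans ω w` have to be lifted. Every vector is isotropic for
an alternating form, so any lift of a multiple `s ^ l • w` will do. -/
theorem hasDenominators_symplectic (h2 : IsUnit (2 : R)) {B : LinearMap.BilinForm R P}
    (hB : B.IsAlt) {s : R} {x y : P} {K : ℕ} (hxy : B x y = s ^ K) {k : ℕ}
    (b : Module.Basis (PairIdx k) S (S ⊗[R] (P × R × R)))
    (hb : IsStdBasis ((sumForm B (-1)).baseChange S) (-1) b) :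
    HasDenominators s b (spRoots k) (spNilp B) := by
  rintro C C' _ _ _ _ _ _ loc hloc γ hγ Y hY
  set ω := (sumForm B (-1)).baseChange C'
  have hω : ω.IsAlt := isAlt_baseChange (isAlt_sumForm hB)
  have hb' : IsStdBasis ω (-1) (extBasis C' b) := by
    simpa using isStdBasis_extBasis (C := C') hb
  obtain ⟨ε, u, v, h⟩ := hb'.conj_spRoot (hb'.isometry_sp hω hγ) hY
  obtain ⟨k₁, e, he⟩ := hloc.1 ε
  have lift : ∀ w : C' ⊗[R] (P × R × R), ∃ l, ∀ M ≥ l, ∀ h : C,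
      ∃ τ ∈ Subgroup.closure (rootAuts (spNilp B) (⊤ : Ideal C)),
        extend loc τ.toLinearMap = symTrans ω w (s ^ M • loc h) := by
    intro w
    obtain ⟨l, w', hw⟩ := exists_scalarMap_eq hloc w
    -- `symTrans` is quadratic in the vector, so the denominator `s ^ l` costs `2 * l`; the summand
    -- `K` is the exponent of `B x y`.
    refine ⟨2 * l + K, fun M hM h => ?_⟩
    obtain ⟨t, rfl⟩ := Nat.exists_eq_add_of_le hM
    obtain ⟨τ, hτ, e⟩ := symTrans_mem_rootEnds hB h2 x y w' (s ^ t • h)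
    refine ⟨τ, hτ, ?_⟩
    rw [e, extend_symTrans, ← hw, ← algebraMap_smul C' (s ^ l), symTrans_smul, hxy]
    congr 1
    simp only [map_mul, AlgHom.commutes, Algebra.smul_def, map_pow]
    ring
  obtain h | ⟨huv, h⟩ := h
  · obtain ⟨l, hl⟩ := lift u
    refine ⟨l + k₁, fun z => ?_⟩
    obtain ⟨τ, hτ, hz⟩ := hl l le_rfl (z * e)
    refine ⟨τ, hτ, ?_⟩
    rw [hz]
    change _ = 1 + _ • Matrix.toLinAlgEquiv (extBasis C' b) _
    rw [h, symTrans, smul_smul, map_mul, ← he, pow_add]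
    congr 2
    simp only [Algebra.smul_def, map_mul]
    ring
  · obtain ⟨l₁, hl₁⟩ := lift (u + v)
    obtain ⟨l₂, hl₂⟩ := lift u
    obtain ⟨l₃, hl₃⟩ := lift v
    set l := l₁ + l₂ + l₃
    refine ⟨l + k₁, fun z => ?_⟩
    obtain ⟨τ₁, hτ₁, hz₁⟩ := hl₁ l (by omega) (z * e)
    obtain ⟨τ₂, hτ₂, hz₂⟩ := hl₂ l (by omega) (-(z * e))
    obtain ⟨τ₃, hτ₃, hz₃⟩ := hl₃ l (by omega) (-(z * e))
    refine ⟨τ₁ * τ₂ * τ₃, mul_mem (mul_mem hτ₁ hτ₂) hτ₃, ?_⟩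
    rw [extend_equiv_mul, extend_equiv_mul, hz₁, hz₂, hz₃]
    change _ = 1 + _ • Matrix.toLinAlgEquiv (extBasis C' b) _
    rw [h, map_neg, smul_neg, ← spTrans_smul_eq_mul hω huv, spTrans_smul, smul_smul, map_mul, ← he,
      pow_add s l]
    congr 2
    simp only [Algebra.smul_def, map_mul]
    ring

/-- `P_s` is free of positive rank, so a frame contains a functional and a vector pairing to a power
of `s`; surjectivity of `P → P^*` represents the functional by a vector of `P`. -/
theorem exists_form_eq_pow [Module.Finite R P] [Module.Projective R P] {B : LinearMap.BilinForm R P}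
    (hB : Function.Surjective fun p : P => (B p : Module.Dual R P)) {s : R} (hs : ¬ IsNilpotent s)
    (hfree : Module.Free (Localization.Away s) (Localization.Away s ⊗[R] P)) {ι : Type*} [Fintype ι]
    (hι : 2 < Fintype.card ι)
    (b : Module.Basis ι (Localization.Away s) (Localization.Away s ⊗[R] (P × R × R))) :
    ∃ (x y : P) (K : ℕ), B x y = s ^ K := by
  classical
  have : Nontrivial (Localization.Away s) := by
    by_contra h
    rw [not_nontrivial_iff_subsingleton] at h
    refine hs ?_
    obtain ⟨⟨_, n, rfl⟩, hn⟩ := (IsLocalization.map_eq_zero_iff (Submonoid.powers s)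
      (Localization.Away s) 1).1 (Subsingleton.elim _ _)
    exact ⟨n, by simpa using hn⟩
  let e := Module.finBasis (Localization.Away s) (Localization.Away s ⊗[R] P)
  have h1 := Module.finrank_eq_card_basis b
  rw [(splitForm (Localization.Away s) P).finrank_eq] at h1
  simp only [Module.finrank_prod, Module.finrank_self] at h1
  obtain ⟨K, p, φ, -, hφ⟩ := exists_frame s e
  have i : Fin (Module.finrank (Localization.Away s) (Localization.Away s ⊗[R] P)) :=
    ⟨0, by omega⟩
  obtain ⟨q, hq⟩ := hB (φ i)
  refine ⟨q, p i, K, ?_⟩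
  rw [show B q = φ i from hq, hφ, if_pos rfl]

theorem dilation_symplectic [Module.Finite R P] [Module.Projective R P] (h2 : IsUnit (2 : R))
    (I : Ideal R) {s : R} (hs : ¬ IsNilpotent s)
    (hfree : Module.Free (Localization.Away s) (Localization.Away s ⊗[R] P)) {m : ℕ} (hm : 0 < m)
    {B : LinearMap.BilinForm R P} (hB : IsSymplectic B)
    (σ : (R[X] ⊗[R] (P × R × R)) ≃ₗ[R[X]] (R[X] ⊗[R] (P × R × R)))
    (h0 : atZero σ.toLinearMap = LinearMap.id)
    (hσ : LocElemSp (m + 1) (sumForm B (-1)) I s σ.toLinearMap) :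
    ∃ l : ℕ, 0 < l ∧ ∀ b ∈ Ideal.span {s ^ l},
      ∃ τ ∈ relETransSp R[X] B (I.map (algebraMap R R[X])),
        atZero τ.toLinearMap = LinearMap.id ∧
        localize s τ.toLinearMap = localize s (scale b σ.toLinearMap) := by
  obtain ⟨b, hb, hσ⟩ := hσ
  obtain ⟨x, y, K, hxy⟩ := exists_form_eq_pow hB.2.2 hs hfree (by simp; omega) b
  exact exists_dilation_of_matrixMem s I b spRoots_sq (spNilp_sq hB.1)
    (hasDenominators_symplectic h2 hB.1 hxy b hb) (symplecticGens (m + 1)) symplecticGens_subset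
    (transSpGens R[X] B) (rootAuts_spNilp_subset R[X]) σ h0 hσ

end SymplecticDenominators

end RelDilation

namespace RelDilation

/-! ### Orthogonal transvections -/

section OrthogonalTransvections

variable {C V : Type*} [CommRing C] [AddCommGroup V] [Module C V]

/-- The orthogonal transvection `z ↦ z + ⟨z, y⟩ x - ⟨z, x⟩ y - t ⟨x, x⟩ ⟨z, y⟩ y`, where `t` stands
for `1 / 2`. -/
def orthTrans (ω : LinearMap.BilinForm C V) (t : C) (y x : V) : Module.End C V :=
  1 + (rankOne ω x y - rankOne ω y x - (t * ω x x) • rankOne ω y y)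

variable {ω : LinearMap.BilinForm C V} {t : C}

theorem orthTrans_apply (y x z : V) : orthTrans ω t y x z =
    z + (ω z y • x - ω z x • y - (t * ω x x) • ω z y • y) := rfl

theorem orthTrans_zero (y : V) : orthTrans ω t y 0 = 1 :=
  LinearMap.ext fun x => by simp [orthTrans_apply]

/-- The correction term with `⟨x, x⟩ / 2` is what makes the parameter additive on the orthogonal
complement of the axis `y`. -/
theorem orthTrans_add (hω : ∀ x y, ω x y = ω y x) (ht : t * 2 = 1) {x x' y : V} (hy : ω y y = 0)
    (h : ω x y = 0) (h' : ω x' y = 0) :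
    orthTrans ω t y (x + x') = orthTrans ω t y x * orthTrans ω t y x' := by
  refine LinearMap.ext fun z => ?_
  have hh : ω y x = 0 := by rw [hω, h]
  have hh' : ω y x' = 0 := by rw [hω, h']
  simp only [Module.End.mul_apply, orthTrans_apply, map_add, map_sub, map_smul, LinearMap.add_apply,
    hy, h', hh, hω x' x]
  match_scalars <;> first | ring1 | linear_combination (-(ω z y * ω x x')) * ht

/-- For two isotropic vectors the correction terms vanish and axis and parameter play symmetric
roles up to sign. Hence memberships in `transSub` can be reversed. -/
theorem orthTrans_smul_swap {x y : V} (hx : ω x x = 0) (hy : ω y y = 0) (h : C) :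
    orthTrans ω t y (h • x) = orthTrans ω t x (-h • y) := by
  refine LinearMap.ext fun z => ?_
  simp only [orthTrans_apply, map_smul, LinearMap.smul_apply, smul_eq_mul, hx, hy]
  module

theorem isometry_orthTrans (hω : ∀ x y, ω x y = ω y x) (ht : t * 2 = 1) {x y : V} (hy : ω y y = 0)
    (h : ω x y = 0) (z z' : V) : ω (orthTrans ω t y x z) (orthTrans ω t y x z') = ω z z' := by
  have hh : ω y x = 0 := by rw [hω, h]
  simp only [orthTrans_apply, map_add, map_sub, map_smul, LinearMap.add_apply,
    LinearMap.sub_apply, LinearMap.smul_apply, smul_eq_mul, hy, h, hh, hω x z', hω y z']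
  linear_combination (-(ω x x * ω z y * ω z' y)) * ht

theorem orthTrans_conj {g g' : Module.End C V} (hg : g * g' = 1) (hiso : ∀ z z', ω (g z) (g z') = ω z z')
    (y x : V) : orthTrans ω t (g y) (g x) = g * orthTrans ω t y x * g' := by
  refine LinearMap.ext fun z => ?_
  have hz : z = g (g' z) := by rw [← Module.End.mul_apply, hg, Module.End.one_apply]
  conv_lhs => rw [hz]
  simp only [Module.End.mul_apply, orthTrans_apply, map_add, map_sub, map_smul, hiso]

/-- For isotropic `w`, the submodule of all `x` orthogonal to `w` such that all transvections
with parameters `w` and `h x` belong to a given monoid. -/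
def transSub (hω : ∀ x y, ω x y = ω y x) (ht : t * 2 = 1) (M : Submonoid (Module.End C V)) {w : V}
    (hw : ω w w = 0) : Submodule C V where
  carrier := {x | ω x w = 0 ∧ ∀ h : C, orthTrans ω t w (h • x) ∈ M}
  add_mem' := by
    rintro x x' ⟨h1, h2⟩ ⟨h1', h2'⟩
    refine ⟨by simp [h1, h1'], fun h => ?_⟩
    rw [smul_add, orthTrans_add hω ht hw (by simp [h1]) (by simp [h1'])]
    exact mul_mem (h2 h) (h2' h)
  zero_mem' := ⟨by simp, fun h => by
    rw [smul_zero, orthTrans_zero]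
    exact M.one_mem⟩
  smul_mem' := by
    rintro c x ⟨h1, h2⟩
    refine ⟨by simp [h1], fun h => ?_⟩
    rw [smul_smul]
    exact h2 _

variable {hω : ∀ x y, ω x y = ω y x} {ht : t * 2 = 1} {M : Submonoid (Module.End C V)}

theorem transSub_swap {x y : V} (hx : ω x x = 0) (hy : ω y y = 0) {c : C} (hxy : ω x y = 0)
    (h : c • x ∈ transSub hω ht M hy) : c • y ∈ transSub hω ht M hx := by
  refine ⟨by rw [map_smul, LinearMap.smul_apply, hω, hxy, smul_zero], fun d => ?_⟩
  rw [smul_smul, orthTrans_smul_swap hy hx, neg_mul_eq_neg_mul, mul_smul]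
  exact h.2 _

theorem transSub_swap_one {x y : V} (hx : ω x x = 0) (hy : ω y y = 0)
    (h : x ∈ transSub hω ht M hy) : y ∈ transSub hω ht M hx := by
  rw [← one_smul C y]
  exact transSub_swap hx hy h.1 (by rwa [one_smul])

theorem self_mem_transSub {w : V} (hw : ω w w = 0) : w ∈ transSub hω ht M hw := by
  refine ⟨hw, fun h => ?_⟩
  convert M.one_mem
  refine LinearMap.ext fun z => ?_
  simp only [orthTrans_apply, map_smul, LinearMap.smul_apply, smul_eq_mul, hw, Module.End.one_apply]
  module

/-- The commutator of the transvections with axes `z'` and `y` and parameters `c x` and `z`, where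
the pair `z, z'` is orthogonal to both `x` and `y`; the pairing `⟨z, z'⟩` becomes the factor `μ`. -/
theorem smul_mem_transSub_of_commutator {x y z z' : V} {μ : C} (hx : ω x x = 0) (hy : ω y y = 0)
    (hz : ω z z = 0) (hz' : ω z' z' = 0) (hzz : ω z z' = μ) (hyx : ω y x = 0) (hyz' : ω y z' = 0)
    (hxz : ω x z = 0) (h : z ∈ transSub hω ht M hy) (h' : x ∈ transSub hω ht M hz') :
    μ • x ∈ transSub hω ht M hy := by
  have hxy : ω x y = 0 := by rw [hω, hyx]
  have hz'y : ω z' y = 0 := by rw [hω, hyz']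
  have hzx : ω z x = 0 := by rw [hω, hxz]
  have hzy := h.1
  have hxz' := h'.1
  have hyz : ω y z = 0 := by rw [hω, hzy]
  have hz'x : ω z' x = 0 := by rw [hω, hxz']
  have hz'z : ω z' z = μ := by rw [hω, hzz]
  refine ⟨by simp [hxy], fun c => ?_⟩
  have key : orthTrans ω t y (c • μ • x) = orthTrans ω t z' (c • x) * orthTrans ω t y ((1 : C) • z) *
      orthTrans ω t z' (-c • x) * orthTrans ω t y ((-1 : C) • z) := by
    refine LinearMap.ext fun v => ?_
    simp only [Module.End.mul_apply, orthTrans_apply, map_add, map_sub, map_smul, 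
      LinearMap.smul_apply, 
      smul_eq_mul, hx, hy, hz, hz', hzz, hyx, hyz', hxz, hxy, hz'y, hzx, hzy, hxz', hyz, hz'x, hz'z]
    module
  rw [key]
  exact mul_mem (mul_mem (mul_mem (h'.2 _) (h.2 _)) (h'.2 _)) (h.2 _)

/-- The vector `⟨w, u⟩ v - ⟨w, v⟩ u`, as a linear function of `v`. -/
def koszul (ω : LinearMap.BilinForm C V) (w u : V) : V →ₗ[C] V :=
  ω w u • LinearMap.id - (ω w).smulRight u

theorem koszul_apply (w u v : V) : koszul ω w u v = ω w u • v - ω w v • u := rfl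

theorem koszul_swap (w u v : V) : koszul ω w u v = -koszul ω w v u := by
  rw [koszul_apply, koszul_apply, neg_sub]

theorem koszul_conj {g : Module.End C V} (hiso : ∀ z z', ω (g z) (g z') = ω z z') (w u v : V) :
    koszul ω (g w) (g u) (g v) = g (koszul ω w u v) := by
  simp only [koszul_apply, hiso, map_sub, map_smul]

/-- Conjugation by an isometry moves axis and parameter together. As `H` is available for every
isotropic `w`, conjugating by `g ∈ M` merely permutes the axes and replaces `u, v` by their images.
-/
theorem koszul_conj_mem {g g' : Module.End C V} (hg : g ∈ M) (hg' : g' ∈ M) (h : g * g' = 1)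
    (hiso : ∀ z z', ω (g z) (g z') = ω z z') {c : C} {u v : V}
    (H : ∀ w (hw : ω w w = 0), c • koszul ω w u v ∈ transSub hω ht M hw) (w : V) (hw : ω w w = 0) :
    c • koszul ω w (g u) (g v) ∈ transSub hω ht M hw := by
  obtain ⟨w', rfl⟩ : ∃ w', g w' = w := ⟨g' w, by
    rw [← Module.End.mul_apply, h, Module.End.one_apply]⟩
  have hw' : ω w' w' = 0 := by rw [← hiso, hw]
  obtain ⟨h1, h2⟩ := H w' hw'
  rw [koszul_conj hiso, ← map_smul]
  refine ⟨by rw [hiso, h1], fun d => ?_⟩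
  rw [← map_smul, orthTrans_conj h hiso]
  exact mul_mem (mul_mem hg (h2 d)) hg'

end OrthogonalTransvections

end RelDilation

namespace RelDilation

/-! ### Koszul vectors as elementary parameters over a hyperbolic frame. -/

section OrthElementary

variable {C V : Type*} [CommRing C] [AddCommGroup V] [Module C V]
  {ω : LinearMap.BilinForm C V} {t : C} (hω : ∀ x y, ω x y = ω y x) (ht : t * 2 = 1)

/-- A hyperbolic pair `e, f` and, in its orthogonal complement, a family `p` of isotropic vectors
that is hyperbolic and spans the complement up to the factor `μ`, together with a monoid containing
the elementary orthogonal transvections with parameters in the family. -/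
structure OrthElementary {ι : Type*} [Fintype ι] (e f : V) (p : ι → V) (τ : ι → ι) (μ : C)
    (M : Submonoid (Module.End C V)) : Prop where
  inv : ∀ i, τ (τ i) = i
  ne : ∀ i, τ i ≠ i
  exists_ne : ∀ i, ∃ j, j ≠ i ∧ j ≠ τ i
  e_e : ω e e = 0
  f_f : ω f f = 0
  e_f : ω e f = 1
  p_e : ∀ i, ω (p i) e = 0
  p_f : ∀ i, ω (p i) f = 0
  p_swap : ∀ i, ω (p i) (p (τ i)) = μ
  p_p : ∀ i j, j ≠ τ i → ω (p i) (p j) = 0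
  frame : ∀ x, μ • x = (μ * ω x f) • e + (μ * ω x e) • f + ∑ i, ω x (p (τ i)) • p i
  mem_e : ∀ i, p i ∈ transSub hω ht M e_e
  mem_f : ∀ i, p i ∈ transSub hω ht M f_f

namespace OrthElementary

variable {hω ht} {ι : Type*} [Fintype ι] {e f : V} {p : ι → V} {τ : ι → ι} {μ : C}
  {M : Submonoid (Module.End C V)}

theorem symm (H : OrthElementary hω ht e f p τ μ M) : OrthElementary hω ht f e p τ μ M where
  inv := H.inv
  ne := H.ne
  exists_ne := H.exists_ne
  e_e := H.f_f
  f_f := H.e_e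
  e_f := by rw [hω, H.e_f]
  p_e := H.p_f
  p_f := H.p_e
  p_swap := H.p_swap
  p_p := H.p_p
  frame x := by rw [H.frame, add_comm ((μ * ω x f) • e)]
  mem_e := H.mem_f
  mem_f := H.mem_e

theorem iso (H : OrthElementary hω ht e f p τ μ M) (i : ι) : ω (p i) (p i) = 0 :=
  H.p_p i i (H.ne i).symm

theorem e_mem (H : OrthElementary hω ht e f p τ μ M) (i : ι) :
    e ∈ transSub hω ht M (H.iso i) :=
  transSub_swap_one (H.iso i) H.e_e (H.mem_e i)

theorem p_mem (H : OrthElementary hω ht e f p τ μ M) {i j : ι} (hij : j ≠ τ i) :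
    p j ∈ transSub hω ht M (H.iso i) := by
  rw [← one_smul C (p j)]
  exact smul_mem_transSub_of_commutator (H.iso j) (H.iso i) H.e_e H.f_f H.e_f (H.p_p i j hij)
    (H.p_f i) (H.p_e j) (H.e_mem i) (H.mem_f j)

theorem koszul_e_p_mem (H : OrthElementary hω ht e f p τ μ M) (i : ι) (w : V) (hw : ω w w = 0) :
    (μ * μ) • koszul ω w e (p i) ∈ transSub hω ht M hw := by
  classical
  set y := koszul ω w e (p i) with hydef
  have hye : ∀ v, ω v y = ω w e * ω v (p i) - ω w (p i) * ω v e := fun v => by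
    rw [hydef, koszul_apply, map_sub, map_smul, map_smul, smul_eq_mul, smul_eq_mul]
  have hyv : ∀ v, ω y v = ω w e * ω v (p i) - ω w (p i) * ω v e := fun v => by rw [hω, hye]
  have ep : ω e (p i) = 0 := by rw [hω, H.p_e]
  have fp : ω f (p i) = 0 := by rw [hω, H.p_f]
  have fe : ω f e = 1 := by rw [hω, H.e_f]
  have hy : ω y y = 0 := by rw [hyv, hω y, hω y, hye, hye, H.iso, H.p_e, ep, H.e_e]; ring
  have hwy : ω w y = 0 := by rw [hye]; ring
  -- Both `w` and `y` are isotropic, so `y` may serve as the axis. The parameter `w` can then be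
  -- expanded in the frame, at the cost of one `μ`.
  refine transSub_swap hw hy hwy ?_
  have h1 : e ∈ transSub hω ht M hy := by
    refine transSub_swap_one hy H.e_e ?_
    exact sub_mem (Submodule.smul_mem _ _ (H.mem_e i))
      (Submodule.smul_mem _ _ (self_mem_transSub H.e_e))
  have h2 : ∀ j, j ≠ τ i → p j ∈ transSub hω ht M hy := by
    intro j hj
    refine transSub_swap_one hy (H.iso j) ?_
    refine sub_mem (Submodule.smul_mem _ _ (H.p_mem ?_)) (Submodule.smul_mem _ _ (H.e_mem j))
    rintro rfl
    exact hj (H.inv j).symm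
  -- The vectors `f` and `p (τ i)` need not be orthogonal to `y` individually, but this combination
  -- is. It is reached by a commutator with an auxiliary pair `p j, p (τ j)`, which costs the second
  -- `μ`.
  have h3 : μ • ((μ * ω w e) • f + ω w (p i) • p (τ i)) ∈ transSub hω ht M hy := by
    obtain ⟨j, hj, hj'⟩ := H.exists_ne i
    have hτ : τ i ≠ τ j := fun h => hj (by rw [← H.inv j, ← h, H.inv])
    have hτ' : τ i ≠ j := hj'.symm
    refine smul_mem_transSub_of_commutator (z := p j) (z' := p (τ j)) ?_ hy (H.iso _) (H.iso _)
      (H.p_swap j) ?_ ?_ ?_ (h2 j hj') ?_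
    · have h4 : ω (p (τ i)) f = 0 := H.p_f _
      have h5 : ω f (p (τ i)) = 0 := by rw [hω, h4]
      simp only [map_add, map_smul, LinearMap.add_apply, LinearMap.smul_apply, H.iso, H.f_f, h4, h5]
      simp
    · have h4 : ω (p (τ i)) (p i) = μ := by rw [hω, H.p_swap]
      rw [hyv]
      simp only [map_add, map_smul, LinearMap.add_apply, LinearMap.smul_apply, H.p_e, fe, fp,
        smul_eq_mul]
      rw [h4]
      ring
    · rw [hyv, H.p_p _ _ (by rw [H.inv]; exact hj.symm), H.p_e]
      ring
    · simp only [map_add, map_smul, LinearMap.add_apply, LinearMap.smul_apply]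
      rw [hω f, H.p_f, H.p_p _ _ (by rw [H.inv]; exact hj)]
      simp
    · refine add_mem (Submodule.smul_mem _ _ (H.symm.e_mem _)) (Submodule.smul_mem _ _ (H.p_mem ?_))
      rw [H.inv]
      exact hτ'
  rw [mul_smul, H.frame w, ← Finset.add_sum_erase _ _ (Finset.mem_univ (τ i)), H.inv]
  have h4 : (μ * ω w f) • e + (μ * ω w e) • f + (ω w (p i) • p (τ i) +
      ∑ j ∈ Finset.univ.erase (τ i), ω w (p (τ j)) • p j) = (μ * ω w f) • e +
      ∑ j ∈ Finset.univ.erase (τ i), ω w (p (τ j)) • p j +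
      ((μ * ω w e) • f + ω w (p i) • p (τ i)) := by abel
  rw [h4, smul_add]
  refine add_mem (Submodule.smul_mem _ _ (add_mem (Submodule.smul_mem _ _ h1)
    (Submodule.sum_mem _ fun j hj => Submodule.smul_mem _ _ (h2 j (Finset.ne_of_mem_erase hj))))) h3

/-- The transvection with axis `f` and parameter `p j` sends `e` to `e + p j` and `p i` to `p i - ⟨p
i, p j⟩ f`. Transporting the Koszul vector of `e, p i` by it and removing the known terms leaves
this one. -/
theorem koszul_p_p_sub_mem (H : OrthElementary hω ht e f p τ μ M) (i j : ι) (w : V)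
    (hw : ω w w = 0) : (μ * μ) • (koszul ω w (p j) (p i) - ω (p i) (p j) • koszul ω w e f) ∈
      transSub hω ht M hw := by
  have hf : ω (p j) f = 0 := H.p_f j
  have hm : ∀ c : C, orthTrans ω t f (c • p j) ∈ M := (H.mem_f j).2
  have hg : orthTrans ω t f ((1 : C) • p j) * orthTrans ω t f ((-1 : C) • p j) = 1 := by
    rw [← orthTrans_add hω ht H.f_f (by simp [hf]) (by simp [hf]), ← add_smul, add_neg_cancel,
      zero_smul, orthTrans_zero]
  have key := koszul_conj_mem (hm 1) (hm (-1)) hg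
    (isometry_orthTrans hω ht H.f_f (by simp [hf])) (H.koszul_e_p_mem i) w hw
  have h1 : orthTrans ω t f ((1 : C) • p j) e = e + p j := by
    simp [orthTrans_apply, H.e_f, H.iso, hω e (p j), H.p_e]
  have h2 : orthTrans ω t f ((1 : C) • p j) (p i) = p i - ω (p i) (p j) • f := by
    simp [orthTrans_apply, H.p_f, sub_eq_add_neg]
  rw [h1, h2] at key
  have h3 := H.koszul_e_p_mem i w hw
  have h4 := H.symm.koszul_e_p_mem j w hw
  have h5 : (μ * μ) • (koszul ω w (p j) (p i) - ω (p i) (p j) • koszul ω w e f) =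
      (μ * μ) • koszul ω w (e + p j) (p i - ω (p i) (p j) • f) - (μ * μ) • koszul ω w e (p i) -
        ω (p i) (p j) • ((μ * μ) • koszul ω w f (p j)) := by
    simp only [koszul_apply, map_add, map_sub, map_smul]
    module
  rw [h5]
  exact sub_mem (sub_mem key h3) (Submodule.smul_mem _ _ h4)

/-- Adding the preceding result for `(i, τ i)` and for `(τ i, i)` cancels the antisymmetric Koszul
vectors and leaves `-2 μ` times the one of `e, f`; `t` stands for `1 / 2`. -/
theorem koszul_e_f_mem (H : OrthElementary hω ht e f p τ μ M) (i : ι) (w : V)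
    (hw : ω w w = 0) : (μ * μ * μ) • koszul ω w e f ∈ transSub hω ht M hw := by
  have h1 := H.koszul_p_p_sub_mem i (τ i) w hw
  have h2 := H.koszul_p_p_sub_mem (τ i) i w hw
  have h3 : (μ * μ * μ) • koszul ω w e f = (-t) •
      ((μ * μ) • (koszul ω w (p (τ i)) (p i) - ω (p i) (p (τ i)) • koszul ω w e f) +
      (μ * μ) • (koszul ω w (p i) (p (τ i)) - ω (p (τ i)) (p i) • koszul ω w e f)) := by
    rw [koszul_swap w (p i), hω (p (τ i)) (p i), H.p_swap]
    match_scalars <;> first | ring1 | linear_combination (-(μ * μ * μ)) * ht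
  rw [h3]
  exact Submodule.smul_mem _ _ (add_mem h1 h2)

theorem koszul_p_p_mem (H : OrthElementary hω ht e f p τ μ M) (i j : ι) (w : V)
    (hw : ω w w = 0) : (μ * μ * μ) • koszul ω w (p j) (p i) ∈ transSub hω ht M hw := by
  have h1 := H.koszul_p_p_sub_mem i j w hw
  have h2 := H.koszul_e_f_mem i w hw
  have h3 : (μ * μ * μ) • koszul ω w (p j) (p i) =
      μ • ((μ * μ) • (koszul ω w (p j) (p i) - ω (p i) (p j) • koszul ω w e f)) +
        ω (p i) (p j) • ((μ * μ * μ) • koszul ω w e f) := by module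
  rw [h3]
  exact add_mem (Submodule.smul_mem _ _ h1) (Submodule.smul_mem _ _ h2)

theorem smul_mem_of_frame (H : OrthElementary hω ht e f p τ μ M) {N : Submodule C V} (he : e ∈ N)
    (hf : f ∈ N) (hp : ∀ i, p i ∈ N) (x : V) : μ • x ∈ N := by
  rw [H.frame]
  exact add_mem (add_mem (N.smul_mem _ he) (N.smul_mem _ hf))
    (N.sum_mem fun i _ => N.smul_mem _ (hp i))

/-- Koszul vectors are bilinear and antisymmetric in `u, v`. On frame vectors the factor `μ ^ 3`
suffices; expanding `u` and `v` in the frame costs one more `μ` each. -/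
theorem koszul_mem [Nonempty ι] (H : OrthElementary hω ht e f p τ μ M) (u v w : V)
    (hw : ω w w = 0) : (μ ^ 5) • koszul ω w u v ∈ transSub hω ht M hw := by
  have swap : ∀ {a b}, (μ * μ * μ) • koszul ω w a b ∈ transSub hω ht M hw →
      (μ * μ * μ) • koszul ω w b a ∈ transSub hω ht M hw := fun {a b} h => by
    rw [koszul_swap, smul_neg]
    exact neg_mem h
  have self : ∀ a, (μ * μ * μ) • koszul ω w a a ∈ transSub hω ht M hw := fun a => by
    rw [koszul_apply, sub_self, smul_zero]
    exact zero_mem _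
  have hep : ∀ i, (μ * μ * μ) • koszul ω w e (p i) ∈ transSub hω ht M hw := fun i => by
    rw [mul_comm, mul_smul]
    exact Submodule.smul_mem _ _ (H.koszul_e_p_mem i w hw)
  have hfp : ∀ i, (μ * μ * μ) • koszul ω w f (p i) ∈ transSub hω ht M hw := fun i => by
    rw [mul_comm, mul_smul]
    exact Submodule.smul_mem _ _ (H.symm.koszul_e_p_mem i w hw)
  have hef := H.koszul_e_f_mem (Classical.arbitrary ι) w hw
  have right : ∀ a, (μ * μ * μ) • koszul ω w a e ∈ transSub hω ht M hw →
      (μ * μ * μ) • koszul ω w a f ∈ transSub hω ht M hw →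
      (∀ i, (μ * μ * μ) • koszul ω w a (p i) ∈ transSub hω ht M hw) →
      (μ * μ * μ) • koszul ω w a (μ • v) ∈ transSub hω ht M hw := fun a h1 h2 h3 =>
    H.smul_mem_of_frame (N := (transSub hω ht M hw).comap ((μ * μ * μ) • koszul ω w a)) h1 h2 h3 v
  have left : (μ * μ * μ) • koszul ω w (μ • v) (μ • u) ∈ transSub hω ht M hw :=
    H.smul_mem_of_frame (N := (transSub hω ht M hw).comap ((μ * μ * μ) • koszul ω w (μ • v)))
      (swap (right e (self e) hef hep)) (swap (right f (swap hef) (self f) hfp))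
      (fun i => swap (right (p i) (swap (hep i)) (swap (hfp i))
        fun j => H.koszul_p_p_mem j i w hw)) u
  have h3 : (μ ^ 5) • koszul ω w u v = (μ * μ * μ) • koszul ω w (μ • u) (μ • v) := by
    simp only [koszul_apply, map_smul, smul_eq_mul]
    module
  rw [h3]
  exact swap left

end OrthElementary
end OrthElementary

end RelDilation

namespace RelDilation

/-! ### The orthogonal case -/

section OrthogonalRoots

variable {R : Type*} [CommRing R] {P : Type*} [AddCommGroup P] [Module R P]
  (B : LinearMap.BilinForm R P)

/-- The nilpotent endomorphisms of `P ⊥ R²` giving the elementary orthogonal transvections. -/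
def oNilp : Set (Module.End R (P × R × R)) :=
  {N | ∃ u ∈ ({(0, 1, 0), (0, 0, 1)} : Set (P × R × R)), ∃ x : P, B x x = 0 ∧
    N = rankOne (sumForm B 1) (x, 0, 0) u - rankOne (sumForm B 1) u (x, 0, 0)}

variable {B}

theorem oNilp_sq : ∀ N ∈ oNilp B, N * N = 0 := by
  rintro _ ⟨_, rfl | rfl, x, hx, rfl⟩ <;>
    refine LinearMap.ext fun y => ?_ <;>
    simp [sumForm_apply, hx]

theorem rootAuts_oNilp_subset (A : Type*) [CommRing A] [Algebra R A] (J : Ideal A) :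
    rootAuts (oNilp B) J ⊆ transOGens A B J := by
  have key : ∀ (g : (A ⊗[R] (P × R × R)) ≃ₗ[A] (A ⊗[R] (P × R × R)))
      (N : Module.End A (A ⊗[R] (P × R × R))), g.toLinearMap = 1 + N → ∀ x, g x = x + N x :=
    fun g N e x => DFunLike.congr_fun e x
  have hsub : ∀ u v : Module.End R (P × R × R),
      (u - v).baseChange A = u.baseChange A - v.baseChange A := fun u v =>
    LinearMap.baseChange_sub u v
  rintro g ⟨_, ⟨_, rfl | rfl, x, hx, rfl⟩, h, hh, e⟩
  · refine Or.inr ⟨h • (1 ⊗ₜ x), Submodule.smul_mem_smul hh Submodule.mem_top,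
      by simp [LinearMap.BilinForm.baseChange_tmul, hx], fun p a b => ?_⟩
    rw [key _ _ e, hsub, rankOne_baseChange, rankOne_baseChange,
      LinearMap.smul_apply, LinearMap.sub_apply, rankOne_apply, rankOne_apply,
      baseChange_sumForm_splitForm, baseChange_sumForm_splitForm, one_tmul_eq_splitForm,
      one_tmul_eq_splitForm, ← map_smul, ← map_smul, ← map_sub, ← map_smul, ← map_add]
    simp [smul_smul, mul_comm, sub_eq_add_neg]
  · refine Or.inl ⟨h • (1 ⊗ₜ x), Submodule.smul_mem_smul hh Submodule.mem_top,
      by simp [LinearMap.BilinForm.baseChange_tmul, hx], fun p a b => ?_⟩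
    rw [key _ _ e, hsub, rankOne_baseChange, rankOne_baseChange,
      LinearMap.smul_apply, LinearMap.sub_apply, rankOne_apply, rankOne_apply,
      baseChange_sumForm_splitForm, baseChange_sumForm_splitForm, one_tmul_eq_splitForm,
      one_tmul_eq_splitForm, ← map_smul, ← map_smul, ← map_sub, ← map_smul, ← map_add]
    simp [smul_smul, mul_comm, sub_eq_add_neg]

/-- The integer matrices of the root elements of the orthogonal group. -/
def oRoots (k : ℕ) : Set (Matrix (PairIdx k) (PairIdx k) ℤ) :=
  {Y | ∃ i j : PairIdx k, i ≠ j ∧ i ≠ swapIdx j ∧ Y = Matrix.single i j 1 -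
      Matrix.single (swapIdx j) (swapIdx i) 1}

theorem oRoots_sq {k : ℕ} : ∀ Y ∈ oRoots k, Y * Y = 0 := by
  rintro _ ⟨i, j, h1, h2, rfl⟩
  rw [sub_mul, mul_sub, mul_sub, Matrix.single_mul_single_of_ne _ _ _ _ h1.symm,
    Matrix.single_mul_single_of_ne _ _ _ _ (swapIdx_ne j).symm,
    Matrix.single_mul_single_of_ne _ _ _ _ (swapIdx_ne i),
    Matrix.single_mul_single_of_ne _ _ _ _ (fun h => h1 (swapIdx_inj.1 h))]
  simp

theorem map_oRoot {A : Type*} [CommRing A] {k : ℕ} (i j : PairIdx k) :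
    (Matrix.single i j (1 : ℤ) - Matrix.single (swapIdx j) (swapIdx i) 1).map
      (Int.castRingHom A) = Matrix.single i j (1 : A) -
        Matrix.single (swapIdx j) (swapIdx i) 1 := by
  ext u v
  simp [Matrix.single_apply]

theorem orthogonalGens_subset {A : Type*} [CommRing A] {k : ℕ} (J : Ideal A) :
    orthogonalGens k J ⊆ rootMatrices (oRoots k) J := by
  rintro g ⟨i, j, h1, h2, z, hz, e⟩
  refine ⟨_, ⟨i, j, h1, h2, rfl⟩, z, hz, ?_⟩
  rw [e, map_oRoot, smul_sub, Matrix.smul_single, Matrix.smul_single, add_sub_assoc, smul_eq_mul,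
    mul_one]

section Conj

variable {C V : Type*} [CommRing C] [AddCommGroup V] [Module C V] {ω : LinearMap.BilinForm C V}
  {k : ℕ} {b : Module.Basis (PairIdx k) C V}

theorem IsStdBasis.conj_oRoot (hb : IsStdBasis ω 1 b) {γ : GL (PairIdx k) C}
    (hγ : ∀ x y, ω (Matrix.toLinAlgEquiv b (γ : Matrix _ _ C) x)
      (Matrix.toLinAlgEquiv b (γ : Matrix _ _ C) y) = ω x y) {Y : Matrix (PairIdx k) (PairIdx k) ℤ}
    (hY : Y ∈ oRoots k) :
    ∃ u v v' : V, ω u u = 0 ∧ ω v v = 0 ∧ ω u v = 0 ∧ ω v v' = 1 ∧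
      Matrix.toLinAlgEquiv b ((γ : Matrix _ _ C) *
        Y.map (Int.castRingHom C) * ((γ⁻¹ : GL (PairIdx k) C) : Matrix _ _ C)) =
          rankOne ω u v - rankOne ω v u := by
  obtain ⟨i, j, h1, h2, rfl⟩ := hY
  have hs : ∀ i, stdSign (1 : C) (i : PairIdx k) = 1 := fun i => by simp [stdSign]
  refine ⟨Matrix.toLinAlgEquiv b (γ : Matrix _ _ C) (b i),
    Matrix.toLinAlgEquiv b (γ : Matrix _ _ C) (b (swapIdx j)),
    Matrix.toLinAlgEquiv b (γ : Matrix _ _ C) (b j), ?_, ?_, ?_, ?_, ?_⟩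
  · rw [hγ, hb.apply_self]
  · rw [hγ, hb.apply_self]
  · rw [hγ, hb, stdForm, if_neg]
    rw [swapIdx_inj]
    exact h1.symm
  · rw [hγ, hb, stdForm, swapIdx_swapIdx]
    simp
  · rw [map_oRoot, mul_sub, sub_mul, map_sub, hb.conj_single (by ring) hγ,
      hb.conj_single (by ring) hγ, swapIdx_swapIdx, hs, hs, one_smul, one_smul]

theorem IsStdBasis.isometry_o (hω : ∀ x y, ω x y = ω y x) (hb : IsStdBasis ω 1 b)
    {γ : GL (PairIdx k) C}
    (hγ : γ ∈ Subgroup.closure (rootMatrices (oRoots k) (⊤ : Ideal C))) (x y : V) :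
    ω (Matrix.toLinAlgEquiv b (γ : Matrix _ _ C) x)
      (Matrix.toLinAlgEquiv b (γ : Matrix _ _ C) y) = ω x y := by
  refine isometry_of_mem_closure b oRoots_sq (fun Y hY x y => ?_) hγ x y
  obtain ⟨u, v, -, -, -, -, -, h⟩ := hb.conj_oRoot (γ := 1) (by simp) hY
  simp only [Units.val_one, one_mul, inv_one, mul_one] at h
  rw [h]
  simp only [LinearMap.sub_apply, LinearMap.smul_apply, rankOne_apply, map_smul, map_sub,
    smul_eq_mul, hω u y, hω v y]
  ring

end Conj

variable {C : Type*} [CommRing C] [Algebra R C]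

theorem sumForm_one_comm (hB : B.IsSymm) (x y : C ⊗[R] (P × R × R)) :
    (sumForm B 1).baseChange C x y = (sumForm B 1).baseChange C y x := by
  have := baseChange_comm (C := C) (sumForm_comm (c := (1 : R)) (by ring)
    (fun x y => by rw [one_mul, hB.eq])) x y
  rwa [map_one, one_mul] at this

theorem orthTrans_smul_of_isotropic {V : Type*} [AddCommGroup V] [Module C V]
    {ω : LinearMap.BilinForm C V} {t : C} {x : V} (hx : ω x x = 0) (y : V) (h : C) :
    orthTrans ω t y (h • x) = 1 + h • (rankOne ω x y - rankOne ω y x) := by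
  refine LinearMap.ext fun z => ?_
  simp only [orthTrans_apply, map_smul, LinearMap.smul_apply, smul_eq_mul, hx, LinearMap.add_apply,
    LinearMap.sub_apply, rankOne_apply, Module.End.one_apply]
  module

theorem orthElementary (hB : B.IsSymm) {t : C} (ht : t * 2 = 1) {ι : Type*} [Fintype ι] {p : ι → P}
    {τ : ι → ι} {μ : R} (hτ : ∀ i, τ (τ i) = i) (hτ' : ∀ i, τ i ≠ i)
    (hι : ∀ i, ∃ j, j ≠ i ∧ j ≠ τ i) (hp : ∀ i, B (p i) (p (τ i)) = μ)
    (hp' : ∀ i j, j ≠ τ i → B (p i) (p j) = 0)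
    (hframe : ∀ x, μ • x = ∑ i, B x (p (τ i)) • p i) :
    OrthElementary (sumForm_one_comm (C := C) hB) ht (1 ⊗ₜ (0, 1, 0)) (1 ⊗ₜ (0, 0, 1))
      (fun i => 1 ⊗ₜ (p i, 0, 0)) τ (algebraMap R C μ) (rootEnds C (oNilp B)) where
  inv := hτ
  ne := hτ'
  exists_ne := hι
  e_e := by simp [LinearMap.BilinForm.baseChange_tmul, sumForm_apply]
  f_f := by simp [LinearMap.BilinForm.baseChange_tmul, sumForm_apply]
  e_f := by simp [LinearMap.BilinForm.baseChange_tmul, sumForm_apply]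
  p_e i := by simp [LinearMap.BilinForm.baseChange_tmul, sumForm_apply]
  p_f i := by simp [LinearMap.BilinForm.baseChange_tmul, sumForm_apply]
  p_swap i := by simp [LinearMap.BilinForm.baseChange_tmul, sumForm_apply, hp,
    Algebra.algebraMap_eq_smul_one]
  p_p i j h := by simp [LinearMap.BilinForm.baseChange_tmul, sumForm_apply, hp' i j h]
  frame x := by
    have h : (μ • LinearMap.id : Module.End R (P × R × R)) =
        μ • rankOne (sumForm B 1) (0, 1, 0) (0, 0, 1) +
          μ • rankOne (sumForm B 1) (0, 0, 1) (0, 1, 0) +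
            ∑ i, rankOne (sumForm B 1) (p i, 0, 0) (p (τ i), 0, 0) := by
      refine LinearMap.ext fun ⟨x, a, b⟩ => ?_
      simp only [LinearMap.smul_apply, LinearMap.add_apply, LinearMap.sum_apply, rankOne_apply,
        LinearMap.id_apply, sumForm_apply]
      ext
      · simp [hframe, Prod.fst_sum]
      · simp [Prod.snd_sum]
      · simp [Prod.snd_sum]
    have hsum : ∀ φ : ι → Module.End R (P × R × R), (∑ i, φ i).baseChange C =
        ∑ i, (φ i).baseChange C := fun φ =>
      map_sum (LinearMap.baseChangeHom R C (P × R × R) (P × R × R)) φ Finset.univ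
    have h' := congrArg (fun φ => LinearMap.baseChange C φ x) h
    simp only [LinearMap.baseChange_add, LinearMap.baseChange_smul, hsum,
      rankOne_baseChange, LinearMap.smul_apply, LinearMap.add_apply, LinearMap.sum_apply,
      LinearMap.baseChange_id, LinearMap.id_apply, rankOne_apply] at h'
    rw [algebraMap_smul, h', mul_smul, mul_smul, algebraMap_smul, algebraMap_smul]
  mem_e i := by
    have h : (sumForm B 1).baseChange C (1 ⊗ₜ (p i, 0, 0)) (1 ⊗ₜ (p i, 0, 0)) = 0 := by
      simp [LinearMap.BilinForm.baseChange_tmul, sumForm_apply, hp' i i (hτ' i).symm]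
    refine ⟨by simp [LinearMap.BilinForm.baseChange_tmul, sumForm_apply], fun c => ?_⟩
    rw [orthTrans_smul_of_isotropic h, ← rankOne_baseChange, ← rankOne_baseChange,
      ← LinearMap.baseChange_sub]
    exact one_add_smul_mem_rootEnds (oNilp_sq (B := B)) ⟨_, Or.inl rfl, p i, hp' i i (hτ' i).symm, rfl⟩ c
  mem_f i := by
    have h : (sumForm B 1).baseChange C (1 ⊗ₜ (p i, 0, 0)) (1 ⊗ₜ (p i, 0, 0)) = 0 := by
      simp [LinearMap.BilinForm.baseChange_tmul, sumForm_apply, hp' i i (hτ' i).symm]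
    refine ⟨by simp [LinearMap.BilinForm.baseChange_tmul, sumForm_apply], fun c => ?_⟩
    rw [orthTrans_smul_of_isotropic h, ← rankOne_baseChange, ← rankOne_baseChange,
      ← LinearMap.baseChange_sub]
    exact one_add_smul_mem_rootEnds (oNilp_sq (B := B)) ⟨_, Or.inr rfl, p i, hp' i i (hτ' i).symm, rfl⟩ c

end OrthogonalRoots

end RelDilation

namespace RelDilation

/-! ### Hyperbolic frames of `P ⊥ R²` and of `P`. -/

section OrthogonalFrames

variable {R : Type*} [CommRing R]

theorem exists_std_frame {Q : Type*} [AddCommGroup Q] [Module R Q] [Module.Finite R Q]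
    [Module.Projective R Q] {S : Type*} [CommRing S] [Algebra R S] (s : R) [IsLocalization.Away s S]
    (B : LinearMap.BilinForm R Q) {k : ℕ} (b : Module.Basis (PairIdx k) S (S ⊗[R] Q))
    (hb : IsStdBasis (B.baseChange S) 1 b) :
    ∃ (K : ℕ) (q : PairIdx k → Q), (∀ u v, B (q u) (q v) = s ^ K * stdForm k 1 u v) ∧
      ∀ x, ∑ u, B x (q (swapIdx u)) • q u = s ^ K • x := by
  obtain ⟨a, p, hp⟩ := exists_pow_smul_eq_one_tmul s b
  have hB : ∀ x y, algebraMap R S (B x y) = B.baseChange S (1 ⊗ₜ x) (1 ⊗ₜ y) := fun x y => by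
    rw [LinearMap.BilinForm.baseChange_tmul, mul_one, Algebra.algebraMap_eq_smul_one]
  have hpb : ∀ u, (1 : S) ⊗ₜ[R] p u = algebraMap R S (s ^ a) • b u := fun u => by
    rw [hp, algebraMap_smul]
  obtain ⟨t, ht⟩ := exists_pow_smul_eq_zero_of_algebraMap (S := S) s
    (fun i : PairIdx k × PairIdx k => B (p i.1) (p i.2) - s ^ (2 * a) * stdForm k 1 i.1 i.2)
    fun i => by
      rw [map_sub, hB, hpb, hpb, map_smul, map_smul, LinearMap.smul_apply, hb, map_mul]
      simp only [stdForm]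
      split_ifs <;> simp <;> ring
  obtain ⟨t', ht'⟩ := exists_pow_smul_eq_zero (S := S) s
    (∑ u, rankOne B (p u) (p (swapIdx u)) - s ^ (2 * a) • LinearMap.id) fun x => by
      simp only [LinearMap.sub_apply, LinearMap.sum_apply, rankOne_apply, LinearMap.smul_apply,
        LinearMap.id_apply, TensorProduct.tmul_sub, TensorProduct.tmul_sum,
        TensorProduct.tmul_smul, hp]
      rw [sub_eq_zero]
      conv_rhs => rw [← b.sum_repr (1 ⊗ₜ x), Finset.smul_sum]
      refine Finset.sum_congr rfl fun u _ => ?_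
      rw [← algebraMap_smul S (B x _), hB, hpb, map_smul, hb.apply_swapIdx, ← algebraMap_smul S (s ^ a),
        ← algebraMap_smul S (s ^ (2 * a)), smul_smul, smul_smul, smul_eq_mul]
      congr 1
      simp [stdSign]
      ring
  -- After localization each chosen vector is `s ^ (a + t + t')` times a basis vector, whence the
  -- doubled exponent; `t` and `t'` kill the torsion in the two relations.
  refine ⟨2 * (a + t + t'), fun u => s ^ (t + t') • p u, fun u v => ?_, fun x => ?_⟩
  · have := ht (u, v)
    simp only [map_smul, LinearMap.smul_apply, smul_eq_mul]
    linear_combination (s ^ (t + t') * s ^ t') * this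
  · have := ht' x
    rw [LinearMap.sub_apply, smul_sub, sub_eq_zero] at this
    simp only [LinearMap.sum_apply, rankOne_apply, LinearMap.smul_apply, LinearMap.id_apply] at this
    have h : ∀ u, B x (s ^ (t + t') • p (swapIdx u)) • s ^ (t + t') • p u =
        (s ^ (t + t') * s ^ t) • s ^ t' • B x (p (swapIdx u)) • p u := fun u => by
      rw [map_smul]
      simp only [smul_smul, smul_eq_mul]
      congr 1
      ring
    simp only [h, ← Finset.smul_sum]
    rw [this]
    simp only [smul_smul]
    congr 1
    ring

variable {P : Type*} [AddCommGroup P] [Module R P]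

/-- From a hyperbolic frame of `P ⊥ R²`, a hyperbolic frame of `P`. -/
theorem exists_orthElementary {B : LinearMap.BilinForm R P} (hB : B.IsSymm) {C : Type*} [CommRing C]
    [Algebra R C] {t : C} (ht : t * 2 = 1) {k : ℕ} (hk : 3 ≤ k) {κ : R}
    {q : PairIdx k → P × R × R} (hq : ∀ u v, sumForm B 1 (q u) (q v) = κ * stdForm k 1 u v)
    (hframe : ∀ x, ∑ u, sumForm B 1 x (q (swapIdx u)) • q u = κ • x) (j : PairIdx k) :
    ∃ p : {u : PairIdx k // u ≠ j ∧ u ≠ swapIdx j} → P,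
      OrthElementary (sumForm_one_comm (C := C) hB) ht (1 ⊗ₜ (0, 1, 0)) (1 ⊗ₜ (0, 0, 1))
        (fun i => 1 ⊗ₜ (p i, 0, 0))
        (fun u => ⟨swapIdx u.1, fun h => u.2.2 ((swapIdx_swapIdx u.1).symm.trans (congrArg swapIdx h)),
          fun h => u.2.1 (swapIdx_inj.1 h)⟩)
        (algebraMap R C ((q j).2.2 ^ 2 * κ)) (rootEnds C (oNilp B)) := by
  have hB' : ∀ u v, B (q u).1 (q v).1 =
      κ * stdForm k 1 u v - (q u).2.1 * (q v).2.2 - (q u).2.2 * (q v).2.1 := fun u v => by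
    rw [← hq, sumForm_apply]
    ring
  have hstd : ∀ u v : PairIdx k, v ≠ swapIdx u → stdForm k (1 : R) u v = 0 := fun u v h => by
    rw [stdForm, if_neg h]
  -- The scalar `(q u).2.2` is the pairing of `q u` with `e = (0, 1, 0)`. The combination of `q u`
  -- and `q j` with these coefficients is orthogonal to `e`, and `p u` is its image under the
  -- form-preserving projection of the complement of `e` onto `P`.
  set p : PairIdx k → P := fun u => (q j).2.2 • (q u).1 - (q u).2.2 • (q j).1 with hp
  have hpp : ∀ u v, u ≠ swapIdx j → v ≠ swapIdx j →
      B (p u) (p v) = (q j).2.2 ^ 2 * κ * stdForm k 1 u v := fun u v hu hv => by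
    simp only [hp, map_sub, map_smul, LinearMap.sub_apply, LinearMap.smul_apply, smul_eq_mul, hB']
    rw [hstd j v hv, hstd u j (fun h => hu (by rw [h, swapIdx_swapIdx])), hstd j j (swapIdx_ne j).symm]
    ring
  have hx : ∀ x : P, ∑ u, B x (q (swapIdx u)).1 • (q u).1 = κ • x ∧
      ∑ u, B x (q (swapIdx u)).1 * (q u).2.2 = 0 := fun x => by
    have h := hframe (x, 0, 0)
    simp only [sumForm_apply, zero_mul, mul_zero, add_zero] at h
    have h1 := congrArg Prod.fst h
    have h2 := congrArg (fun y : P × R × R => y.2.2) h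
    simp only [Prod.fst_sum, Prod.snd_sum, Prod.smul_fst, Prod.smul_snd, smul_eq_mul, mul_zero] at h1 h2
    exact ⟨h1, h2⟩
  have he : ∑ u, (q (swapIdx u)).2.2 • (q u).1 = 0 ∧
      ∑ u, (q (swapIdx u)).2.2 * (q u).2.2 = 0 := by
    have h := hframe (0, 1, 0)
    simp only [sumForm_apply, zero_mul, mul_zero, add_zero, map_zero, LinearMap.zero_apply, zero_add,
      one_mul] at h
    have h1 := congrArg Prod.fst h
    have h2 := congrArg (fun y : P × R × R => y.2.2) h
    simp only [Prod.fst_sum, Prod.snd_sum, Prod.smul_fst, Prod.smul_snd, smul_eq_mul, mul_zero,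
      smul_zero] at h1 h2
    exact ⟨h1, h2⟩
  have hframe' : ∀ x : P, ((q j).2.2 ^ 2 * κ) • x = ∑ u, B x (p (swapIdx u)) • p u := fun x => by
    have h : ∀ u, B x (p (swapIdx u)) • p u =
        (q j).2.2 ^ 2 • B x (q (swapIdx u)).1 • (q u).1 -
          ((q j).2.2 * (B x (q (swapIdx u)).1 * (q u).2.2)) • (q j).1 -
          ((q j).2.2 * B x (q j).1) • (q (swapIdx u)).2.2 • (q u).1 +
          (B x (q j).1 * ((q (swapIdx u)).2.2 * (q u).2.2)) • (q j).1 := fun u => by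
      simp only [hp, map_sub, map_smul, smul_eq_mul]
      module
    simp only [h, Finset.sum_add_distrib, Finset.sum_sub_distrib, ← Finset.smul_sum,
      ← Finset.sum_smul, ← Finset.mul_sum, hx, he]
    module
  refine ⟨fun u => p u, orthElementary hB ht (fun u => Subtype.ext (swapIdx_swapIdx _))
    (fun u h => swapIdx_ne u.1 (congrArg Subtype.val h)) (fun u => ?_) (fun u => ?_)
    (fun u v huv => ?_) (fun x => ?_)⟩
  · obtain ⟨a, -, ha⟩ := Finset.exists_mem_notMem_of_card_lt_card
      (s := ({u.1.1, j.1} : Finset (Fin k))) (t := Finset.univ)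
      (by simpa using (Finset.card_le_two).trans_lt (by omega))
    simp only [Finset.mem_insert, Finset.mem_singleton, not_or] at ha
    refine ⟨⟨(a, false), fun h => ha.2 (congrArg Prod.fst h), fun h => ha.2 (congrArg Prod.fst h)⟩,
      fun h => ha.1 (congrArg (fun v => v.1.1) h), fun h => ha.1 (congrArg (fun v => v.1.1) h)⟩
  · rw [hpp _ _ u.2.2 fun h => u.2.1 (swapIdx_inj.1 h)]
    simp [stdForm]
  · rw [hpp _ _ u.2.2 v.2.2, hstd, mul_zero]
    exact fun h => huv (Subtype.ext h)
  -- The two omitted indices contribute nothing, since `p j = 0`.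
  · rw [hframe', ← Finset.sum_subtype (Finset.univ.filter fun u => u ≠ j ∧ u ≠ swapIdx j)
      (by simp) (fun u => B x (p (swapIdx u)) • p u), Finset.sum_filter_of_ne]
    intro u _ hu
    have hpj : p j = 0 := by simp [hp]
    refine ⟨?_, ?_⟩
    · rintro rfl
      rw [hpj, smul_zero] at hu
      exact hu rfl
    · rintro rfl
      rw [swapIdx_swapIdx, hpj, map_zero, zero_smul] at hu
      exact hu rfl

/-- A local-global argument. The scalars that turn all Koszul vectors into elementary parameters
form an ideal. The frame of `P` built from index `j` puts `(q j).2.2 * s ^ K` into its radical, and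
these coordinates together generate `s ^ K`. -/
theorem exists_pow_smul_koszul_mem {B : LinearMap.BilinForm R P} (hB : B.IsSymm) {C : Type*}
    [CommRing C] [Algebra R C] {t : C} (ht : t * 2 = 1) {k : ℕ} (hk : 3 ≤ k) {s : R} {K : ℕ}
    {q : PairIdx k → P × R × R} (hq : ∀ u v, sumForm B 1 (q u) (q v) = s ^ K * stdForm k 1 u v)
    (hframe : ∀ x, ∑ u, sumForm B 1 x (q (swapIdx u)) • q u = s ^ K • x) :
    ∃ N : ℕ, ∀ u v w (hw : (sumForm B 1).baseChange C w w = 0),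
      algebraMap R C (s ^ N) • koszul ((sumForm B 1).baseChange C) w u v ∈
        transSub (sumForm_one_comm (C := C) hB) ht (rootEnds C (oNilp B)) hw := by
  let 𝔤 : Ideal R :=
    { carrier := {r | ∀ u v w (hw : (sumForm B 1).baseChange C w w = 0),
        algebraMap R C r • koszul ((sumForm B 1).baseChange C) w u v ∈
          transSub (sumForm_one_comm (C := C) hB) ht (rootEnds C (oNilp B)) hw}
      add_mem' := fun h h' u v w hw => by
        rw [map_add, add_smul]
        exact add_mem (h u v w hw) (h' u v w hw)
      zero_mem' := fun u v w hw => by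
        rw [map_zero, zero_smul]
        exact zero_mem _
      smul_mem' := fun c x h u v w hw => by
        rw [smul_eq_mul, map_mul, mul_smul]
        exact Submodule.smul_mem _ _ (h u v w hw) }
  have h1 : ∀ j, (q j).2.2 * s ^ K ∈ 𝔤.radical := fun j => by
    have h2 : (q j).2.2 ^ 2 * s ^ K ∈ 𝔤.radical := by
      refine ⟨5, fun u v w hw => ?_⟩
      obtain ⟨p, hp⟩ := exists_orthElementary hB ht hk hq hframe j
      have : Nonempty {u : PairIdx k // u ≠ j ∧ u ≠ swapIdx j} := by
        have : Nontrivial (Fin k) := Fin.nontrivial_iff_two_le.2 (by omega)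
        obtain ⟨a, ha⟩ := exists_ne j.1
        exact ⟨(a, false), fun h => ha (congrArg Prod.fst h), fun h => ha (congrArg Prod.fst h)⟩
      rw [map_pow]
      exact hp.koszul_mem u v w hw
    refine (Ideal.radical_isRadical 𝔤) ⟨2, ?_⟩
    have : ((q j).2.2 * s ^ K) ^ 2 = s ^ K * ((q j).2.2 ^ 2 * s ^ K) := by ring
    rw [this]
    exact Ideal.mul_mem_left _ _ h2
  -- The last coordinate of the frame relation at `(0, 0, 1)` writes `s ^ K` as a linear combination
  -- of the `(q j).2.2`.
  have h3 : s ^ K * s ^ K ∈ 𝔤.radical := by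
    have h := congrArg (fun y : P × R × R => y.2.2) (hframe (0, 0, 1))
    simp only [sumForm_apply, Prod.snd_sum, Prod.smul_snd, smul_eq_mul, mul_one] at h
    nth_rewrite 1 [← h]
    rw [Finset.sum_mul]
    refine Ideal.sum_mem _ fun j _ => ?_
    rw [mul_assoc]
    exact Ideal.mul_mem_left _ _ (h1 j)
  obtain ⟨n, hn⟩ := h3
  refine ⟨(K + K) * n, ?_⟩
  rw [← pow_add, ← pow_mul] at hn
  exact hn

end OrthogonalFrames

/-! ### Denominators and conclusion in the orthogonal case. -/

section OrthogonalDenominators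

universe u v

variable {R : Type u} [CommRing R] {P : Type v} [AddCommGroup P] [Module R P] {S : Type u}
  [CommRing S] [Algebra R S]

theorem rankOne_smul_smul {C V : Type*} [CommRing C] [AddCommGroup V] [Module C V]
    (ω : LinearMap.BilinForm C V) (a b : C) (u v : V) :
    rankOne ω (a • u) (b • v) = (a * b) • rankOne ω u v := by
  refine LinearMap.ext fun x => ?_
  simp only [rankOne_apply, LinearMap.smul_apply, map_smul, smul_eq_mul]
  module

/-- A conjugated root element is the transvection of an isotropic orthogonal pair `u, v` for which
some `v'` satisfies `⟨v, v'⟩ = 1`. Then `u = ⟨v, v'⟩ u - ⟨v, u⟩ v'` is a Koszul vector for the axis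
`v`, so lifts of `u` and `v` give an elementary transvection after multiplication by a power of `s`.
-/
theorem hasDenominators_orthogonal [Module.Finite R P] [Module.Projective R P]
    (h2 : IsUnit (2 : R)) {B : LinearMap.BilinForm R P} (hB : B.IsSymm) (s : R)
    [IsLocalization.Away s S] {k : ℕ} (hk : 3 ≤ k)
    (b : Module.Basis (PairIdx k) S (S ⊗[R] (P × R × R)))
    (hb : IsStdBasis ((sumForm B 1).baseChange S) 1 b) :
    HasDenominators s b (oRoots k) (oNilp B) := by
  rintro C C' _ _ _ _ _ _ loc hloc γ hγ Y hY
  obtain ⟨K, q, hq, hframe⟩ := exists_std_frame s (sumForm B 1) b hb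
  obtain ⟨t, ht⟩ : ∃ t : C, t * 2 = 1 := by
    obtain ⟨t, ht⟩ := h2.exists_left_inv
    exact ⟨algebraMap R C t, by rw [← map_ofNat (algebraMap R C) 2, ← map_mul, ht, map_one]⟩
  obtain ⟨N, hN⟩ := exists_pow_smul_koszul_mem hB ht hk hq hframe
  set ω := (sumForm B 1).baseChange C with hωdef
  set ω' := (sumForm B 1).baseChange C' with hωdef'
  have hω : ∀ x y, ω x y = ω y x := sumForm_one_comm hB
  have hb' : IsStdBasis ω' 1 (extBasis C' b) := by
    simpa using isStdBasis_extBasis (C := C') hb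
  obtain ⟨u, v, v', huu, hvv, huv, hvv', h⟩ :=
    hb'.conj_oRoot (hb'.isometry_o (sumForm_one_comm hB) hγ) hY
  have hnat : ∀ x y, loc (ω x y) = ω' (scalarMap _ loc x) (scalarMap _ loc y) := fun x y =>
    (baseChange_scalarMap (sumForm B 1) loc x y).symm
  have lift : ∀ x : C' ⊗[R] (P × R × R), ∃ n y, scalarMap _ loc y = algebraMap R C' (s ^ n) • x :=
    fun x => by
      obtain ⟨n, y, hy⟩ := exists_scalarMap_eq hloc x
      exact ⟨n, y, by rw [← hy, algebraMap_smul]⟩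
  obtain ⟨n₁, x, hx⟩ := lift u
  obtain ⟨n₂, y, hy⟩ := lift v
  obtain ⟨n₃, y', hy'⟩ := lift v'
  obtain ⟨k₁, hk₁⟩ := hloc.2 (ω x x) (by rw [hnat, hx]; simp [huu])
  obtain ⟨k₂, hk₂⟩ := hloc.2 (ω y y) (by rw [hnat, hy]; simp [hvv])
  obtain ⟨k₃, hk₃⟩ := hloc.2 (ω x y) (by rw [hnat, hx, hy]; simp [huv])
  obtain ⟨k₄, hk₄⟩ := hloc.2 (ω y y' - algebraMap R C (s ^ (n₂ + n₃))) (by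
    rw [map_sub, hnat, hy, hy', AlgHom.commutes]
    simp [hvv', pow_add]
    ring)
  rw [Algebra.smul_def] at hk₁ hk₂ hk₃ hk₄
  -- The lifts are isotropic, orthogonal and correctly paired only up to `s`-torsion; multiplying
  -- `x` and `y` by `s ^ T` makes all the relations exact.
  set T := k₁ + k₂ + k₃ + k₄ with hT
  have hpow : algebraMap R C (s ^ T) = algebraMap R C (s ^ k₁) * algebraMap R C (s ^ k₂) *
      algebraMap R C (s ^ k₃) * algebraMap R C (s ^ k₄) := by
    rw [← map_mul, ← map_mul, ← map_mul, ← pow_add, ← pow_add, ← pow_add]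
  set a := algebraMap R C (s ^ T) with ha
  have e₁ : ω (a • x) (a • x) = 0 := by
    simp only [map_smul, LinearMap.smul_apply, smul_eq_mul]
    rw [hpow]
    linear_combination (algebraMap R C (s ^ k₂) * algebraMap R C (s ^ k₃) * algebraMap R C (s ^ k₄) *
      (algebraMap R C (s ^ k₁) * algebraMap R C (s ^ k₂) * algebraMap R C (s ^ k₃) *
        algebraMap R C (s ^ k₄))) * hk₁
  have e₂ : ω (a • y) (a • y) = 0 := by
    simp only [map_smul, LinearMap.smul_apply, smul_eq_mul]
    rw [hpow]
    linear_combination (algebraMap R C (s ^ k₁) * algebraMap R C (s ^ k₃) * algebraMap R C (s ^ k₄) *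
      (algebraMap R C (s ^ k₁) * algebraMap R C (s ^ k₂) * algebraMap R C (s ^ k₃) *
        algebraMap R C (s ^ k₄))) * hk₂
  have e₃ : ω (a • y) (a • x) = 0 := by
    rw [hω]
    simp only [map_smul, LinearMap.smul_apply, smul_eq_mul]
    rw [hpow]
    linear_combination (algebraMap R C (s ^ k₁) * algebraMap R C (s ^ k₂) * algebraMap R C (s ^ k₄) *
      (algebraMap R C (s ^ k₁) * algebraMap R C (s ^ k₂) * algebraMap R C (s ^ k₃) *
        algebraMap R C (s ^ k₄))) * hk₃
  have e₄ : ω (a • y) y' = a * algebraMap R C (s ^ (n₂ + n₃)) := by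
    simp only [map_smul, LinearMap.smul_apply, smul_eq_mul]
    rw [hpow]
    linear_combination (algebraMap R C (s ^ k₁) * algebraMap R C (s ^ k₂) *
      algebraMap R C (s ^ k₃)) * hk₄
  have hmem := hN y' (a • x) (a • y) e₂
  rw [koszul_apply, e₃, zero_smul, sub_zero, e₄, smul_smul] at hmem
  -- The terms are the Koszul exponent `N`, the pairing of `a • y` with `y'`, and the scalings of `a
  -- • x` and `a • y` relative to `u` and `v`.
  refine ⟨N + (T + (n₂ + n₃)) + (T + n₁) + (T + n₂), fun z => ?_⟩
  have hz := hmem.2 z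
  rw [smul_smul, orthTrans_smul_of_isotropic e₁] at hz
  obtain ⟨σ, hσ, e⟩ := hz
  refine ⟨σ, hσ, ?_⟩
  have hsub : ∀ x y : C ⊗[R] (P × R × R), extend loc (rankOne ω x y - rankOne ω y x) =
      rankOne ω' (scalarMap _ loc x) (scalarMap _ loc y) -
        rankOne ω' (scalarMap _ loc y) (scalarMap _ loc x) := fun x y =>
    eq_extend loc fun w => by
      simp only [LinearMap.sub_apply, rankOne_apply, map_sub, ← hnat, scalarMap_smul]
  have hcs : ∀ (c d : C') (X Y : Module.End C' (C' ⊗[R] (P × R × R))),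
      c • (d • X - d • Y) = (c * d) • (X - Y) := fun c d X Y => by module
  rw [e, extend_one_add_smul, hsub]
  change _ = 1 + _ • Matrix.toLinAlgEquiv (extBasis C' b) _
  rw [h, scalarMap_smul, scalarMap_smul, hx, hy, smul_smul, smul_smul, rankOne_smul_smul,
    rankOne_smul_smul, mul_comm (_ * algebraMap R C' (s ^ n₂))]
  refine (congrArg (1 + ·) (hcs _ _ _ _)).trans ?_
  congr 2
  simp only [ha, map_mul, AlgHom.commutes, Algebra.smul_def, pow_add]
  ring

theorem dilation_orthogonal [Module.Finite R P] [Module.Projective R P] (h2 : IsUnit (2 : R))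
    (I : Ideal R) {s : R} {m : ℕ} (hm : 2 ≤ m) {B : LinearMap.BilinForm R P} (hB : IsOrthogonal B)
    (σ : (R[X] ⊗[R] (P × R × R)) ≃ₗ[R[X]] (R[X] ⊗[R] (P × R × R)))
    (h0 : atZero σ.toLinearMap = LinearMap.id)
    (hσ : LocElemO (m + 1) (sumForm B 1) I s σ.toLinearMap) :
    ∃ l : ℕ, 0 < l ∧ ∀ b ∈ Ideal.span {s ^ l},
      ∃ τ ∈ relETransO R[X] B (I.map (algebraMap R R[X])),
        atZero τ.toLinearMap = LinearMap.id ∧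
        localize s τ.toLinearMap = localize s (scale b σ.toLinearMap) := by
  obtain ⟨b, hb, hσ⟩ := hσ
  exact exists_dilation_of_matrixMem s I b oRoots_sq oNilp_sq
    (hasDenominators_orthogonal h2 hB.1 s (by omega) b hb) (orthogonalGens (m + 1))
    orthogonalGens_subset (transOGens R[X] B) (rootAuts_oNilp_subset R[X]) σ h0 hσ

end OrthogonalDenominators

end RelDilation

end

open RelDilation in
theorem mainTheorem4 {R : Type*} [CommRing R] (h2 : IsUnit (2 : R)) (I : Ideal R) (hI : I ≠ ⊤)
    {P : Type*} [AddCommGroup P] [Module R P] [Module.Finite R P] [Module.Projective R P]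
    (n : ℕ) (hrank : ∀ p : PrimeSpectrum R, Module.rankAtStalk (R := R) P p = n)
    (s : R) (hs : ¬ IsNilpotent s)
    (hfree : Module.Free (Localization.Away s) (Localization.Away s ⊗[R] P)) :
    -- the linear case
    (2 ≤ n →
      ∀ σ : (R[X] ⊗[R] (P × R)) ≃ₗ[R[X]] (R[X] ⊗[R] (P × R)),
        CongrOne (I.map (algebraMap R R[X])) σ →
        atZero σ.toLinearMap = LinearMap.id →
        LocElemLin n I s σ.toLinearMap →
        ∃ l : ℕ, 0 < l ∧ ∀ b ∈ Ideal.span {s ^ l},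
          ∃ τ ∈ relETrans R[X] P (I.map (algebraMap R R[X])),
            atZero τ.toLinearMap = LinearMap.id ∧
            localize s τ.toLinearMap = localize s (scale b σ.toLinearMap)) ∧
    -- the symplectic case
    (∀ m : ℕ, n = 2 * m → 6 ≤ n →
      ∀ B : LinearMap.BilinForm R P, IsSymplectic B → H2 (m + 1) (sumForm B (-1)) (-1) →
      ∀ σ : (R[X] ⊗[R] (P × R × R)) ≃ₗ[R[X]] (R[X] ⊗[R] (P × R × R)),
        IsIsometry ((sumForm B (-1)).baseChange R[X]) σ →
        CongrOne (I.map (algebraMap R R[X])) σ →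
        atZero σ.toLinearMap = LinearMap.id →
        LocElemSp (m + 1) (sumForm B (-1)) I s σ.toLinearMap →
        ∃ l : ℕ, 0 < l ∧ ∀ b ∈ Ideal.span {s ^ l},
          ∃ τ ∈ relETransSp R[X] B (I.map (algebraMap R R[X])),
            atZero τ.toLinearMap = LinearMap.id ∧
            localize s τ.toLinearMap = localize s (scale b σ.toLinearMap)) ∧
    -- the orthogonal case
    (∀ m : ℕ, n = 2 * m → 6 ≤ n →
      ∀ B : LinearMap.BilinForm R P, IsOrthogonal B → H2 (m + 1) (sumForm B 1) 1 →
      ∀ σ : (R[X] ⊗[R] (P × R × R)) ≃ₗ[R[X]] (R[X] ⊗[R] (P × R × R)),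
        IsIsometry ((sumForm B 1).baseChange R[X]) σ →
        CongrOne (I.map (algebraMap R R[X])) σ →
        atZero σ.toLinearMap = LinearMap.id →
        LocElemO (m + 1) (sumForm B 1) I s σ.toLinearMap →
        ∃ l : ℕ, 0 < l ∧ ∀ b ∈ Ideal.span {s ^ l},
          ∃ τ ∈ relETransO R[X] B (I.map (algebraMap R R[X])),
            atZero τ.toLinearMap = LinearMap.id ∧
            localize s τ.toLinearMap = localize s (scale b σ.toLinearMap)) := by
  exact ⟨fun hn σ _ h0 hσ => dilation_linear I s hn σ h0 hσ,
    fun m _ hm B hB _ σ _ _ h0 hσ => dilation_symplectic h2 I hs hfree (by omega) hB σ h0 hσ,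
    fun m _ hm B hB _ σ _ _ h0 hσ => dilation_orthogonal h2 I (by omega) hB σ h0 hσ⟩
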